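/- Let $\mathbf k$ be an algebraically closed field and let $\Lambda$ be a gentle $\mathbf k$-algebra, i.e. a $\mathbf k$-algebra Morita equivalent to $\mathbf kQ/I$, where $Q$ is a finite quiver and $I$ is an admissible ideal generated by paths of length two such that at most two arrows start and at most two arrows end at each vertex, and for each arrow $a$ there is at most one arrow $b$ with $s(b)=e(a)$, $ba\notin I$, at most one arrow $b$ with $s(b)=e(a)$, $ba\in I$, at most one arrow $c$ with $e(c)=s(a)$, $ac\notin I$, and at most one arrow $c$ with $e(c)=s(a)$, $ac\in I$. Paths are read from right to left and modules are left modules. For a homotopy string $\sigma$ (trivial, finite or infinite) with its decomposition into homotopy letters (nontrivial paths in $(Q,I)$ or their inverses), $P^\bullet_\sigma$ denotes its string complex; for a homotopy band $\tau$ and $\mu\in\mathbf k^*$, $B^\bullet_{\tau,\mu}$ denotes the one-dimensional band complex with the scalar $\mu$ placed on one letter of $\tau$. Words are read from left to right in unfolded diagrams: a direct letter $p$ is the map $P(e(p))\to P(s(p))$ given by right multiplication by $p$, and an inverse letter $\bar p$ is the same map, drawn from right to left. Let $\sigma=\beta\sigma_L\rho\sigma_R\alpha$ be a homotopy string and let $\tau=\delta\tau_L\rho\tau_R\gamma$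 be a homotopy band, where $\tau_L,\tau_R$ are homotopy letters, each of $\sigma_L,\sigma_R$ is a homotopy letter or empty (if $\sigma_L$ is empty, so is $\beta$; if $\sigma_R$ is empty, so is $\alpha$), and $\rho$ is a finite, possibly trivial, common homotopy substring placed in the same cohomological degrees in $P^\bullet_\sigma$ and $B^\bullet_{\tau,\mu}$. Suppose that $\sigma_R,\tau_R$ satisfy one of the right endpoint conditions 1. $\sigma_R=p$ and $\tau_R=pf_R$ are direct, with $f_R$ a nontrivial path; 2. $\sigma_R=\bar\omega\bar f_R$ and $\tau_R=\bar\omega$ are inverse, with $f_R$ a nontrivial path; 3. $\sigma_R$ is empty or direct, and $\tau_R$ is inverse (there is no component $f_R$); and that $\bar\sigma_L,\bar\tau_L$ satisfy one of the same conditions with $f_L$ in place of $f_R$. Let $f^\bullet\colon P^\bullet_\sigma\to B^\bullet_{\tau,\mu}$ be the corresponding graph map, i.e. the chain map whose components are the identities on the vertices of $\rho$, the paths $f_L$ and $f_R$ (where they exist) at the adjacent vertices, and zero otherwise, up to the nonzero scalars required by the position of $\mu$. Suppose that $\sigma$ and $\tau$ are compatibly oriented: if $\rho$ is trivial and neither $f_L$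 nor $f_R$ exists, then $\sigma_L\bar\tau_L\neq0$ (if $\sigma_L$ is nonempty) and $\bar\tau_R\sigma_R\neq0$ (if $\sigma_R$ is nonempty), meaning that these composites are paths, or inverses of paths, that do not lie in $I$. Then $$c=\beta\,\sigma_L\bar\tau_L\,\bar\delta\,\bar\gamma\,\bar\tau_R\sigma_R\,\alpha$$ is a homotopy string and the mapping cone $M^\bullet_{f^\bullet}$ is isomorphic to the string complex $P^\bullet_c$ in the homotopy category $\mathsf K^{b,-}(\operatorname{proj}\Lambda)$, where the vertices of $\bar\delta\bar\gamma$ are placed in the degrees which they have in $B^\bullet_{\tau,\mu}$. Here $\sigma_L\bar\tau_L$ and $\bar\tau_R\sigma_R$ are reduced to single homotopy letters: $\bar\tau_R\sigma_R$ is $\bar f_R$ in cases 1 and 2, and the direct letter $\bar\tau_R\sigma_R$ in case 3 with $\sigma_R$ nonempty; dually, $\sigma_L\bar\tau_L$ is $f_L$ or the inverse letter $\sigma_L\bar\tau_L$. If $\sigma_L$ is empty, the part $\beta\sigma_L\bar\tau_L$ of $c$ is omitted, and if $\sigma_R$ is empty, the part $\bar\tau_R\sigma_R\alpha$ of $c$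 is omitted. -/

import Mathlib

open CategoryTheory

universe u

namespace GentleCone

/-! ### Quivers with relations, gentle algebras -/

/-- The arrows of a quiver; `a.left` is the source `s(a)` and `a.right` is the target `e(a)`. -/
abbrev Arrow (V : Type u) [Quiver.{u} V] : Type u := Quiver.Total V

section Algebra

variable (k : Type u) [Field k] {V : Type u} [Fintype V] [Quiver.{u} V]

/-- The defining relations of the path algebra on the stationary paths (`Sum.inl`) and the
arrows (`Sum.inr`). Paths are read from right to left: `b * a` is "first `a`, then `b`". -/
inductive PathRel : FreeAlgebra k (V ⊕ Arrow V) → FreeAlgebra k (V ⊕ Arrow V) → Prop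
  | idem (x : V) : PathRel
      (FreeAlgebra.ι k (Sum.inl x) * FreeAlgebra.ι k (Sum.inl x)) (FreeAlgebra.ι k (Sum.inl x))
  | orth (x y : V) (h : x ≠ y) : PathRel
      (FreeAlgebra.ι k (Sum.inl x) * FreeAlgebra.ι k (Sum.inl y)) 0
  | one : PathRel (∑ x : V, FreeAlgebra.ι k (Sum.inl x)) 1
  | target (a : Arrow V) : PathRel
      (FreeAlgebra.ι k (Sum.inl a.right) * FreeAlgebra.ι k (Sum.inr a)) (FreeAlgebra.ι k (Sum.inr a))
  | source (a : Arrow V) : PathRel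
      (FreeAlgebra.ι k (Sum.inr a) * FreeAlgebra.ι k (Sum.inl a.left)) (FreeAlgebra.ι k (Sum.inr a))

variable (V) in
/-- The path algebra `kQ`. -/
def PathAlgebra : Type u := RingQuot (PathRel k (V := V))

noncomputable instance : Ring (PathAlgebra k V) := inferInstanceAs (Ring (RingQuot _))

noncomputable instance : Algebra k (PathAlgebra k V) := inferInstanceAs (Algebra k (RingQuot _))

variable (V) in
/-- The quotient map from the free algebra onto `kQ`. -/
noncomputable def PathAlgebra.mk : FreeAlgebra k (V ⊕ Arrow V) →ₐ[k] PathAlgebra k V :=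
  RingQuot.mkAlgHom k (PathRel k)

/-- The arrow `a` as an element of `kQ`. -/
noncomputable def PathAlgebra.arrow (a : Arrow V) : PathAlgebra k V :=
  PathAlgebra.mk k V (FreeAlgebra.ι k (Sum.inr a))

/-- The stationary path at `x` as an element of `kQ`. -/
noncomputable def PathAlgebra.vertex (x : V) : PathAlgebra k V :=
  PathAlgebra.mk k V (FreeAlgebra.ι k (Sum.inl x))

/-- The length two monomials `a b` (first `b`, then `a`) with `R a b` are set to zero. -/
inductive MonomialRel (R : Arrow V → Arrow V → Prop) : PathAlgebra k V → PathAlgebra k V → Prop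
  | mk (a b : Arrow V) (h : R a b) :
      MonomialRel R (PathAlgebra.arrow k a * PathAlgebra.arrow k b) 0

/-- The algebra `kQ/I`, with `I` the two-sided ideal generated by the length two monomials `a b`
with `R a b`. -/
def BoundAlgebra (R : Arrow V → Arrow V → Prop) : Type u := RingQuot (MonomialRel k R)

variable (R : Arrow V → Arrow V → Prop)

noncomputable instance : Ring (BoundAlgebra k R) := inferInstanceAs (Ring (RingQuot _))

noncomputable instance : Algebra k (BoundAlgebra k R) := inferInstanceAs (Algebra k (RingQuot _))

/-- The quotient map `kQ → kQ/I`. -/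
noncomputable def BoundAlgebra.mk : PathAlgebra k V →ₐ[k] BoundAlgebra k R :=
  RingQuot.mkAlgHom k (MonomialRel k R)

/-- The arrow `a` in `kQ/I`. -/
noncomputable def arrowElt (a : Arrow V) : BoundAlgebra k R :=
  BoundAlgebra.mk k R (PathAlgebra.arrow k a)

/-- The primitive idempotent `e_x` of `kQ/I`; by convention it is `0` for "no vertex". -/
noncomputable def idemElt : Option V → BoundAlgebra k R
  | some x => BoundAlgebra.mk k R (PathAlgebra.vertex k x)
  | none => 0

/-- The element `a_n ⋯ a_1` of `kQ/I` given by the list `[a_n, …, a_1]`. -/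
noncomputable def pathElt (p : List (Arrow V)) : BoundAlgebra k R := (p.map (arrowElt k R)).prod

end Algebra

section Combinatorics

variable {V : Type u} [Quiver.{u} V] (R : Arrow V → Arrow V → Prop)

/-- `[a_n, …, a_1]` is a nontrivial path `a_n ⋯ a_1` in `(Q, I)`, that is, a nontrivial path of `Q`
which is not in `I`. -/
def IsPath (p : List (Arrow V)) : Prop :=
  p ≠ [] ∧ p.IsChain (fun a b => a.left = b.right ∧ ¬ R a b)

/-- `(Q, I)` is a gentle bound quiver, where `I` is generated by the length two paths `a b` (first
`b`, then `a`) with `R a b`. Admissibility of `I` says that the paths outside `I` have bounded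
length. -/
structure IsGentle : Prop where
  composable : ∀ a b, R a b → a.left = b.right
  admissible : ∃ N : ℕ, ∀ p, IsPath R p → p.length ≤ N
  starting : ∀ x : V, {a : Arrow V | a.left = x}.encard ≤ 2
  ending : ∀ x : V, {a : Arrow V | a.right = x}.encard ≤ 2
  left_nonrel : ∀ a : Arrow V, {b : Arrow V | b.left = a.right ∧ ¬ R b a}.encard ≤ 1
  right_nonrel : ∀ a : Arrow V, {c : Arrow V | a.left = c.right ∧ ¬ R a c}.encard ≤ 1
  left_rel : ∀ a : Arrow V, {b : Arrow V | b.left = a.right ∧ R b a}.encard ≤ 1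
  right_rel : ∀ a : Arrow V, {c : Arrow V | a.left = c.right ∧ R a c}.encard ≤ 1

/-! ### Homotopy letters, strings and bands -/

variable (V) in
/-- A homotopy letter: the path `p = a_n ⋯ a_1` given by the list `[a_n, …, a_1]` if `direct` is
true, and the inverse `p̄` of this path otherwise. Letters are read from left to right, so the left
end of a direct letter `p` is the target of `p` and its right end is the source of `p`. -/
structure Letter where
  direct : Bool
  path : List (Arrow V)

namespace Letter

/-- The inverse letter. -/
def inv (l : Letter V) : Letter V := ⟨!l.direct, l.path⟩

/-- The vertex at the left end. -/
def leftEnd (l : Letter V) : Option V :=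
  if l.direct then l.path.head?.map (·.right) else l.path.getLast?.map (·.left)

/-- The vertex at the right end. -/
def rightEnd (l : Letter V) : Option V :=
  if l.direct then l.path.getLast?.map (·.left) else l.path.head?.map (·.right)

/-- The change of cohomological degree from the left end to the right end. -/
def sign (l : Letter V) : ℤ := if l.direct then 1 else -1

end Letter

/-- The letter `l` may be followed on its right by the letter `m` in a homotopy string, that is, `l`
and `m` are consecutive letters in the letter decomposition of `l m`:
they meet at a vertex; if both are direct (both are inverse), the two arrows meeting
there have composition in `I`; if their orientations differ, then no arrow cancels. -/
def Adj (l m : Letter V) : Prop :=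
  l.rightEnd = m.leftEnd ∧
  match l.direct, m.direct with
  | true, true => ∀ a ∈ l.path.getLast?, ∀ b ∈ m.path.head?, R a b
  | false, false => ∀ b ∈ m.path.getLast?, ∀ a ∈ l.path.head?, R b a
  | true, false => l.path.getLast? ≠ m.path.getLast?
  | false, true => l.path.head? ≠ m.path.head?

variable (V) in
/-- A (finite or infinite) word in letters with a chosen base vertex. All letters are read from left
to right; `right` lists the letters to the right of the base vertex and
`left` lists the letters to the left of the base vertex, in both cases the letter nearest to the
base vertex comes first. If both are empty the word is the trivial word at `base`. -/
structure Word where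
  base : V
  left : Stream'.Seq (Letter V)
  right : Stream'.Seq (Letter V)

namespace Word

/-- The vertices of the word are numbered by integers from left to right, the base vertex being `0`;
`w.letter i` is the letter between the vertices `i` and `i + 1`, if there is one. -/
def letter (w : Word V) : ℤ → Option (Letter V)
  | Int.ofNat m => w.right.get? m
  | Int.negSucc m => w.left.get? m

/-- The vertex of the quiver at position `i` (`none` beyond the ends of the word). -/
def label (w : Word V) : ℤ → Option V
  | Int.ofNat 0 => some w.base
  | Int.ofNat (m + 1) => (w.right.get? m).bind Letter.rightEnd
  | Int.negSucc m => (w.left.get? m).bind Letter.leftEnd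

/-- The cohomological degree at position `i`, if the base vertex is in degree `d`. -/
def deg (w : Word V) (d : ℤ) : ℤ → ℤ
  | Int.ofNat m => d + ∑ j ∈ Finset.range m, ((w.right.get? j).elim 0 Letter.sign)
  | Int.negSucc m => d - ∑ j ∈ Finset.range (m + 1), ((w.left.get? j).elim 0 Letter.sign)

/-- The word is a (possibly trivial, possibly infinite) homotopy string, decomposed into its homotopy
letters. If it is infinite to the right (left) then it ends in an inverse (begins with a direct)
antipath. -/
structure IsHomotopyString (w : Word V) : Prop where
  isPath : ∀ i, ∀ l ∈ w.letter i, IsPath R l.path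
  leftEnd_base : ∀ l ∈ w.letter 0, l.leftEnd = some w.base
  rightEnd_base : ∀ l ∈ w.letter (-1), l.rightEnd = some w.base
  adj : ∀ i, ∀ l ∈ w.letter i, ∀ m ∈ w.letter (i + 1), Adj R l m
  antipath_right : ∃ N, ∀ m, N ≤ m → ∀ l ∈ w.right.get? m, l.direct = false ∧ l.path.length = 1
  antipath_left : ∃ N, ∀ m, N ≤ m → ∀ l ∈ w.left.get? m, l.direct = true ∧ l.path.length = 1

end Word

/-- The list `t` of homotopy letters (from left to right) is a homotopy band: cyclically consecutive
letters may follow each other (so `t t` is a homotopy string with the evident letters, and every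
rotation of `t` is again a homotopy band), `t` is not a proper power,
and it has equal numbers of direct and inverse letters. -/
structure IsHomotopyBand (t : List (Letter V)) : Prop where
  ne_nil : t ≠ []
  isPath : ∀ l ∈ t, IsPath R l.path
  cyclic : (t ++ t).IsChain (Adj R)
  primitive : ∀ (s : List (Letter V)) (m : ℕ), 1 < m → t ≠ (List.replicate m s).flatten
  balanced : t.countP (fun l => l.direct) = t.countP (fun l => !l.direct)

end Combinatorics

/-! ### The complex of an unfolded diagram -/

section Complex

variable (k : Type u) [Field k] {V : Type u} [Quiver.{u} V]

variable (V) in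
/-- An unfolded diagram with positions `ι` (the integers, or the integers modulo `n`): the letter
`letter i`, with scalar `scalar i`, joins position `i` on its left to position `i + 1` on its right;
`label i` is the vertex of the quiver at position `i` (if any) and
`deg i` is the cohomological degree. -/
structure Diagram (ι : Type) where
  letter : ι → Option (Letter V)
  scalar : ι → k
  label : ι → Option V
  deg : ι → ℤ

variable {k} {ι : Type}

/-- Consistency of an unfolded diagram. -/
structure Diagram.Valid [AddGroupWithOne ι] (R : Arrow V → Arrow V → Prop) (D : Diagram k V ι) : Prop where
  isPath : ∀ i, ∀ l ∈ D.letter i, IsPath R l.path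
  leftEnd : ∀ i, ∀ l ∈ D.letter i, D.label i = l.leftEnd
  rightEnd : ∀ i, ∀ l ∈ D.letter i, D.label (i + 1) = l.rightEnd
  deg : ∀ i, ∀ l ∈ D.letter i, D.deg (i + 1) = D.deg i + l.sign
  adj : ∀ i, ∀ l ∈ D.letter i, ∀ m ∈ D.letter (i + 1), Adj R l m

variable [Fintype V] (R : Arrow V → Arrow V → Prop)

variable (k) in
/-- The element of the algebra given by a direct letter, and `0` otherwise. -/
noncomputable def forward : Option (Letter V) → BoundAlgebra k R
  | some ⟨true, p⟩ => pathElt k R p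
  | _ => 0

variable (k) in
/-- The element of the algebra given by the path `p` for an inverse letter `p̄`, `0` otherwise. -/
noncomputable def backward : Option (Letter V) → BoundAlgebra k R
  | some ⟨false, p⟩ => pathElt k R p
  | _ => 0

namespace Diagram

variable (D : Diagram k V ι)

/-- The component in degree `d` is `⨁_{deg i = d} P(label i)`, with `P(x)` the left ideal
generated by `e_x`, realised inside the free module on the positions. -/
def piece (d : ℤ) : Submodule (BoundAlgebra k R) (ι →₀ BoundAlgebra k R) where
  carrier := {x | ∀ i, x i ∈ Submodule.span (BoundAlgebra k R) {idemElt k R (D.label i)} ∧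
    (x i ≠ 0 → D.deg i = d)}
  zero_mem' := fun i => ⟨by simp, fun h => absurd rfl h⟩
  add_mem' := by
    intro x y hx hy i
    refine ⟨Submodule.add_mem _ (hx i).1 (hy i).1, fun h => ?_⟩
    by_cases h0 : x i = 0
    · exact (hy i).2 (fun h1 => h (by simp [h0, h1]))
    · exact (hx i).2 h0
  smul_mem' := by
    intro c x hx i
    refine ⟨Submodule.smul_mem _ c (hx i).1, fun h => (hx i).2 (fun h0 => h (by simp [h0]))⟩

/-- The row at `i` of the matrix of the differential. A direct letter `p` from `i` to `i + 1` gives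
the map `P(label i) → P(label (i + 1))` that multiplies by `p` on the right; an inverse letter `p̄`
from `i - 1` to `i` gives the map `P(label i) → P(label (i - 1))` that multiplies by `p` on the
right. -/
noncomputable def row [AddGroupWithOne ι] (i : ι) : ι →₀ BoundAlgebra k R :=
  Finsupp.single (i + 1) (D.scalar i • forward k R (D.letter i)) +
  Finsupp.single (i - 1) (D.scalar (i - 1) • backward k R (D.letter (i - 1)))

/-- The differential, on the free module on all positions. -/
noncomputable def differential [AddGroupWithOne ι] :
    (ι →₀ BoundAlgebra k R) →ₗ[BoundAlgebra k R] (ι →₀ BoundAlgebra k R) :=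
  Finsupp.linearCombination (BoundAlgebra k R) (D.row R)

theorem arrowElt_mul_idemElt (a : Arrow V) :
    arrowElt k R a * idemElt k R (some a.left) = arrowElt k R a := by
  simp only [arrowElt, idemElt, ← map_mul, PathAlgebra.arrow, PathAlgebra.vertex]
  exact congrArg _ (RingQuot.mkAlgHom_rel k (PathRel.source a))

theorem arrowElt_mul_arrowElt {a b : Arrow V} (h : R a b) :
    arrowElt k R a * arrowElt k R b = 0 := by
  rw [arrowElt, arrowElt, ← map_mul]
  exact (RingQuot.mkAlgHom_rel k (MonomialRel.mk a b h)).trans (map_zero _)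

theorem pathElt_mul_idemElt {p : List (Arrow V)} (hp : p ≠ []) :
    pathElt k R p * idemElt k R (p.getLast?.map (·.left)) = pathElt k R p := by
  obtain ⟨q, a, rfl⟩ := List.eq_nil_or_concat' p |>.resolve_left hp
  simp [pathElt, mul_assoc, arrowElt_mul_idemElt]

theorem pathElt_mul_pathElt {p q : List (Arrow V)} (hp : p ≠ []) (hq : q ≠ [])
    (h : ∀ a ∈ p.getLast?, ∀ b ∈ q.head?, R a b) : pathElt k R p * pathElt k R q = 0 := by
  obtain ⟨p, a, rfl⟩ := List.eq_nil_or_concat' p |>.resolve_left hp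
  obtain ⟨b, q, rfl⟩ := List.exists_cons_of_ne_nil hq
  have := arrowElt_mul_arrowElt (k := k) R (h a (by simp) b (by simp))
  simp only [pathElt, List.map_append, List.prod_append, List.map_cons, List.map_nil,
    List.prod_cons, List.prod_nil, mul_one]
  rw [mul_assoc, ← mul_assoc (arrowElt k R a), this, zero_mul, mul_zero]

variable {R D}

theorem single_mem_piece {d : ℤ} {i : ι} {a : BoundAlgebra k R}
    (ha : a * idemElt k R (D.label i) = a) (hd : a ≠ 0 → D.deg i = d) :
    Finsupp.single i a ∈ D.piece R d := by
  classical
  intro j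
  by_cases h : i = j
  · subst h
    simp only [Finsupp.single_eq_same]
    refine ⟨?_, hd⟩
    rw [← ha]
    exact Submodule.smul_mem _ a (Submodule.mem_span_singleton_self _)
  · rw [Finsupp.single_apply, if_neg h]
    exact ⟨Submodule.zero_mem _, fun h => absurd rfl h⟩

variable [AddGroupWithOne ι]

theorem row_mem_piece (hD : D.Valid R) (i : ι) : D.row R i ∈ D.piece R (D.deg i + 1) := by
  refine Submodule.add_mem _ (single_mem_piece ?_ ?_) (single_mem_piece ?_ ?_)
  · rcases h : D.letter i with _ | ⟨_ | _, p⟩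
    · simp [forward]
    · simp [forward]
    · rw [hD.rightEnd i _ h, smul_mul_assoc, forward]
      simp only [Letter.rightEnd, if_true]
      rw [pathElt_mul_idemElt R (hD.isPath i _ h).1]
  · rcases h : D.letter i with _ | ⟨_ | _, p⟩
    · simp [forward]
    · simp [forward]
    · intro _
      simpa [Letter.sign] using hD.deg i _ h
  · rcases h : D.letter (i - 1) with _ | ⟨_ | _, p⟩
    · simp [backward]
    · rw [hD.leftEnd (i - 1) _ h, smul_mul_assoc, backward]
      have : (Letter.mk false p).leftEnd = p.getLast?.map (·.left) := by simp [Letter.leftEnd]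
      rw [this, pathElt_mul_idemElt R (hD.isPath (i - 1) _ h).1]
    · simp [backward]
  · rcases h : D.letter (i - 1) with _ | ⟨_ | _, p⟩
    · simp [backward]
    · intro _
      have := hD.deg (i - 1) _ h
      simp only [sub_add_cancel, Letter.sign] at this
      simp at this
      omega
    · simp [backward]

theorem differential_mem (hD : D.Valid R) {d : ℤ} {x : ι →₀ BoundAlgebra k R}
    (hx : x ∈ D.piece R d) : D.differential R x ∈ D.piece R (d + 1) := by
  rw [differential, Finsupp.linearCombination_apply]
  refine Submodule.sum_mem _ fun i hi => ?_
  rw [← (hx i).2 (Finsupp.mem_support_iff.mp hi)]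
  exact Submodule.smul_mem _ _ (row_mem_piece hD i)

theorem differential_row (hD : D.Valid R) (i : ι) : D.differential R (D.row R i) = 0 := by
  have h1 : forward k R (D.letter i) * forward k R (D.letter (i + 1)) = 0 := by
    rcases h : D.letter i with _ | ⟨_ | _, p⟩ <;> rcases h' : D.letter (i + 1) with _ | ⟨_ | _, q⟩ <;>
      simp only [forward, mul_zero, zero_mul]
    exact pathElt_mul_pathElt R (hD.isPath _ _ h).1 (hD.isPath _ _ h').1 (hD.adj i _ h _ h').2
  have h2 : forward k R (D.letter i) * backward k R (D.letter i) = 0 := by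
    rcases h : D.letter i with _ | ⟨_ | _, p⟩ <;> simp [forward, backward]
  have h3 : backward k R (D.letter (i - 1)) * forward k R (D.letter (i - 1)) = 0 := by
    rcases h : D.letter (i - 1) with _ | ⟨_ | _, p⟩ <;> simp [forward, backward]
  have h4 : backward k R (D.letter (i - 1)) * backward k R (D.letter (i - 1 - 1)) = 0 := by
    rcases h : D.letter (i - 1) with _ | ⟨_ | _, p⟩ <;>
      rcases h' : D.letter (i - 1 - 1) with _ | ⟨_ | _, q⟩ <;>
      simp only [backward, mul_zero, zero_mul]
    have h'' : D.letter (i - 1 - 1 + 1) = some ⟨false, p⟩ := by rw [sub_add_cancel, h]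
    exact pathElt_mul_pathElt R (hD.isPath _ _ h).1 (hD.isPath _ _ h').1
      (hD.adj (i - 1 - 1) _ h' _ h'').2
  have e : i + 1 - 1 = i := add_sub_cancel_right i 1
  have e' : i - 1 + 1 = i := sub_add_cancel i 1
  rw [row, differential, map_add, Finsupp.linearCombination_single,
    Finsupp.linearCombination_single, row, row, e, e']
  simp only [smul_add, Finsupp.smul_single, smul_eq_mul, smul_mul_assoc, mul_smul_comm, h1, h2, h3,
    h4, smul_zero, Finsupp.single_zero, add_zero]

theorem differential_differential (hD : D.Valid R) (x : ι →₀ BoundAlgebra k R) :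
    D.differential R (D.differential R x) = 0 := by
  have : D.differential R x = x.sum fun i a => a • D.row R i := by
    rw [differential, Finsupp.linearCombination_apply]
  rw [this, map_finsuppSum]
  simp [differential_row hD]

variable (D) in
/-- The complex of left `kQ/I`-modules given by an unfolded diagram. -/
noncomputable def complex (hD : D.Valid R) : CochainComplex (ModuleCat.{u} (BoundAlgebra k R)) ℤ :=
  CochainComplex.of (fun d => ModuleCat.of (BoundAlgebra k R) (D.piece R d))
    (fun d => ModuleCat.ofHom ((D.differential R).restrict fun _ hx => differential_mem hD hx))
    (by
      intro d
      ext x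
      exact DFunLike.congr_fun (differential_differential hD x.1) _)

end Diagram

/-- A chain map between the complexes of two unfolded diagrams, applied to an element of degree
`d`. -/
noncomputable def Diagram.apply {ι κ : Type} [AddGroupWithOne ι] [AddGroupWithOne κ]
    {R : Arrow V → Arrow V → Prop} {D : Diagram k V ι} {D' : Diagram k V κ} {hD : D.Valid R}
    {hD' : D'.Valid R} (f : D.complex hD ⟶ D'.complex hD') (d : ℤ) (z : D.piece R d) :
    D'.piece R d :=
  (f.f d).hom z

end Complex

/-! ### String complexes and band complexes -/

section StringBand

variable (k : Type u) [Field k] {V : Type u} [Quiver.{u} V] {R : Arrow V → Arrow V → Prop}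

/-- The unfolded diagram of a word, with base vertex in degree `d`. -/
def Word.diagram (w : Word V) (d : ℤ) : Diagram k V ℤ where
  letter := w.letter
  scalar := fun _ => 1
  label := w.label
  deg := w.deg d

theorem Word.diagram_valid {w : Word V} (hw : w.IsHomotopyString R) (d : ℤ) :
    (w.diagram k d).Valid R where
  isPath := hw.isPath
  adj := hw.adj
  leftEnd := by
    rintro ((_ | m) | m) l hl
    · exact (hw.leftEnd_base l hl).symm
    · have hl' : w.right.get? (m + 1) = some l := hl
      obtain ⟨l', h'⟩ := w.right.ge_stable (Nat.le_succ m) hl'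
      have := (hw.adj (Int.ofNat m) l' h' l hl).1
      show (w.right.get? m).bind Letter.rightEnd = l.leftEnd
      rw [h', ← this]; rfl
    · have hl' : w.left.get? m = some l := hl
      show (w.left.get? m).bind Letter.leftEnd = l.leftEnd
      rw [hl']; rfl
  rightEnd := by
    rintro (m | (_ | m)) l hl
    · have hl' : w.right.get? m = some l := hl
      show (w.right.get? m).bind Letter.rightEnd = l.rightEnd
      rw [hl']; rfl
    · exact (hw.rightEnd_base l hl).symm
    · have hl' : w.left.get? (m + 1) = some l := hl
      obtain ⟨l', h'⟩ := w.left.ge_stable (Nat.le_succ m) hl'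
      have := (hw.adj (Int.negSucc (m + 1)) l hl l' h').1
      show (w.left.get? m).bind Letter.leftEnd = l.rightEnd
      rw [h', this]; rfl
  deg := by
    rintro (m | (_ | m)) l hl
    · have hl' : w.right.get? m = some l := hl
      show d + ∑ j ∈ Finset.range (m + 1), ((w.right.get? j).elim 0 Letter.sign) =
        d + ∑ j ∈ Finset.range m, ((w.right.get? j).elim 0 Letter.sign) + l.sign
      rw [Finset.sum_range_succ, hl']; simp [add_assoc]
    · have hl' : w.left.get? 0 = some l := hl
      show d + ∑ j ∈ Finset.range 0, ((w.right.get? j).elim 0 Letter.sign) =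
        d - ∑ j ∈ Finset.range (0 + 1), ((w.left.get? j).elim 0 Letter.sign) + l.sign
      rw [Finset.sum_range_succ, hl']; simp
    · have hl' : w.left.get? (m + 1) = some l := hl
      show d - ∑ j ∈ Finset.range (m + 1), ((w.left.get? j).elim 0 Letter.sign) =
        d - ∑ j ∈ Finset.range (m + 1 + 1), ((w.left.get? j).elim 0 Letter.sign) + l.sign
      rw [Finset.sum_range_succ _ (m + 1), hl']; simp; ring

/-- The sum of the signs of a list of letters, that is, the difference of the degrees of its
ends. -/
def signSum (t : List (Letter V)) : ℤ := (t.map Letter.sign).sum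

/-- The cyclic unfolded diagram of a list `t` of letters, with scalar `μ` on the letter with
number `i`, and with the left end of the first letter in degree `d`. -/
def bandDiagram (t : List (Letter V)) (μ : kˣ) (i : ZMod t.length) (d : ℤ) :
    Diagram k V (ZMod t.length) where
  letter j := t[j.val]?
  scalar j := if j = i then (μ : k) else 1
  label j := t[j.val]?.bind Letter.leftEnd
  deg j := d + signSum (t.take j.val)

theorem signSum_eq (t : List (Letter V)) :
    signSum t = t.countP (fun l => l.direct) - t.countP (fun l => !l.direct) := by
  induction t with
  | nil => simp [signSum]
  | cons l t ih =>
    simp only [signSum, List.map_cons, List.sum_cons] at ih ⊢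
    rw [ih, List.countP_cons, List.countP_cons]
    rcases l with ⟨_ | _, p⟩ <;> simp [Letter.sign] <;> ring

theorem IsHomotopyBand.next {t : List (Letter V)} (ht : IsHomotopyBand R t) (j : ZMod t.length)
    {l : Letter V} (hl : t[j.val]? = some l) :
    ∃ m, t[(j + 1).val]? = some m ∧ Adj R l m ∧
      signSum (t.take (j + 1).val) = signSum (t.take j.val) + l.sign := by
  have hpos : 0 < t.length := List.length_pos_iff.mpr ht.ne_nil
  have : NeZero t.length := ⟨hpos.ne'⟩
  have hj : j.val < t.length := ZMod.val_lt j
  have hl' : t[j.val] = l := by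
    rw [List.getElem?_eq_getElem hj] at hl; exact Option.some.inj hl
  have hv : (j + 1).val = (j.val + 1) % t.length := by
    rw [ZMod.val_add, ZMod.val_one_eq_one_mod, Nat.add_mod_mod]
  have hc := List.isChain_iff_getElem.mp ht.cyclic j.val (by simp; omega)
  rw [List.getElem_append_left hj, hl'] at hc
  have hs : signSum (t.take (j.val + 1)) = signSum (t.take j.val) + l.sign := by
    rw [List.take_add_one, hl]; simp [signSum]
  rcases Nat.lt_or_ge (j.val + 1) t.length with h | h
  · rw [Nat.mod_eq_of_lt h] at hv
    rw [List.getElem_append_left h] at hc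
    exact ⟨_, by rw [hv, List.getElem?_eq_getElem h], hc, by rw [hv, hs]⟩
  · have h1 : j.val + 1 = t.length := by omega
    rw [h1, Nat.mod_self] at hv
    rw [List.getElem_append_right h] at hc
    simp only [h1, Nat.sub_self] at hc
    refine ⟨_, by rw [hv, List.getElem?_eq_getElem hpos], hc, ?_⟩
    rw [hv, ← hs, h1, List.take_length, signSum_eq t, ht.balanced]
    simp [signSum]

theorem bandDiagram_valid {t : List (Letter V)} (ht : IsHomotopyBand R t) (μ : kˣ)
    (i : ZMod t.length) (d : ℤ) : (bandDiagram k t μ i d).Valid R where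
  isPath j l hl := ht.isPath l (List.mem_of_getElem? hl)
  leftEnd j l hl := by
    have hl' : t[j.val]? = some l := hl
    show t[j.val]?.bind Letter.leftEnd = _
    rw [hl']; rfl
  rightEnd j l hl := by
    obtain ⟨m, hm, ha, -⟩ := ht.next j hl
    show t[(j + 1).val]?.bind Letter.leftEnd = _
    rw [hm, ha.1]; rfl
  deg j l hl := by
    obtain ⟨m, -, -, hs⟩ := ht.next j hl
    show d + signSum (t.take (j + 1).val) = d + signSum (t.take j.val) + l.sign
    rw [hs, add_assoc]
  adj j l hl m hm := by
    obtain ⟨m', hm', ha, -⟩ := ht.next j hl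
    have hm2 : t[(j + 1).val]? = some m := hm
    rw [hm'] at hm2
    exact Option.some.inj hm2 ▸ ha

variable [Fintype V]

/-- The string complex `P_w` of a homotopy string `w`, with base vertex in degree `d`. -/
noncomputable def stringComplex (w : Word V) (hw : w.IsHomotopyString R) (d : ℤ) :
    CochainComplex (ModuleCat.{u} (BoundAlgebra k R)) ℤ :=
  (w.diagram k d).complex (Word.diagram_valid k hw d)

/-- The (one-dimensional) band complex `B_{t,μ}` of a homotopy band `t`, with scalar `μ` on the
letter with number `i`, and with the left end of the first letter in degree `d`. -/
noncomputable def bandComplex (t : List (Letter V)) (ht : IsHomotopyBand R t) (μ : kˣ)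
    (i : ZMod t.length) (d : ℤ) : CochainComplex (ModuleCat.{u} (BoundAlgebra k R)) ℤ :=
  (bandDiagram k t μ i d).complex (bandDiagram_valid k ht μ i d)

end StringBand

/-! ### Graph maps from a string complex to a band complex -/

section GraphMap

variable {V : Type u} [Quiver.{u} V]

/-- The right endpoint conditions of a graph map: `EndCondition s t c f` for the letters `s = σ_R`
(`none` if empty) and `t = τ_R` on the right of the overlap. Here `c` is the reduced form
of `τ̄_R σ_R` (`none` if `σ_R` is empty), and `f` is the path `f_R` (`none` if there is no such
component).
* `one`: `σ_R = p` and `τ_R = p f` are direct, `τ̄_R σ_R = f̄`;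
* `two`: `σ_R = w̄ f̄` and `τ_R = w̄` are inverse, `τ̄_R σ_R = f̄`;
* `three`: `σ_R = p` is direct and `τ_R = q̄` is inverse, `τ̄_R σ_R = q p`;
* `three_empty`: `σ_R` is empty and `τ_R = q̄` is inverse. -/
inductive EndCondition :
    Option (Letter V) → Letter V → Option (Letter V) → Option (List (Arrow V)) → Prop
  | one (p f : List (Arrow V)) (hf : f ≠ []) :
      EndCondition (some ⟨true, p⟩) ⟨true, p ++ f⟩ (some ⟨false, f⟩) (some f)
  | two (w f : List (Arrow V)) (hf : f ≠ []) :
      EndCondition (some ⟨false, f ++ w⟩) ⟨false, w⟩ (some ⟨false, f⟩) (some f)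
  | three (p q : List (Arrow V)) :
      EndCondition (some ⟨true, p⟩) ⟨false, q⟩ (some ⟨true, q ++ p⟩) none
  | three_empty (q : List (Arrow V)) : EndCondition none ⟨false, q⟩ none none

variable (V) in
/-- The data of words `σ = β σ_L ρ σ_R α` and `τ = δ τ_L ρ τ_R γ`. Here `β` is listed from right to
left (the letter next to `σ_L` comes first), all other words are listed from left to right. `x` is
the vertex at the left end of `ρ` and `y` is the vertex at the left end of `τ`.
`cL` and `cR` are the letters `σ_L τ̄_L` and `τ̄_R σ_R`, and `fL` and `fR` are the components `f_L`
and `f_R`; all four are determined by the conditions in `IsGraphOverlap`. -/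
structure Overlap where
  x : V
  y : V
  β : Stream'.Seq (Letter V)
  σL : Option (Letter V)
  ρ : List (Letter V)
  σR : Option (Letter V)
  α : Stream'.Seq (Letter V)
  δ : List (Letter V)
  τL : Letter V
  τR : Letter V
  γ : List (Letter V)
  cL : Option (Letter V)
  cR : Option (Letter V)
  fL : Option (List (Arrow V))
  fR : Option (List (Arrow V))

/-- The (possibly empty) letter `l` followed by the sequence `s`. -/
def consLetter (l : Option (Letter V)) (s : Stream'.Seq (Letter V)) : Stream'.Seq (Letter V) :=
  l.elim Stream'.Seq.nil (fun l => Stream'.Seq.cons l s)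

/-- The list `l` followed by the sequence `s`. -/
def prepend (l : List (Letter V)) (s : Stream'.Seq (Letter V)) : Stream'.Seq (Letter V) :=
  l.foldr Stream'.Seq.cons s

namespace Overlap

variable (O : Overlap V)

/-- `σ = β σ_L ρ σ_R α`, with base vertex the left end of `ρ`. -/
def sigma : Word V where
  base := O.x
  left := consLetter O.σL O.β
  right := prepend O.ρ (consLetter O.σR O.α)

/-- `τ = δ τ_L ρ τ_R γ`. -/
def tau : List (Letter V) := O.δ ++ O.τL :: (O.ρ ++ O.τR :: O.γ)

/-- `c = β σ_L τ̄_L δ̄ γ̄ τ̄_R σ_R α`, with base vertex between `δ̄` and `γ̄`. If `σ_L` is empty then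
`β σ_L τ̄_L` is omitted, and if `σ_R` is empty then `τ̄_R σ_R α` is omitted. -/
def cone : Word V where
  base := O.y
  left := prepend (O.δ.map Letter.inv) (consLetter O.cL O.β)
  right := prepend (O.γ.reverse.map Letter.inv) (consLetter O.cR O.α)

/-- The overlap `ρ` satisfies the endpoint conditions of a graph map on the right and (dually) on the
left; in particular `ρ` is a maximal common homotopy substring. An empty `σ_L` or `σ_R` can occur
only at an end of `σ`. -/
structure IsGraphOverlap : Prop where
  right : EndCondition O.σR O.τR O.cR O.fR
  left : EndCondition (O.σL.map Letter.inv) O.τL.inv (O.cL.map Letter.inv) O.fL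
  α_nil : O.σR = none → O.α = Stream'.Seq.nil
  β_nil : O.σL = none → O.β = Stream'.Seq.nil
  base : O.τL.rightEnd = some O.x
  base' : O.tau.head?.bind Letter.leftEnd = some O.y

/-- Compatible orientation: if `f` is concentrated in one degree (`ρ` is trivial and there are no
components `f_L`, `f_R`), then `σ_L τ̄_L` and `τ̄_R σ_R` (where defined) are nonzero, that is,
(inverses of) paths in `(Q, I)`. -/
def CompatiblyOriented (R : Arrow V → Arrow V → Prop) : Prop :=
  O.ρ = [] → O.fL = none → O.fR = none →
    (∀ l ∈ O.cL, IsPath R l.path) ∧ (∀ l ∈ O.cR, IsPath R l.path)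

variable (k : Type u) [Field k] [Fintype V] {R : Arrow V → Arrow V → Prop}

variable (R) in
/-- The component of the graph map at the position `i` of `σ`, up to a scalar: an identity for the
positions `0, …, |ρ|` on the overlap, `f_R` and `f_L` for the adjacent positions, and `0` otherwise. -/
noncomputable def component (i : ℤ) : BoundAlgebra k R :=
  if 0 ≤ i ∧ i ≤ O.ρ.length then idemElt k R (O.sigma.label i)
  else if i = O.ρ.length + 1 then O.fR.elim 0 (pathElt k R)
  else if i = -1 then O.fL.elim 0 (pathElt k R)
  else 0

/-- `f` is the graph map of the overlap: its components are those of `component`, from the position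
`i` of `σ` to the position `|δ| + 1 + i` of `τ`, multiplied by nonzero scalars. (If the scalar `μ` of
the band complex is not on a letter of `τ_L ρ τ_R`, one can take all the scalars to be `1`.
In general the position of `μ` determines them up to a common factor, because `f` is a chain
map.) -/
def IsGraphMap {hσ : O.sigma.IsHomotopyString R} {hτ : IsHomotopyBand R O.tau} {μ : kˣ}
    {j : ZMod O.tau.length} {d d' : ℤ}
    (f : stringComplex k O.sigma hσ d' ⟶ bandComplex k O.tau hτ μ j d) : Prop :=
  ∃ u : ℤ → kˣ, ∀ (n : ℤ) (z : (O.sigma.diagram k d').piece R n),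
    (Diagram.apply f n z : ZMod O.tau.length →₀ BoundAlgebra k R) =
      Finsupp.linearCombination (BoundAlgebra k R)
        (fun i : ℤ => Finsupp.single ((O.δ.length + 1 + i : ℤ) : ZMod O.tau.length)
          ((u i : k) • O.component k R i))
        (z : ℤ →₀ BoundAlgebra k R)

end Overlap

end GraphMap

end GentleCone

namespace GentleCone

/-! ### Graded modules with a differential -/

/-! The theorem is Gaussian elimination in the mapping cone of the graph map. As a graded module the
cone is free on the positions of σ (shifted by one) and the positions of τ, cut down by idempotents.
On the overlap ρ the graph map is the identity up to units, so each vertex of ρ in σ cancels against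
its copy in τ. What is left is the outside of ρ in σ and the complementary arc of τ, and these are
exactly the vertices of c.

The differential after elimination is the old one plus zigzags through the overlap: enter ρ from τ,
go back to σ along the inverse of the graph map, leave ρ inside σ. Entering along an inverse τ_R and
leaving along a direct σ_R gives the product of the two paths, which is the direct form of the
letter c_R (`EndCondition.forward_eq`). A component f_R of the graph map already joins σ to the arc
and is the inverse form of c_R (`EndCondition.backward_eq`). The left side is dual. When ρ is
trivial a zigzag could also leave on the wrong side. Those products vanish by gentleness and
compatible orientation (`EndCondition.backward_mul_forward`). Hence the reduced differential is that
of the diagram of c with nonzero scalars on its letters (`exists_row_eq_reduction`). Since c is a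
line and not a cycle, the scalars can be normalised to 1 (`nonempty_iso_of_scalar`).

That c is a homotopy string (`IsGraphOverlap.isHomotopyString`) is a separate combinatorial check at
the new letters c_L and c_R. It uses that a gentle quiver has at most one continuation of an arrow
with a relation and at most one without.

The computation takes place on the full free modules, with 1 in place of the idempotents, so that
the inverse on the overlap is an honest linear map. The graded pieces are restored afterwards. -/

/-- A square zero endomorphism `d` of a module `T`, homogeneous of degree one for a family of
submodules. -/
structure GradedDifferential (A : Type u) [Ring A] (T : Type u) [AddCommGroup T] [Module A T] where
  d : T →ₗ[A] T
  piece : ℤ → Submodule A T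
  mem : ∀ n, ∀ x ∈ piece n, d x ∈ piece (n + 1)
  sq : ∀ x, d (d x) = 0

namespace GradedDifferential

variable {A : Type u} [Ring A]
variable {T : Type u} [AddCommGroup T] [Module A T] (D : GradedDifferential A T)
variable {T' : Type u} [AddCommGroup T'] [Module A T'] (D' : GradedDifferential A T')

/-- The cochain complex formed by the pieces. -/
def complex : CochainComplex (ModuleCat.{u} A) ℤ :=
  CochainComplex.of (fun n => ModuleCat.of A (D.piece n))
    (fun n => ModuleCat.ofHom (D.d.restrict (D.mem n)))
    (by
      intro n
      ext x
      exact D.sq x.1)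

/-- The map between pieces given by a linear map. -/
def map (L : T →ₗ[A] T') {n m : ℤ} (hL : ∀ x ∈ D.piece n, L x ∈ D'.piece m) :
    D.complex.X n ⟶ D'.complex.X m :=
  ModuleCat.ofHom (L.restrict hL)

theorem complex_d (n : ℤ) : D.complex.d n (n + 1) = D.map D D.d (D.mem n) :=
  CochainComplex.of_d (fun n => ModuleCat.of A (D.piece n))
    (fun n => ModuleCat.ofHom (D.d.restrict (D.mem n))) n

/-- The chain map given by a linear map which is homogeneous of degree zero and commutes with the
differentials. -/
def chainMap (L : T →ₗ[A] T') (hL : ∀ n, ∀ x ∈ D.piece n, L x ∈ D'.piece n)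
    (hd : ∀ x, L (D.d x) = D'.d (L x)) : D.complex ⟶ D'.complex where
  f n := D.map D' L (hL n)
  comm' := by
    rintro n _ rfl
    rw [complex_d, complex_d]
    ext x
    exact Subtype.ext (hd x.1).symm

open Classical in
/-- The components of a homotopy given by a linear map of degree `-1`. -/
noncomputable def homotopyHom (h : T →ₗ[A] T')
    (hh : ∀ n, ∀ x ∈ D.piece (n + 1), h x ∈ D'.piece n) (i j : ℤ) :
    D.complex.X i ⟶ D'.complex.X j :=
  if hij : j + 1 = i then D.map D' h (by subst hij; exact hh j) else 0

/-- The homotopy given by a linear map of degree `-1`. -/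
noncomputable def homotopy {f g : D.complex ⟶ D'.complex} (h : T →ₗ[A] T')
    (hh : ∀ n, ∀ x ∈ D.piece (n + 1), h x ∈ D'.piece n)
    (comm : ∀ n (x : D.piece n), ((f.f n).hom x : D'.piece n).1 =
      h (D.d x) + D'.d (h x) + ((g.f n).hom x : D'.piece n).1) : Homotopy f g where
  hom := D.homotopyHom D' h hh
  zero i j hij := dif_neg hij
  comm n := by
    obtain ⟨m, rfl⟩ : ∃ m, n = m + 1 := ⟨n - 1, by ring⟩
    rw [dNext_eq (D.homotopyHom D' h hh) (show (ComplexShape.up ℤ).Rel (m + 1) (m + 1 + 1) from rfl),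
      prevD_eq (D.homotopyHom D' h hh) (show (ComplexShape.up ℤ).Rel m (m + 1) from rfl)]
    rw [homotopyHom, homotopyHom, dif_pos rfl, dif_pos rfl, complex_d, complex_d]
    ext x
    exact Subtype.ext (comm (m + 1) x)

/-- Gaussian elimination: a linear map `h` of degree `-1` with `h h = 0` and `h d h = h`, together
with a module `T` identified with a complement of `h d e₁ = e₁` and `e₂ d h = e₂`, gives a homotopy
equivalence. -/
noncomputable def homotopyEquiv (h : T' →ₗ[A] T') (ι : T →ₗ[A] T') (π : T' →ₗ[A] T)
    (e₁ e₂ : T' →ₗ[A] T')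
    (h_mem : ∀ n, ∀ x ∈ D'.piece (n + 1), h x ∈ D'.piece n)
    (ι_mem : ∀ n, ∀ x ∈ D.piece n, ι x ∈ D'.piece n)
    (π_mem : ∀ n, ∀ x ∈ D'.piece n, π x ∈ D.piece n)
    (hh : ∀ x, h (h x) = 0) (hdh : ∀ x, h (D'.d (h x)) = h x)
    (hι : ∀ x, h (ι x) = 0) (πh : ∀ x, π (h x) = 0) (πι : ∀ x, π (ι x) = x)
    (decomp : ∀ x, ι (π x) + e₁ x + e₂ x = x)
    (he₁ : ∀ x, h (e₁ x) = 0) (hde₁ : ∀ x, h (D'.d (e₁ x)) = e₁ x)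
    (e₂h : ∀ x, e₂ (h x) = 0) (e₂dh : ∀ x, e₂ (D'.d (h x)) = e₂ x)
    (hd : ∀ x, D.d x = π (D'.d (ι x)) - π (D'.d (h (D'.d (ι x))))) :
    HomotopyEquiv D'.complex D.complex := by
  -- `P` = 1 − dh − hd is an idempotent chain map homotopic to the identity. `I` and `Q` are the
  -- inclusion and the projection that split it.
  let P : T' →ₗ[A] T' := LinearMap.id - D'.d ∘ₗ h - h ∘ₗ D'.d
  let I : T →ₗ[A] T' := ι - h ∘ₗ D'.d ∘ₗ ι
  let Q : T' →ₗ[A] T := π - π ∘ₗ D'.d ∘ₗ h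
  have sq := D'.sq
  have hP : ∀ x, P x = x - D'.d (h x) - h (D'.d x) := fun x => rfl
  have hI : ∀ x, I x = ι x - h (D'.d (ι x)) := fun x => rfl
  have hQ : ∀ x, Q x = π x - π (D'.d (h x)) := fun x => rfl
  have PP : ∀ x, P (P x) = P x := by
    intro x; simp [hP, sq, hh, hdh]
  have Pd : ∀ x, P (D'.d x) = D'.d (P x) := by
    intro x; simp [hP, sq]
  have IPι : ∀ x, I x = P (ι x) := by
    intro x; simp [hP, hI, hι]
  have QπP : ∀ x, Q x = π (P x) := by
    intro x; simp [hP, hQ, πh]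
  have Pe₁ : ∀ x, P (e₁ x) = - D'.d (h (e₁ x)) := by
    intro x; simp [hP, hde₁]
  have e₂P : ∀ x, e₂ (P x) = 0 := by
    intro x; simp [hP, e₂h, e₂dh]
  -- Decompose `P x` by `decomp` and apply `P` again. The `e₂` part is zero, and `P` kills the `e₁`
  -- part because `h` does, so only the part through `ι` and `π` survives.
  have IQ : ∀ x, I (Q x) = P x := by
    intro x
    have := congrArg P (decomp (P x))
    rw [map_add, map_add, Pe₁, e₂P, he₁, PP] at this
    rw [IPι, QπP]
    simpa using this
  have QI : ∀ x, Q (I x) = x := by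
    intro x; simp [hQ, hI, hι, πh, πι, hh]
  -- Of the four terms of `Q d I`, the one containing h d h cancels one of the two equal zigzags by
  -- `hdh`. This leaves the formula `hd`.
  have hd' : ∀ x, D.d x = Q (D'.d (I x)) := by
    intro x; simp [hQ, hI, hd, hdh]
  have Id : ∀ x, I (D.d x) = D'.d (I x) := by
    intro x
    rw [hd', IQ, Pd, IPι, PP]
  have Qd : ∀ x, Q (D'.d x) = D.d (Q x) := by
    intro x
    rw [hd', IQ, ← Pd, QπP, QπP, PP]
  have d_h_mem : ∀ n, ∀ x ∈ D'.piece n, D'.d (h x) ∈ D'.piece n := by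
    intro n x hx
    obtain ⟨m, rfl⟩ : ∃ m, n = m + 1 := ⟨n - 1, by ring⟩
    exact D'.mem _ _ (h_mem _ _ hx)
  have I_mem : ∀ n, ∀ x ∈ D.piece n, I x ∈ D'.piece n := fun n x hx =>
    Submodule.sub_mem _ (ι_mem n x hx) (h_mem _ _ (D'.mem _ _ (ι_mem n x hx)))
  have Q_mem : ∀ n, ∀ x ∈ D'.piece n, Q x ∈ D.piece n := fun n x hx =>
    Submodule.sub_mem _ (π_mem n x hx) (π_mem _ _ (d_h_mem n x hx))
  refine
    { hom := D'.chainMap D Q Q_mem Qd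
      inv := D.chainMap D' I I_mem Id
      homotopyHomInvId := D'.homotopy D' (-h) (fun n x hx => Submodule.neg_mem _ (h_mem n x hx)) ?_
      homotopyInvHomId := Homotopy.ofEq ?_ }
  · intro n x
    change I (Q x.1) = -h (D'.d x.1) + D'.d (-h x.1) + x.1
    rw [IQ, hP, map_neg]
    abel
  · ext n x
    exact Subtype.ext (QI x.1)

/-- The mapping cone of a map between graded modules with differential. -/
def cone (F : T →ₗ[A] T') (hF : ∀ n, ∀ x ∈ D.piece n, F x ∈ D'.piece n)
    (hd : ∀ x, F (D.d x) = D'.d (F x)) : GradedDifferential A (T × T') where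
  d := LinearMap.prod (-(D.d ∘ₗ LinearMap.fst A T T'))
    (F ∘ₗ LinearMap.fst A T T' + D'.d ∘ₗ LinearMap.snd A T T')
  piece n := (D.piece (n + 1)).prod (D'.piece n)
  mem n x hx := ⟨Submodule.neg_mem _ (D.mem _ _ hx.1),
    Submodule.add_mem _ (hF _ _ hx.1) (D'.mem _ _ hx.2)⟩
  sq x := by
    ext
    · simp [D.sq]
    · simp [D'.sq, hd]

open CochainComplex CochainComplex.HomComplex in
/-- The mapping cone of a chain map given by `F` is the complex of `cone`. -/
noncomputable def mappingConeIso (F : T →ₗ[A] T') (hF : ∀ n, ∀ x ∈ D.piece n, F x ∈ D'.piece n)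
    (hd : ∀ x, F (D.d x) = D'.d (F x)) (φ : D.complex ⟶ D'.complex)
    (hφ : ∀ n, φ.f n = D.map D' F (hF n)) :
    mappingCone φ ≅ (D.cone D' F hF hd).complex := by
  generalize hE : D.cone D' F hF hd = E
  have hEp : ∀ n, E.piece n = (D.piece (n + 1)).prod (D'.piece n) := fun n => by rw [← hE]; rfl
  have hEd : ∀ x, E.d x = (-D.d x.1, F x.1 + D'.d x.2) := fun x => by rw [← hE]; rfl
  -- `a`, `b`, `p`, `q` are the inclusions and projections of the two summands. They are matched
  -- with the structure maps of the mapping cone.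
  let a : ∀ n m, n + 1 = m → (D.complex.X m ⟶ E.complex.X n) := fun n m h =>
    D.map E (LinearMap.inl A T T')
      (fun x hx => by subst h; rw [hEp]; exact ⟨hx, Submodule.zero_mem _⟩)
  let b : ∀ n, (D'.complex.X n ⟶ E.complex.X n) := fun n =>
    D'.map E (LinearMap.inr A T T') (fun x hx => by rw [hEp]; exact ⟨Submodule.zero_mem _, hx⟩)
  let p : ∀ n m, n + 1 = m → (E.complex.X n ⟶ D.complex.X m) := fun n m h =>
    E.map D (LinearMap.fst A T T') (fun x hx => by subst h; rw [hEp] at hx; exact hx.1)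
  let q : ∀ n, (E.complex.X n ⟶ D'.complex.X n) := fun n =>
    E.map D' (LinearMap.snd A T T') (fun x hx => by rw [hEp] at hx; exact hx.2)
  refine HomologicalComplex.Hom.isoOfComponents (fun n =>
    { hom := (mappingCone.fst φ).1.v n (n + 1) rfl ≫ a n (n + 1) rfl +
        (mappingCone.snd φ).v n n (add_zero n) ≫ b n
      inv := p n (n + 1) rfl ≫ (mappingCone.inl φ).v (n + 1) n (by omega) +
        q n ≫ (mappingCone.inr φ).f n
      hom_inv_id := ?_
      inv_hom_id := ?_ }) ?_
  · have h1 : a n (n + 1) rfl ≫ p n (n + 1) rfl = 𝟙 _ := rfl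
    have h2 : b n ≫ q n = 𝟙 _ := rfl
    have h3 : a n (n + 1) rfl ≫ q n = 0 := rfl
    have h4 : b n ≫ p n (n + 1) rfl = 0 := rfl
    rw [mappingCone.ext_to_iff _ _ _ rfl]
    simp [reassoc_of% h1, reassoc_of% h2, reassoc_of% h3, reassoc_of% h4]
  · have : p n (n + 1) rfl ≫ a n (n + 1) rfl + q n ≫ b n = 𝟙 _ := by
      ext x
      refine Subtype.ext ?_
      change (x.1.1 + 0, 0 + x.1.2) = x.1
      simp
    simpa using this
  · rintro n _ rfl
    have h1 : a n (n + 1) rfl ≫ E.complex.d n (n + 1) =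
        φ.f (n + 1) ≫ b (n + 1) - D.complex.d (n + 1) (n + 1 + 1) ≫ a (n + 1) (n + 1 + 1) rfl := by
      rw [complex_d, complex_d, hφ]
      ext x
      refine Subtype.ext ?_
      change E.d (x.1, 0) = (0 - D.d x.1, F x.1 - 0)
      simp [hEd]
    have h2 : b n ≫ E.complex.d n (n + 1) = D'.complex.d n (n + 1) ≫ b (n + 1) := by
      rw [complex_d, complex_d]
      ext x
      refine Subtype.ext ?_
      change E.d (0, x.1) = (0, D'.d x.1)
      simp [hEd]
    rw [mappingCone.ext_from_iff _ (n + 1) n rfl]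
    constructor
    · simp [h1, mappingCone.inl_v_d_assoc φ (n + 1) n (n + 1 + 1) (by omega) (by omega),
        sub_eq_add_neg, add_comm]
    · simp [h2]

end GradedDifferential

/-! ### Letters -/

section Letters

variable {V : Type u} [Quiver.{u} V] {R : Arrow V → Arrow V → Prop}

namespace Letter

@[simp] theorem inv_inv (l : Letter V) : l.inv.inv = l := by
  rcases l with ⟨_ | _, p⟩ <;> rfl

@[simp] theorem inv_mk (b : Bool) (p : List (Arrow V)) : (Letter.mk b p).inv = ⟨!b, p⟩ := rfl

@[simp] theorem inv_path (l : Letter V) : l.inv.path = l.path := rfl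

@[simp] theorem leftEnd_inv (l : Letter V) : l.inv.leftEnd = l.rightEnd := by
  rcases l with ⟨_ | _, p⟩ <;> rfl

@[simp] theorem rightEnd_inv (l : Letter V) : l.inv.rightEnd = l.leftEnd := by
  rcases l with ⟨_ | _, p⟩ <;> rfl

@[simp] theorem sign_inv (l : Letter V) : l.inv.sign = -l.sign := by
  rcases l with ⟨_ | _, p⟩ <;> rfl

theorem leftEnd_ne_none {l : Letter V} (hl : l.path ≠ []) : l.leftEnd ≠ none := by
  rcases l with ⟨_ | _, p⟩ <;> simpa [Letter.leftEnd] using hl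

theorem rightEnd_ne_none {l : Letter V} (hl : l.path ≠ []) : l.rightEnd ≠ none := by
  rcases l with ⟨_ | _, p⟩ <;> simpa [Letter.rightEnd] using hl

end Letter

theorem Adj.inv {l m : Letter V} (h : Adj R l m) : Adj R m.inv l.inv := by
  rcases l with ⟨_ | _, p⟩ <;> rcases m with ⟨_ | _, q⟩ <;>
    simp only [Adj, Letter.rightEnd_inv, Letter.leftEnd_inv] at h ⊢ <;>
    simp only [Letter.inv, Bool.not_true, Bool.not_false] at h ⊢
  · exact ⟨h.1.symm, h.2⟩
  · exact ⟨h.1.symm, h.2.symm⟩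
  · exact ⟨h.1.symm, h.2.symm⟩
  · exact ⟨h.1.symm, h.2⟩

theorem adj_inv_iff {l m : Letter V} : Adj R m.inv l.inv ↔ Adj R l m :=
  ⟨fun h => by simpa using h.inv, Adj.inv⟩

theorem IsPath.append_iff {p q : List (Arrow V)} (hp : p ≠ []) (hq : q ≠ []) :
    IsPath R (p ++ q) ↔ IsPath R p ∧ IsPath R q ∧
      (p.getLast hp).left = (q.head hq).right ∧ ¬ R (p.getLast hp) (q.head hq) := by
  simp only [IsPath, List.isChain_append, List.getLast?_eq_some_getLast hp,
    List.head?_eq_some_head hq, Option.mem_def, Option.some.injEq]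
  simp [hp, hq]

theorem adj_direct_direct {p q : List (Arrow V)} (hp : p ≠ []) (hq : q ≠ []) :
    Adj R ⟨true, p⟩ ⟨true, q⟩ ↔
      (p.getLast hp).left = (q.head hq).right ∧ R (p.getLast hp) (q.head hq) := by
  simp [Adj, Letter.rightEnd, Letter.leftEnd, List.getLast?_eq_some_getLast hp,
    List.head?_eq_some_head hq]

theorem adj_direct_inverse {p q : List (Arrow V)} (hp : p ≠ []) (hq : q ≠ []) :
    Adj R ⟨true, p⟩ ⟨false, q⟩ ↔
      (p.getLast hp).left = (q.getLast hq).left ∧ p.getLast hp ≠ q.getLast hq := by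
  simp [Adj, Letter.rightEnd, Letter.leftEnd, List.getLast?_eq_some_getLast hp,
    List.getLast?_eq_some_getLast hq]

theorem adj_inverse_direct {p q : List (Arrow V)} (hp : p ≠ []) (hq : q ≠ []) :
    Adj R ⟨false, p⟩ ⟨true, q⟩ ↔
      (p.head hp).right = (q.head hq).right ∧ p.head hp ≠ q.head hq := by
  simp [Adj, Letter.rightEnd, Letter.leftEnd, List.head?_eq_some_head hp,
    List.head?_eq_some_head hq]

theorem adj_inverse_inverse {p q : List (Arrow V)} (hp : p ≠ []) (hq : q ≠ []) :
    Adj R ⟨false, p⟩ ⟨false, q⟩ ↔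
      (p.head hp).right = (q.getLast hq).left ∧ R (q.getLast hq) (p.head hp) := by
  simp [Adj, Letter.rightEnd, Letter.leftEnd, List.head?_eq_some_head hp,
    List.getLast?_eq_some_getLast hq]

namespace IsGentle

variable (hR : IsGentle R)
include hR

theorem eq_of_left_nonrel {a b b' : Arrow V} (h : b.left = a.right) (h' : b'.left = a.right)
    (hn : ¬ R b a) (hn' : ¬ R b' a) : b = b' :=
  Set.encard_le_one_iff.mp (hR.left_nonrel a) b b' ⟨h, hn⟩ ⟨h', hn'⟩

theorem eq_of_right_nonrel {a b b' : Arrow V} (h : a.left = b.right) (h' : a.left = b'.right)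
    (hn : ¬ R a b) (hn' : ¬ R a b') : b = b' :=
  Set.encard_le_one_iff.mp (hR.right_nonrel a) b b' ⟨h, hn⟩ ⟨h', hn'⟩

theorem eq_of_left_rel {a b b' : Arrow V} (h : b.left = a.right) (h' : b'.left = a.right)
    (hn : R b a) (hn' : R b' a) : b = b' :=
  Set.encard_le_one_iff.mp (hR.left_rel a) b b' ⟨h, hn⟩ ⟨h', hn'⟩

theorem eq_of_right_rel {a b b' : Arrow V} (h : a.left = b.right) (h' : a.left = b'.right)
    (hn : R a b) (hn' : R a b') : b = b' :=
  Set.encard_le_one_iff.mp (hR.right_rel a) b b' ⟨h, hn⟩ ⟨h', hn'⟩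

/-- If `l p` and `l q̄` are homotopy strings with letters `l, p` and `l, q̄`, then `q p` is a path
outside the ideal. -/
theorem isPath_append_of_adj {l : Letter V} {p q : List (Arrow V)} (hl : IsPath R l.path)
    (hp : IsPath R p) (hq : IsPath R q) (h : Adj R l ⟨true, p⟩) (h' : Adj R l ⟨false, q⟩) :
    IsPath R (q ++ p) := by
  rw [IsPath.append_iff hq.1 hp.1]
  refine ⟨hq, hp, ?_⟩
  rcases l with ⟨_ | _, w⟩
  · rw [adj_inverse_direct hl.1 hp.1] at h
    rw [adj_inverse_inverse hl.1 hq.1] at h'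
    -- A relation at the junction would put the last entry of `q` in relation with both the head of
    -- `w` and the head of `p`. Gentleness would identify these heads, a cancellation which `h`
    -- forbids. For direct `l` the argument is mirrored.
    refine ⟨h'.1.symm.trans h.1, fun hr => h.2 ?_⟩
    exact hR.eq_of_right_rel h'.1.symm (h'.1.symm.trans h.1) h'.2 hr
  · rw [adj_direct_direct hl.1 hp.1] at h
    rw [adj_direct_inverse hl.1 hq.1] at h'
    refine ⟨h'.1.symm.trans h.1, fun hr => h'.2 ?_⟩
    exact hR.eq_of_left_rel h.1 (h'.1.symm.trans h.1) h.2 hr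

end IsGentle

namespace EndCondition

variable {s c : Option (Letter V)} {t : Letter V} {f : Option (List (Arrow V))}

theorem eq_none_iff (h : EndCondition s t c f) : c = none ↔ s = none := by
  cases h <;> simp

/-- Degree bookkeeping for c = t̄ s. The −1 is the shift of σ in the mapping cone. -/
theorem sign_eq (h : EndCondition s t c f) {l m : Letter V} (hl : s = some l) (hm : c = some m) :
    m.sign = l.sign - t.sign - 1 := by
  cases h <;> simp_all <;> subst_vars <;> simp [Letter.sign]

section

variable (h : EndCondition s t c f) (hs : ∀ l ∈ s, IsPath R l.path) (ht : IsPath R t.path)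
include h hs ht

/-- The letter c is t̄ s after cancellation of the common part, so it leads from the far end of `t`
to the far end of `s`. In the cases with a component `f` this uses that `f` composes with the common
part. -/
theorem rightEnd_eq {l m : Letter V} (hl : s = some l) (hm : c = some m) :
    m.rightEnd = l.rightEnd := by
  cases h with
  | one p f hf =>
    obtain rfl := Option.some.inj hl
    obtain rfl := Option.some.inj hm
    have hp := (hs _ rfl).1
    have := ((IsPath.append_iff hp hf).mp ht).2.2.1
    simp [Letter.rightEnd, List.head?_eq_some_head hf, List.getLast?_eq_some_getLast hp, this]
  | two w f hf =>
    obtain rfl := Option.some.inj hl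
    obtain rfl := Option.some.inj hm
    simp [Letter.rightEnd, List.head?_eq_some_head hf, List.head?_append]
  | three p q =>
    obtain rfl := Option.some.inj hl
    obtain rfl := Option.some.inj hm
    have hp := (hs _ rfl).1
    simp [Letter.rightEnd, List.getLast?_append, List.getLast?_eq_some_getLast hp]
  | three_empty q => cases hl

theorem leftEnd_eq {m : Letter V} (hm : c = some m) : m.leftEnd = t.rightEnd := by
  cases h with
  | one p f hf =>
    obtain rfl := Option.some.inj hm
    simp [Letter.rightEnd, Letter.leftEnd, List.getLast?_append, List.getLast?_eq_some_getLast hf]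
  | two w f hf =>
    obtain rfl := Option.some.inj hm
    have hw : w ≠ [] := ht.1
    have := ((IsPath.append_iff hf hw).mp (hs _ rfl)).2.2.1
    simp [Letter.rightEnd, Letter.leftEnd, List.getLast?_eq_some_getLast hf,
      List.head?_eq_some_head hw, this]
  | three p q =>
    obtain rfl := Option.some.inj hm
    have hq : q ≠ [] := ht.1
    simp [Letter.rightEnd, Letter.leftEnd, List.head?_append, List.head?_eq_some_head hq]
  | three_empty q => cases hm

/-- Whatever may precede `t̄` may precede the letter `c`. -/
theorem adj_left (hR : IsGentle R) {x m : Letter V} (hx : IsPath R x.path)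
    (hxt : Adj R x t.inv) (hm : c = some m) : Adj R x m := by
  cases h with
  | one p f hf =>
    obtain rfl := Option.some.inj hm
    have hp := (hs _ rfl).1
    have hpf : p ++ f ≠ [] := ht.1
    rcases x with ⟨_ | _, w⟩ <;> simp only [Letter.inv_mk, Bool.not_true] at hxt
    · rw [adj_inverse_inverse hx.1 hpf] at hxt
      rw [adj_inverse_inverse hx.1 hf]
      simpa [List.getLast_append, hf] using hxt
    · rw [adj_direct_inverse hx.1 hpf] at hxt
      rw [adj_direct_inverse hx.1 hf]
      simpa [List.getLast_append, hf] using hxt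
  | two w f hf =>
    obtain rfl := Option.some.inj hm
    have hw : w ≠ [] := ht.1
    have hfw := ((IsPath.append_iff hf hw).mp (hs _ rfl)).2.2
    rcases x with ⟨_ | _, v⟩ <;> simp only [Letter.inv_mk, Bool.not_false] at hxt
    · rw [adj_inverse_direct hx.1 hw] at hxt
      rw [adj_inverse_inverse hx.1 hf]
      have e : (f.getLast hf).left = (v.head hx.1).right := hfw.1.trans hxt.1.symm
      -- The last entry of `f` is followed without relation by the head of `w`. If the head of `v`
      -- also followed it without relation, gentleness would identify the two heads, against `hxt`.
      refine ⟨e.symm, by_contra fun hn => hxt.2 ?_⟩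
      exact hR.eq_of_right_nonrel e hfw.1 hn hfw.2
    · rw [adj_direct_direct hx.1 hw] at hxt
      rw [adj_direct_inverse hx.1 hf]
      exact ⟨hxt.1.trans hfw.1.symm, fun e => hfw.2 (e ▸ hxt.2)⟩
  | three p q =>
    obtain rfl := Option.some.inj hm
    have hq : q ≠ [] := ht.1
    have hqp : q ++ p ≠ [] := by simp [hq]
    rcases x with ⟨_ | _, w⟩ <;> simp only [Letter.inv_mk, Bool.not_false] at hxt
    · rw [adj_inverse_direct hx.1 hq] at hxt
      rw [adj_inverse_direct hx.1 hqp]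
      simpa [List.head_append, hq] using hxt
    · rw [adj_direct_direct hx.1 hq] at hxt
      rw [adj_direct_direct hx.1 hqp]
      simpa [List.head_append, hq] using hxt
  | three_empty q => cases hm

/-- Whatever may follow `s` may follow the letter `c`. -/
theorem adj_right (hR : IsGentle R) {y l m : Letter V} (hy : IsPath R y.path)
    (hl : s = some l) (hly : Adj R l y) (hm : c = some m) : Adj R m y := by
  cases h with
  | one p f hf =>
    obtain rfl := Option.some.inj hl
    obtain rfl := Option.some.inj hm
    have hp : p ≠ [] := (hs _ rfl).1
    have hpf := ((IsPath.append_iff hp hf).mp ht).2.2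
    rcases y with ⟨_ | _, w⟩
    · rw [adj_direct_inverse hp hy.1] at hly
      rw [adj_inverse_inverse hf hy.1]
      have e : (w.getLast hy.1).left = (f.head hf).right := hly.1.symm.trans hpf.1
      -- The mirrored argument: the last entries of `p` and of `w` cannot both precede the head of
      -- `f` without relation, since they differ.
      refine ⟨e.symm, by_contra fun hn => hly.2 ?_⟩
      exact hR.eq_of_left_nonrel hpf.1 e hpf.2 hn
    · rw [adj_direct_direct hp hy.1] at hly
      rw [adj_inverse_direct hf hy.1]
      exact ⟨hpf.1.symm.trans hly.1, fun e => hpf.2 (e ▸ hly.2)⟩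
  | two w f hf =>
    obtain rfl := Option.some.inj hl
    obtain rfl := Option.some.inj hm
    have hfw : f ++ w ≠ [] := by simp [hf]
    rcases y with ⟨_ | _, v⟩
    · rw [adj_inverse_inverse hfw hy.1] at hly
      rw [adj_inverse_inverse hf hy.1]
      simpa [List.head_append, hf] using hly
    · rw [adj_inverse_direct hfw hy.1] at hly
      rw [adj_inverse_direct hf hy.1]
      simpa [List.head_append, hf] using hly
  | three p q =>
    obtain rfl := Option.some.inj hl
    obtain rfl := Option.some.inj hm
    have hp : p ≠ [] := (hs _ rfl).1
    have hqp : q ++ p ≠ [] := by simp [hp]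
    rcases y with ⟨_ | _, w⟩
    · rw [adj_direct_inverse hp hy.1] at hly
      rw [adj_direct_inverse hqp hy.1]
      simpa [List.getLast_append, hp] using hly
    · rw [adj_direct_direct hp hy.1] at hly
      rw [adj_direct_direct hqp hy.1]
      simpa [List.getLast_append, hp] using hly
  | three_empty q => cases hl

/-- If there is a component `f`, then `s` and `t` begin in the same way. -/
theorem adj_source {y : Letter V} (hf : f ≠ none) (hy : Adj R y t) :
    ∃ l, s = some l ∧ Adj R y l := by
  cases h with
  | one p f hf =>
    have hp : p ≠ [] := (hs _ rfl).1
    refine ⟨_, rfl, ?_⟩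
    rcases y with ⟨_ | _, v⟩ <;>
      simpa [Adj, Letter.leftEnd, List.head?_append, List.head?_eq_some_head hp] using hy
  | two w f hf =>
    have hw : w ≠ [] := ht.1
    refine ⟨_, rfl, ?_⟩
    rcases y with ⟨_ | _, v⟩ <;>
      simpa [Adj, Letter.leftEnd, List.getLast?_append, List.getLast?_eq_some_getLast hw] using hy
  | three p q => exact absurd rfl hf
  | three_empty q => exact absurd rfl hf

/-- The letter `c` is a path outside the ideal. -/
theorem isPath (hc : f = none → ∀ m ∈ c, IsPath R m.path) : ∀ m ∈ c, IsPath R m.path := by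
  cases h with
  | one p f hf =>
    rintro _ ⟨rfl⟩
    exact ((IsPath.append_iff (hs _ rfl).1 hf).mp ht).2.1
  | two w f hf =>
    rintro _ ⟨rfl⟩
    exact ((IsPath.append_iff hf ht.1).mp (hs _ rfl)).1
  | three p q => exact hc rfl
  | three_empty q => exact hc rfl

/-- If a letter may precede both `s` and `t`, then `c` is a path outside the ideal. -/
theorem isPath_of_adj (hR : IsGentle R) {x : Letter V} (hx : IsPath R x.path)
    (hxs : ∀ l ∈ s, Adj R x l) (hxt : Adj R x t) : ∀ m ∈ c, IsPath R m.path := by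
  refine h.isPath hs ht fun hf => ?_
  cases h with
  | one p f hf' => cases hf
  | two w f hf' => cases hf
  | three p q =>
    rintro _ ⟨rfl⟩
    exact hR.isPath_append_of_adj hx (hs _ rfl) ht (hxs _ rfl) hxt
  | three_empty q => rintro _ ⟨⟩

end

end EndCondition

end Letters

/-! ### The elements of the algebra given by letters -/

section Elements

variable (k : Type u) [Field k] {V : Type u} [Fintype V] [Quiver.{u} V]
  (R : Arrow V → Arrow V → Prop)

theorem idemElt_mul_self (x : Option V) : idemElt k R x * idemElt k R x = idemElt k R x := by
  rcases x with _ | x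
  · simp [idemElt]
  · simp only [idemElt, ← map_mul, PathAlgebra.vertex]
    exact congrArg _ (RingQuot.mkAlgHom_rel k (PathRel.idem x))

theorem idemElt_mul_arrowElt (a : Arrow V) :
    idemElt k R (some a.right) * arrowElt k R a = arrowElt k R a := by
  simp only [arrowElt, idemElt, ← map_mul, PathAlgebra.arrow, PathAlgebra.vertex]
  exact congrArg _ (RingQuot.mkAlgHom_rel k (PathRel.target a))

theorem idemElt_mul_pathElt {p : List (Arrow V)} (hp : p ≠ []) :
    idemElt k R (p.head?.map (·.right)) * pathElt k R p = pathElt k R p := by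
  obtain ⟨a, q, rfl⟩ := List.exists_cons_of_ne_nil hp
  simp [pathElt, ← mul_assoc, idemElt_mul_arrowElt]

theorem pathElt_append (p q : List (Arrow V)) :
    pathElt k R (p ++ q) = pathElt k R p * pathElt k R q := by
  simp [pathElt]

theorem forward_inv (o : Option (Letter V)) :
    forward k R (o.map Letter.inv) = backward k R o := by
  rcases o with _ | ⟨_ | _, p⟩ <;> rfl

theorem backward_inv (o : Option (Letter V)) :
    backward k R (o.map Letter.inv) = forward k R o := by
  rcases o with _ | ⟨_ | _, p⟩ <;> rfl

variable {R}

theorem idemElt_mul_forward {l : Letter V} (hl : l.path ≠ []) :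
    idemElt k R l.leftEnd * forward k R (some l) = forward k R (some l) := by
  rcases l with ⟨_ | _, p⟩
  · simp [forward]
  · simpa [forward, Letter.leftEnd] using idemElt_mul_pathElt k R hl

theorem idemElt_mul_backward {l : Letter V} (hl : l.path ≠ []) :
    idemElt k R l.rightEnd * backward k R (some l) = backward k R (some l) := by
  rcases l with ⟨_ | _, p⟩
  · simpa [backward, Letter.rightEnd] using idemElt_mul_pathElt k R hl
  · simp [backward]

namespace EndCondition

variable {s c : Option (Letter V)} {t : Letter V} {f : Option (List (Arrow V))}

/-- The right-hand side is the zigzag created by the elimination: in along `t`, out along `s`. It is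
nonzero at most when `t` is inverse and `s` direct; in the other cases c has no direct form and both
sides vanish. -/
theorem forward_eq (h : EndCondition s t c f) :
    forward k R c = backward k R (some t) * forward k R s := by
  cases h <;> simp [forward, backward, pathElt_append]

/-- The component of the graph map next to the overlap becomes the inverse letter of c. Without such
a component c is direct or empty. -/
theorem backward_eq (h : EndCondition s t c f) :
    backward k R c = f.elim 0 (pathElt k R) := by
  cases h <;> simp [backward]

/-- The composition of `t` on one side of a trivial overlap with `s` on the other side vanishes. -/
theorem backward_mul_forward (hR : IsGentle R) {s' c' : Option (Letter V)} {t' : Letter V}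
    {f' : Option (List (Arrow V))} (h : EndCondition s t c f) (h' : EndCondition s' t' c' f')
    (hs : ∀ l ∈ s, IsPath R l.path) (ht : IsPath R t.path)
    (hs' : ∀ l ∈ s', IsPath R l.path) (ht' : IsPath R t'.path)
    (hadj : Adj R t'.inv t) (hadj' : ∀ l ∈ s', ∀ m ∈ s, Adj R l.inv m)
    (hc : f = none → f' = none → ∀ m ∈ c', IsPath R m.path) :
    backward k R (some t) * forward k R s' = 0 := by
  -- Only an inverse `t` and a direct `s'` contribute, which leaves the cases `one` and `three` for
  -- `h'`.
  rcases t with ⟨_ | _, q⟩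
  swap
  · simp [backward]
  have hq : q ≠ [] := ht.1
  cases h' with
  | one p f hf =>
    have hp : p ≠ [] := (hs' _ rfl).1
    have hpf : p ++ f ≠ [] := ht'.1
    simp only [Letter.inv_mk, Bool.not_true] at hadj
    rw [adj_inverse_inverse hpf hq] at hadj
    refine Diagram.pathElt_mul_pathElt R hq hp ?_
    simpa [List.head_append, hp, List.getLast?_eq_some_getLast hq, List.head?_eq_some_head hp]
      using hadj.2
  | two w f hf => simp [forward]
  | three p' r =>
    have hp : p' ≠ [] := (hs' _ rfl).1
    have hr : r ≠ [] := ht'.1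
    simp only [Letter.inv_mk, Bool.not_false] at hadj
    rw [adj_direct_inverse hr hq] at hadj
    refine Diagram.pathElt_mul_pathElt R hq hp ?_
    -- With no components present, `r ++ p'` is a path by compatible orientation. The last entries
    -- of `q` and `r` start at the same vertex and are distinct, and only one arrow can precede the
    -- head of `p'` without relation. So `q` is in relation with `p'`.
    have key : f = none → R (q.getLast hq) (p'.head hp) := by
      intro hf
      have := ((IsPath.append_iff hr hp).mp (hc hf rfl _ rfl)).2.2
      refine by_contra fun hn => hadj.2 ?_
      exact hR.eq_of_left_nonrel this.1 (hadj.1.symm.trans this.1) this.2 hn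
    suffices R (q.getLast hq) (p'.head hp) by
      simpa [List.getLast?_eq_some_getLast hq, List.head?_eq_some_head hp] using this
    -- If `s` ends in `q`, the relation is already visible in σ, where the inverse of `s'` meets
    -- `s`. Otherwise there is no component and `key` applies.
    cases h with
    | two w f hf =>
      have := hadj' _ rfl _ rfl
      have hfq : f ++ q ≠ [] := by simp [hf]
      simp only [Letter.inv_mk, Bool.not_true] at this
      rw [adj_inverse_inverse hp hfq] at this
      simpa [List.getLast_append, hq] using this.2
    | three p q => exact key rfl
    | three_empty q => exact key rfl
  | three_empty q => simp [forward]

end EndCondition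

end Elements

/-! ### The word c is a homotopy string -/

section ConeString

variable {V : Type u} [Quiver.{u} V] {R : Arrow V → Arrow V → Prop}

/-- If the overlap is trivial, then the letter `c` is a path outside the ideal. -/
theorem EndCondition.isPath_of_trivial (hR : IsGentle R) {s c s' c' : Option (Letter V)}
    {t t' : Letter V} {f f' : Option (List (Arrow V))} (h : EndCondition s t c f)
    (h' : EndCondition s' t' c' f')
    (hs : ∀ l ∈ s, IsPath R l.path) (ht : IsPath R t.path)
    (hs' : ∀ l ∈ s', IsPath R l.path) (ht' : IsPath R t'.path)
    (hadj : Adj R t'.inv t) (hadj' : ∀ l ∈ s', ∀ m ∈ s, Adj R l.inv m)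
    (hc : f = none → f' = none → ∀ m ∈ c, IsPath R m.path) : ∀ m ∈ c, IsPath R m.path := by
  by_cases hf' : f' = none
  · exact h.isPath hs ht fun hf => hc hf hf'
  -- If the other side has a component, its letters `s'` and `t'` agree next to the overlap. The
  -- inverse of `s'` may then precede both `s` and `t`, as a letter of a nontrivial overlap would.
  · have := hadj.inv
    rw [Letter.inv_inv] at this
    obtain ⟨l, hl, hadj₂⟩ := h'.adj_source hs' ht' hf' this
    refine h.isPath_of_adj hs ht hR (x := l.inv) (hs' l hl) (hadj' l hl) ?_
    simpa using hadj₂.inv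

theorem prepend_get?_of_lt (l : List (Letter V)) (s : Stream'.Seq (Letter V)) {m : ℕ}
    (hm : m < l.length) : (prepend l s).get? m = l[m]? := by
  induction l generalizing m with
  | nil => simp at hm
  | cons a l ih =>
    rcases m with _ | m
    · simp [prepend]
    · simpa [prepend] using ih (by simpa using hm)

theorem prepend_get?_add (l : List (Letter V)) (s : Stream'.Seq (Letter V)) (m : ℕ) :
    (prepend l s).get? (l.length + m) = s.get? m := by
  induction l with
  | nil => simp [prepend]
  | cons a l ih =>
    rw [List.length_cons, Nat.add_right_comm]
    simpa [prepend] using ih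

theorem consLetter_get?_zero (l : Option (Letter V)) (s : Stream'.Seq (Letter V)) :
    (consLetter l s).get? 0 = l := by
  cases l <;> simp [consLetter]

theorem consLetter_get?_succ {l : Option (Letter V)} {s : Stream'.Seq (Letter V)}
    (h : l = none → s = Stream'.Seq.nil) (m : ℕ) :
    (consLetter l s).get? (m + 1) = s.get? m := by
  cases l
  · simp [consLetter, h]
  · simp [consLetter]

theorem Word.letter_natCast (w : Word V) (m : ℕ) : w.letter m = w.right.get? m := rfl

theorem Word.letter_neg (w : Word V) (m : ℕ) : w.letter (-(m : ℤ) - 1) = w.left.get? m := by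
  rw [show -(m : ℤ) - 1 = Int.negSucc m by omega]; rfl

namespace Overlap

variable (O : Overlap V)

theorem length_tau : O.tau.length = O.δ.length + 1 + (O.ρ.length + 1 + O.γ.length) := by
  simp [tau]; ring

instance : NeZero O.tau.length := ⟨by rw [length_tau]; omega⟩

/-- The letter of `τ` between the positions `z` and `z + 1`, with `z` read modulo the length. -/
def bandLetter (z : ℤ) : Option (Letter V) := O.tau[(z : ZMod O.tau.length).val]?

theorem val_intCast {z : ℤ} (h : 0 ≤ z) (h' : z < O.tau.length) :
    ((z : ZMod O.tau.length).val : ℤ) = z := by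
  rw [ZMod.val_intCast, Int.emod_eq_of_lt h h']

theorem val_natCast {m : ℕ} (h : m < O.tau.length) :
    ((m : ℤ) : ZMod O.tau.length).val = m := by
  have := O.val_intCast (z := m) (by omega) (by omega)
  omega

theorem intCast_add_length (z : ℤ) :
    ((z + O.tau.length : ℤ) : ZMod O.tau.length) = (z : ZMod O.tau.length) := by
  simp

theorem bandLetter_natCast {m : ℕ} (h : m < O.tau.length) : O.bandLetter m = O.tau[m]? := by
  rw [bandLetter, val_natCast O h]

theorem bandLetter_add_length (z : ℤ) : O.bandLetter (z + O.tau.length) = O.bandLetter z := by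
  rw [bandLetter, intCast_add_length, bandLetter]

theorem exists_bandLetter (z : ℤ) : ∃ l, O.bandLetter z = some l :=
  ⟨_, List.getElem?_eq_getElem (ZMod.val_lt _)⟩

theorem bandLetter_τL : O.bandLetter O.δ.length = some O.τL := by
  rw [bandLetter_natCast O (by rw [length_tau]; omega)]
  simp [tau]

theorem bandLetter_ρ {i : ℕ} (hi : i < O.ρ.length) :
    O.bandLetter (O.δ.length + 1 + i) = O.ρ[i]? := by
  have : (O.δ.length + 1 + i : ℤ) = ((O.δ.length + 1 + i : ℕ) : ℤ) := by push_cast; ring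
  rw [this, bandLetter_natCast O (by rw [length_tau]; omega), tau,
    List.getElem?_append_right (by omega),
    show O.δ.length + 1 + i - O.δ.length = i + 1 by omega, List.getElem?_cons_succ,
    List.getElem?_append_left hi]

theorem bandLetter_τR : O.bandLetter (O.δ.length + 1 + O.ρ.length) = some O.τR := by
  have : (O.δ.length + 1 + O.ρ.length : ℤ) = ((O.δ.length + 1 + O.ρ.length : ℕ) : ℤ) := by
    push_cast; ring
  rw [this, bandLetter_natCast O (by rw [length_tau]; omega), tau,
    List.getElem?_append_right (by omega),
    show O.δ.length + 1 + O.ρ.length - O.δ.length = O.ρ.length + 1 by omega,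
    List.getElem?_cons_succ, List.getElem?_append_right le_rfl]
  simp

theorem sigma_letter_ρ {i : ℕ} (hi : i < O.ρ.length) : O.sigma.letter i = O.ρ[i]? :=
  prepend_get?_of_lt _ _ hi

theorem sigma_letter_σR : O.sigma.letter O.ρ.length = O.σR := by
  rw [Word.letter_natCast, sigma, ← Nat.add_zero O.ρ.length, prepend_get?_add,
    consLetter_get?_zero]

theorem sigma_letter_σL : O.sigma.letter (-1) = O.σL :=
  consLetter_get?_zero _ _

theorem cone_letter_cR : O.cone.letter O.γ.length = O.cR := by
  have : O.γ.length = (O.γ.reverse.map Letter.inv).length + 0 := by simp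
  rw [Word.letter_natCast, cone, this, prepend_get?_add, consLetter_get?_zero]

theorem cone_letter_cL : O.cone.letter (-O.δ.length - 1) = O.cL := by
  have : O.δ.length = (O.δ.map Letter.inv).length + 0 := by simp
  rw [Word.letter_neg, cone, this, prepend_get?_add, consLetter_get?_zero]

/-- The base vertex of c is the left end of τ, and c runs through τ backwards. Position `i` of c is
therefore position `-i` of τ modulo its length, and letter `i` of c is letter `-i - 1` of τ
inverted. This treats δ̄ and γ̄ uniformly. -/
theorem cone_letter_mid {i : ℤ} (h : -O.δ.length ≤ i) (h' : i < O.γ.length) :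
    O.cone.letter i = (O.bandLetter (-i - 1)).map Letter.inv := by
  have hn := O.length_tau
  rcases le_or_gt 0 i with hi | hi
  · obtain ⟨m, rfl⟩ := Int.eq_ofNat_of_zero_le hi
    have e : (-(m : ℤ) - 1 + O.tau.length) = ((O.tau.length - 1 - m : ℕ) : ℤ) := by omega
    rw [← bandLetter_add_length, e, bandLetter_natCast O (by omega), Word.letter_natCast, cone,
      prepend_get?_of_lt _ _ (by simp; omega),
      show O.tau.length - 1 - m = O.δ.length + ((O.γ.length - 1 - m) + O.ρ.length + 1 + 1) by omega,
      tau, List.getElem?_append_right (by omega), Nat.add_sub_cancel_left,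
      List.getElem?_cons_succ, List.getElem?_append_right (by omega),
      show O.γ.length - 1 - m + O.ρ.length + 1 - O.ρ.length = O.γ.length - 1 - m + 1 by omega,
      List.getElem?_cons_succ, List.getElem?_map, List.getElem?_reverse (by omega)]
  · obtain ⟨m, rfl⟩ : ∃ m : ℕ, i = -(m : ℤ) - 1 := ⟨(-i - 1).toNat, by omega⟩
    rw [show -(-(m : ℤ) - 1) - 1 = (m : ℤ) by omega, bandLetter_natCast O (by omega),
      Word.letter_neg, cone, prepend_get?_of_lt _ _ (by simp; omega), tau,
      List.getElem?_append_left (by omega), List.getElem?_map]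

variable {O}

theorem _root_.GentleCone.IsHomotopyBand.adj (hτ : IsHomotopyBand R O.tau) {z : ℤ} {l m : Letter V}
    (hl : O.bandLetter z = some l) (hm : O.bandLetter (z + 1) = some m) : Adj R l m := by
  obtain ⟨m', hm', h, -⟩ := hτ.next (z : ZMod O.tau.length) hl
  have e : ((z + 1 : ℤ) : ZMod O.tau.length) = (z : ZMod O.tau.length) + 1 := by push_cast; rfl
  rw [bandLetter, e, hm'] at hm
  exact Option.some.inj hm ▸ h

theorem _root_.GentleCone.IsHomotopyBand.isPath_bandLetter (hτ : IsHomotopyBand R O.tau) {z : ℤ}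
    {l : Letter V} (hl : O.bandLetter z = some l) : IsPath R l.path :=
  hτ.isPath l (List.mem_of_getElem? hl)

namespace IsGraphOverlap

variable (hO : O.IsGraphOverlap)
include hO

theorem cR_eq_none : O.cR = none ↔ O.σR = none := hO.right.eq_none_iff

theorem cL_eq_none : O.cL = none ↔ O.σL = none := by
  simpa using hO.left.eq_none_iff

/-- Letter |γ| of c is c_R and letter |ρ| of σ is σ_R. Both are followed by α, whence the offset. -/
theorem cone_letter_right {i : ℤ} (h : O.γ.length + 1 ≤ i) :
    O.cone.letter i = O.sigma.letter (i - O.γ.length + O.ρ.length) := by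
  obtain ⟨m, rfl⟩ : ∃ m : ℕ, i = ((O.γ.length + (m + 1) : ℕ) : ℤ) :=
    ⟨(i - O.γ.length - 1).toNat, by omega⟩
  have e : ((O.γ.length + (m + 1) : ℕ) : ℤ) - O.γ.length + O.ρ.length =
    ((O.ρ.length + (m + 1) : ℕ) : ℤ) := by omega
  rw [e, Word.letter_natCast, Word.letter_natCast, sigma, cone,
    show O.γ.length = (O.γ.reverse.map Letter.inv).length by simp, prepend_get?_add,
    prepend_get?_add, consLetter_get?_succ hO.α_nil,
    consLetter_get?_succ fun h => hO.α_nil (hO.cR_eq_none.mp h)]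

theorem cone_letter_left {i : ℤ} (h : i ≤ -O.δ.length - 2) :
    O.cone.letter i = O.sigma.letter (i + O.δ.length) := by
  obtain ⟨m, rfl⟩ : ∃ m : ℕ, i = -((O.δ.length + (m + 1) : ℕ) : ℤ) - 1 :=
    ⟨(-i - O.δ.length - 2).toNat, by omega⟩
  have e : -((O.δ.length + (m + 1) : ℕ) : ℤ) - 1 + O.δ.length = -((m + 1 : ℕ) : ℤ) - 1 := by omega
  rw [e, Word.letter_neg, Word.letter_neg, sigma, cone,
    show O.δ.length = (O.δ.map Letter.inv).length by simp, prepend_get?_add,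
    consLetter_get?_succ hO.β_nil,
    consLetter_get?_succ fun h => hO.β_nil (hO.cL_eq_none.mp h)]

section

variable (hR : IsGentle R) (hσ : O.sigma.IsHomotopyString R) (hτ : IsHomotopyBand R O.tau)

omit hO in
theorem isPath_σR (hσ : O.sigma.IsHomotopyString R) : ∀ l ∈ O.σR, IsPath R l.path :=
  fun l hl => hσ.isPath O.ρ.length l (by rw [sigma_letter_σR]; exact hl)

omit hO in
theorem isPath_σL (hσ : O.sigma.IsHomotopyString R) :
    ∀ l ∈ O.σL.map Letter.inv, IsPath R l.path := by
  intro l hl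
  obtain ⟨m, hm, rfl⟩ := Option.map_eq_some_iff.mp hl
  exact hσ.isPath (-1) m (by rw [sigma_letter_σL]; exact hm)

omit hO in
theorem isPath_τR (hτ : IsHomotopyBand R O.tau) : IsPath R O.τR.path :=
  hτ.isPath_bandLetter O.bandLetter_τR

omit hO in
theorem isPath_τL (hτ : IsHomotopyBand R O.tau) : IsPath R O.τL.inv.path :=
  hτ.isPath_bandLetter (l := O.τL) O.bandLetter_τL

omit hO in
theorem adj_τL_τR (hτ : IsHomotopyBand R O.tau) (hρ : O.ρ = []) : Adj R O.τL O.τR := by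
  refine hτ.adj O.bandLetter_τL ?_
  have := O.bandLetter_τR
  simpa [hρ] using this

omit hO in
theorem adj_σL_σR (hσ : O.sigma.IsHomotopyString R) (hρ : O.ρ = []) :
    ∀ l ∈ O.σL, ∀ m ∈ O.σR, Adj R l m := by
  intro l hl m hm
  refine hσ.adj (-1) l (by rw [sigma_letter_σL]; exact hl) m ?_
  have := O.sigma_letter_σR
  rw [hρ] at this
  exact this.trans hm

include hR hσ hτ

/-- Compatible orientation matters only for a trivial overlap. Otherwise the last letter of ρ may
precede both σ_R and τ_R, and gentleness alone makes c_R a path. -/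
theorem isPath_cR (hor : O.CompatiblyOriented R) : ∀ l ∈ O.cR, IsPath R l.path := by
  by_cases hρ : O.ρ = []
  · refine hO.right.isPath_of_trivial hR hO.left (isPath_σR hσ) (isPath_τR hτ) (isPath_σL hσ)
      (isPath_τL hτ) ?_ ?_ fun hr hl => (hor hρ hl hr).2
    · simpa using adj_τL_τR hτ hρ
    · intro l hl m hm
      obtain ⟨l', hl', rfl⟩ := Option.map_eq_some_iff.mp hl
      simpa using adj_σL_σR hσ hρ l' hl' m hm
  · have hpos : 0 < O.ρ.length := List.length_pos_iff.mpr hρ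
    have hlt : O.ρ.length - 1 < O.ρ.length := by omega
    have h1 : O.sigma.letter ((O.ρ.length - 1 : ℕ) : ℤ) = some O.ρ[O.ρ.length - 1] := by
      rw [sigma_letter_ρ O hlt, List.getElem?_eq_getElem hlt]
    have h2 : O.bandLetter (O.δ.length + 1 + (O.ρ.length - 1 : ℕ)) =
        some O.ρ[O.ρ.length - 1] := by
      rw [bandLetter_ρ O hlt, List.getElem?_eq_getElem hlt]
    refine hO.right.isPath_of_adj (isPath_σR hσ) (isPath_τR hτ) hR (hσ.isPath _ _ h1) ?_ ?_
    · intro l hl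
      refine hσ.adj _ _ h1 l ?_
      rw [show ((O.ρ.length - 1 : ℕ) : ℤ) + 1 = O.ρ.length by omega, sigma_letter_σR]
      exact hl
    · refine hτ.adj h2 ?_
      rw [show (O.δ.length + 1 + (O.ρ.length - 1 : ℕ) : ℤ) + 1 = O.δ.length + 1 + O.ρ.length by
        omega, bandLetter_τR]

theorem isPath_cL (hor : O.CompatiblyOriented R) :
    ∀ l ∈ O.cL.map Letter.inv, IsPath R l.path := by
  by_cases hρ : O.ρ = []
  · refine hO.left.isPath_of_trivial hR hO.right (isPath_σL hσ) (isPath_τL hτ) (isPath_σR hσ)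
      (isPath_τR hτ) (adj_τL_τR hτ hρ).inv ?_ ?_
    · intro m hm l hl
      obtain ⟨l', hl', rfl⟩ := Option.map_eq_some_iff.mp hl
      exact (adj_σL_σR hσ hρ l' hl' m hm).inv
    · intro hl hr m hm
      obtain ⟨m', hm', rfl⟩ := Option.map_eq_some_iff.mp hm
      exact (hor hρ hl hr).1 m' hm'
  · have hpos : 0 < O.ρ.length := List.length_pos_iff.mpr hρ
    have h1 : O.sigma.letter ((0 : ℕ) : ℤ) = some O.ρ[0] := by
      rw [sigma_letter_ρ O hpos, List.getElem?_eq_getElem hpos]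
    have h2 : O.bandLetter (O.δ.length + 1 + (0 : ℕ)) = some O.ρ[0] := by
      rw [bandLetter_ρ O hpos, List.getElem?_eq_getElem hpos]
    refine hO.left.isPath_of_adj (isPath_σL hσ) (isPath_τL hτ) hR (x := O.ρ[0].inv)
      (hσ.isPath _ O.ρ[0] h1) ?_ ?_
    · intro l hl
      obtain ⟨l', hl', rfl⟩ := Option.map_eq_some_iff.mp hl
      exact (hσ.adj (-1) l' (by rw [sigma_letter_σL]; exact hl') _ h1).inv
    · exact (hτ.adj O.bandLetter_τL (by simpa using h2)).inv

theorem adj_cR {x c : Letter V} (hx : IsPath R x.path) (h : Adj R x O.τR.inv)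
    (hc : O.cR = some c) : Adj R x c :=
  hO.right.adj_left (isPath_σR hσ) (isPath_τR hτ) hR hx h hc

theorem adj_cL {x c : Letter V} (hx : IsPath R x.path) (h : Adj R O.τL.inv x)
    (hc : O.cL = some c) : Adj R c x := by
  have := hO.left.adj_left (isPath_σL hσ) (isPath_τL hτ) hR (x := x.inv) hx (m := c.inv)
    (by simpa using h.inv) (by simp [hc])
  exact adj_inv_iff.mp this

theorem isHomotopyString (hor : O.CompatiblyOriented R) : O.cone.IsHomotopyString R := by
  have hn := O.length_tau
  have mid : ∀ {i : ℤ} {l : Letter V}, -O.δ.length ≤ i → i < O.γ.length →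
      O.cone.letter i = some l → ∃ l', O.bandLetter (-i - 1) = some l' ∧ l = l'.inv := by
    intro i l h h' hl
    rw [cone_letter_mid O h h'] at hl
    obtain ⟨l', hl', rfl⟩ := Option.map_eq_some_iff.mp hl
    exact ⟨l', hl', rfl⟩
  -- The arc outside the overlap is indexed from −|γ| to |δ|, so the letter after τ_R can carry a
  -- nonpositive index. The second alternative allows for one full turn.
  have band_adj : ∀ {z w : ℤ} {l m : Letter V}, O.bandLetter z = some l →
      O.bandLetter w = some m → z + 1 = w ∨ z + 1 = w + O.tau.length → Adj R l m := by
    intro z w l m hl hm h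
    rcases h with rfl | h
    · exact hτ.adj hl hm
    · refine hτ.adj hl ?_
      rw [h, bandLetter_add_length, hm]
  have last := O.bandLetter_τR
  have first := O.bandLetter_τL
  obtain ⟨t₀, ht₀⟩ := O.exists_bandLetter 0
  have hy : t₀.leftEnd = some O.y := by
    have h0 := O.bandLetter_natCast (m := 0) (by omega)
    rw [Nat.cast_zero, ht₀] at h0
    have := hO.base'
    rw [List.head?_eq_getElem?, ← h0] at this
    exact this
  have base : O.cone.base = O.y := rfl
  refine ⟨?_, ?_, ?_, ?_, ?_, ?_⟩
  · intro i l hl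
    rcases lt_or_ge i (O.γ.length + 1) with h | h
    swap
    · rw [hO.cone_letter_right h] at hl
      exact hσ.isPath _ l hl
    rcases eq_or_ne i O.γ.length with rfl | h1
    · rw [cone_letter_cR] at hl
      exact hO.isPath_cR hR hσ hτ hor l hl
    rcases le_or_gt (-O.δ.length : ℤ) i with h2 | h2
    · obtain ⟨l', hl', rfl⟩ := mid h2 (by omega) hl
      exact hτ.isPath_bandLetter (l := l') hl'
    rcases eq_or_ne i (-O.δ.length - 1) with rfl | h3
    · rw [cone_letter_cL] at hl
      exact hO.isPath_cL hR hσ hτ hor l.inv (by rw [hl]; rfl)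
    · rw [hO.cone_letter_left (by omega)] at hl
      exact hσ.isPath _ l hl
  · intro l hl
    rcases Nat.eq_zero_or_pos O.γ.length with h | h
    · have h' := O.cone_letter_cR
      rw [h] at h'
      have hl' : O.cR = some l := h'.symm.trans hl
      rw [hO.right.leftEnd_eq (isPath_σR hσ) (isPath_τR hτ) hl']
      rw [(band_adj last ht₀ (by omega)).1, hy, base]
    · obtain ⟨l', hl', rfl⟩ := mid (i := 0) (by omega) (by omega) hl
      rw [Letter.leftEnd_inv, (band_adj hl' ht₀ (by omega)).1, hy, base]
  · intro l hl
    rcases Nat.eq_zero_or_pos O.δ.length with h | h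
    · have h' := O.cone_letter_cL
      rw [h] at h'
      have hl' : O.cL = some l := h'.symm.trans hl
      have := hO.left.leftEnd_eq (isPath_σL hσ) (isPath_τL hτ) (m := l.inv) (by rw [hl']; rfl)
      rw [Letter.leftEnd_inv, Letter.rightEnd_inv] at this
      rw [h, Nat.cast_zero, ht₀] at first
      rw [this, ← Option.some.inj first, hy, base]
    · obtain ⟨l', hl', rfl⟩ := mid (i := -1) (by omega) (by omega) hl
      rw [show (-(-1) - 1 : ℤ) = 0 by norm_num, ht₀] at hl'
      rw [Letter.rightEnd_inv, ← Option.some.inj hl', hy, base]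
  · intro i l hl m hm
    rcases le_or_gt (O.γ.length + 1 : ℤ) i with h | h
    · rw [hO.cone_letter_right h] at hl
      rw [hO.cone_letter_right (by omega),
        show i + 1 - O.γ.length + O.ρ.length = i - O.γ.length + O.ρ.length + 1 by ring] at hm
      exact hσ.adj _ l hl m hm
    rcases eq_or_ne i O.γ.length with rfl | h1
    · rw [cone_letter_cR] at hl
      rw [hO.cone_letter_right (by omega)] at hm
      obtain ⟨s, hs⟩ : ∃ s, O.σR = some s := by
        rw [← Option.ne_none_iff_exists', Ne, ← hO.cR_eq_none, Option.mem_def.mp hl]; simp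
      rw [show (O.γ.length + 1 - O.γ.length + O.ρ.length : ℤ) = O.ρ.length + 1 by ring] at hm
      refine hO.right.adj_right (isPath_σR hσ) (isPath_τR hτ) hR (hσ.isPath _ m hm) hs ?_ hl
      exact hσ.adj _ s (by rw [sigma_letter_σR]; exact hs) m hm
    rcases eq_or_ne i (O.γ.length - 1) with h2 | h2
    · rw [h2, sub_add_cancel, cone_letter_cR] at hm
      rcases le_or_gt (-O.δ.length : ℤ) i with h3 | h3
      · obtain ⟨l', hl', rfl⟩ := mid h3 (by omega) hl
        exact hO.adj_cR hR hσ hτ (hτ.isPath_bandLetter (l := l') hl')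
          (band_adj last hl' (by omega)).inv hm
      -- Here δ and γ are both empty and c_L meets c_R directly. Start from the cyclic junction τ_R
      -- τ_L, inverted, and replace τ̄_R by c_R and then τ̄_L by c_L.
      · obtain rfl : i = -O.δ.length - 1 := by omega
        rw [cone_letter_cL] at hl
        have hd : O.δ.length = 0 := by omega
        have hτL : Adj R O.τR O.τL := band_adj last first (by omega)
        refine hO.adj_cL hR hσ hτ (hO.isPath_cR hR hσ hτ hor m hm) ?_ hl
        exact hO.adj_cR hR hσ hτ (isPath_τL hτ) hτL.inv hm
    rcases le_or_gt (-O.δ.length : ℤ) i with h3 | h3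
    · obtain ⟨l', hl', rfl⟩ := mid h3 (by omega) hl
      obtain ⟨m', hm', rfl⟩ := mid (by omega) (by omega) hm
      exact (band_adj hm' hl' (by omega)).inv
    rcases eq_or_ne i (-O.δ.length - 1) with h4 | h4
    · rw [h4, cone_letter_cL] at hl
      obtain ⟨m', hm', rfl⟩ := mid (by omega) (by omega) hm
      exact hO.adj_cL hR hσ hτ (hτ.isPath_bandLetter (l := m') hm')
        (band_adj hm' first (by omega)).inv hl
    rcases eq_or_ne i (-O.δ.length - 2) with h5 | h5
    · rw [hO.cone_letter_left (by omega)] at hl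
      rw [h5, show (-O.δ.length - 2 + 1 : ℤ) = -O.δ.length - 1 by ring, cone_letter_cL] at hm
      obtain ⟨s, hs⟩ : ∃ s, O.σL = some s := by
        rw [← Option.ne_none_iff_exists', Ne, ← hO.cL_eq_none, Option.mem_def.mp hm]; simp
      rw [h5, show (-O.δ.length - 2 + O.δ.length : ℤ) = -2 by ring] at hl
      have := hσ.adj _ l hl s (by
        rw [show (-2 + 1 : ℤ) = -1 by norm_num, sigma_letter_σL]; exact hs)
      refine adj_inv_iff.mp (hO.left.adj_right (isPath_σL hσ) (isPath_τL hτ) hR (y := l.inv)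
        (l := s.inv) (m := m.inv) (hσ.isPath _ l hl) (by rw [hs]; rfl) this.inv
        (by rw [Option.mem_def.mp hm]; rfl))
    · rw [hO.cone_letter_left (by omega)] at hl
      rw [hO.cone_letter_left (by omega),
        show i + 1 + O.δ.length = i + O.δ.length + 1 by ring] at hm
      exact hσ.adj _ l hl m hm
  -- Far from the base vertex c coincides with σ up to a shift, so the antipath conditions are
  -- inherited.
  · obtain ⟨N, hN⟩ := hσ.antipath_right
    refine ⟨N + O.γ.length + 1, fun m hm l hl => hN (m - O.γ.length + O.ρ.length) (by omega) l ?_⟩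
    have hl' : O.cone.letter m = some l := hl
    rw [hO.cone_letter_right (by omega),
      show (m - O.γ.length + O.ρ.length : ℤ) = ((m - O.γ.length + O.ρ.length : ℕ) : ℤ) by omega]
      at hl'
    exact hl'
  · obtain ⟨N, hN⟩ := hσ.antipath_left
    refine ⟨N + O.δ.length + 1, fun m hm l hl => hN (m - O.δ.length) (by omega) l ?_⟩
    have hl' : O.cone.letter (-m - 1) = some l := (O.cone.letter_neg m).trans hl
    rw [hO.cone_letter_left (by omega),
      show (-m - 1 + O.δ.length : ℤ) = -((m - O.δ.length : ℕ) : ℤ) - 1 by omega,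
      Word.letter_neg] at hl'
    exact hl'

end

end IsGraphOverlap
end Overlap
end ConeString

/-! ### Linear maps on the modules of unfolded diagrams, and rescaling -/

section DiagramMaps

variable {k : Type u} [Field k] {V : Type u} [Fintype V] [Quiver.{u} V]
  {R : Arrow V → Arrow V → Prop} {ι : Type}

/-- Linear maps on a free module agree if they agree on the basis. -/
theorem eq_of_single {A M : Type u} [Ring A] [AddCommGroup M] [Module A M]
    {L L' : (ι →₀ A) →ₗ[A] M}
    (h : ∀ i, L (Finsupp.single i 1) = L' (Finsupp.single i 1)) (x : ι →₀ A) : L x = L' x := by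
  have : L = L' := Finsupp.lhom_ext' fun i => LinearMap.ext_ring (h i)
  rw [this]

namespace Diagram

theorem mul_idemElt_of_mem_piece {D : Diagram k V ι} {n : ℤ} {x : ι →₀ BoundAlgebra k R}
    (hx : x ∈ D.piece R n) (i : ι) : x i * idemElt k R (D.label i) = x i := by
  obtain ⟨c, hc⟩ := Submodule.mem_span_singleton.mp (hx i).1
  rw [← hc, smul_eq_mul, mul_assoc, idemElt_mul_self]

/-- Coefficients in a piece absorb the idempotent of their position. A map on the free module
therefore acts on pieces as if precomposed with the idempotents, and may be defined without them. -/
theorem linearMap_apply_eq {D : Diagram k V ι} {n : ℤ} {x : ι →₀ BoundAlgebra k R}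
    (hx : x ∈ D.piece R n) {M : Type u} [AddCommGroup M] [Module (BoundAlgebra k R) M]
    (L : (ι →₀ BoundAlgebra k R) →ₗ[BoundAlgebra k R] M) :
    L x = x.sum fun i c => c • idemElt k R (D.label i) • L (Finsupp.single i 1) := by
  conv_lhs => rw [← Finsupp.sum_single x, map_finsuppSum]
  refine Finsupp.sum_congr fun i _ => ?_
  rw [smul_smul, mul_idemElt_of_mem_piece hx, ← map_smul, Finsupp.smul_single, smul_eq_mul, mul_one]

/-- Homogeneity is checked on basis vectors times idempotents. Positions beyond the ends of a word
drop out because their idempotent is 0. -/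
theorem map_mem_of_single {D : Diagram k V ι} {n : ℤ} {x : ι →₀ BoundAlgebra k R}
    (hx : x ∈ D.piece R n) {M : Type u} [AddCommGroup M] [Module (BoundAlgebra k R) M]
    (L : (ι →₀ BoundAlgebra k R) →ₗ[BoundAlgebra k R] M) (N : Submodule (BoundAlgebra k R) M)
    (h : ∀ i, D.label i ≠ none → D.deg i = n →
      idemElt k R (D.label i) • L (Finsupp.single i 1) ∈ N) : L x ∈ N := by
  rw [linearMap_apply_eq hx]
  refine Submodule.sum_mem _ fun i hi => Submodule.smul_mem _ _ ?_
  by_cases hl : D.label i = none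
  · simp [hl, idemElt]
  · exact h i hl ((hx i).2 (Finsupp.mem_support_iff.mp hi))

theorem idemElt_smul_single_mem {D : Diagram k V ι} {n : ℤ} {i : ι} (c : k) {x : Option V}
    (hx : D.label i = x) (hn : D.deg i = n) :
    idemElt k R x • Finsupp.single i (c • (1 : BoundAlgebra k R)) ∈ D.piece R n := by
  subst hx
  rw [Finsupp.smul_single]
  exact single_mem_piece (by simp [idemElt_mul_self]) fun _ => hn

/-- Rescaling of the positions. -/
noncomputable def rescale (v : ι → kˣ) :
    (ι →₀ BoundAlgebra k R) →ₗ[BoundAlgebra k R] (ι →₀ BoundAlgebra k R) :=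
  Finsupp.linearCombination _ fun i => Finsupp.single i ((v i : k) • 1)

theorem rescale_single (v : ι → kˣ) (i : ι) (a : BoundAlgebra k R) :
    rescale v (Finsupp.single i a) = Finsupp.single i ((v i : k) • a) := by
  simp [rescale]

theorem rescale_rescale (v w : ι → kˣ) (h : ∀ i, (w i : k) * v i = 1)
    (x : ι →₀ BoundAlgebra k R) : rescale w (rescale v x) = x := by
  refine eq_of_single (L := rescale w ∘ₗ rescale v) (L' := LinearMap.id) (fun i => ?_) x
  simp [rescale_single, smul_smul, h]

theorem rescale_mem (v : ι → kˣ) {n : ℤ} {x : ι →₀ BoundAlgebra k R} {D D' : Diagram k V ι}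
    (hl : D'.label = D.label) (hd : D'.deg = D.deg)
    (hx : x ∈ D.piece R n) : rescale v x ∈ D'.piece R n := by
  refine map_mem_of_single hx _ _ fun i _ hi => ?_
  rw [rescale_single]
  exact idemElt_smul_single_mem _ (congrFun hl i) ((congrFun hd i).trans hi)

variable [AddGroupWithOne ι] {D : Diagram k V ι}

theorem differential_single (i : ι) :
    D.differential R (Finsupp.single i 1) = D.row R i := by
  simp [differential]

theorem Valid.idemElt_mul_forward (hD : D.Valid R) (i : ι) :
    idemElt k R (D.label i) * forward k R (D.letter i) = forward k R (D.letter i) := by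
  rcases h : D.letter i with _ | l
  · simp [forward]
  · rw [hD.leftEnd i l h, GentleCone.idemElt_mul_forward k (hD.isPath i l h).1]

theorem Valid.idemElt_mul_backward (hD : D.Valid R) (i : ι) :
    idemElt k R (D.label (i + 1)) * backward k R (D.letter i) = backward k R (D.letter i) := by
  rcases h : D.letter i with _ | l
  · simp [backward]
  · rw [hD.rightEnd i l h, GentleCone.idemElt_mul_backward k (hD.isPath i l h).1]

/-- The letters at position `i` all begin at its vertex when read as maps out of `i`. Hence the
differential on the free module factors through the idempotents. -/
theorem Valid.idemElt_smul_row (hD : D.Valid R) (i : ι) :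
    idemElt k R (D.label i) • D.row R i = D.row R i := by
  have := hD.idemElt_mul_backward (i - 1)
  rw [sub_add_cancel] at this
  simp only [row, smul_add, Finsupp.smul_single, smul_eq_mul, mul_smul_comm,
    hD.idemElt_mul_forward, this]

/-- The graded module with differential of an unfolded diagram. -/
noncomputable def graded (hD : D.Valid R) :
    GradedDifferential (BoundAlgebra k R) (ι →₀ BoundAlgebra k R) where
  d := D.differential R
  piece := D.piece R
  mem _ _ hx := differential_mem hD hx
  sq := differential_differential hD

/-- Partial products in both directions from 0. A line imposes no closing condition; on a cycle the
total product would be an obstruction, which is why the scalar μ survives in a band complex but not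
in that of c. -/
theorem exists_units_ratio {G : Type u} [CommGroup G] (t : ℤ → G) :
    ∃ v : ℤ → G, ∀ i, v (i + 1) = v i * t i := by
  let v : ℤ → G
    | Int.ofNat m => ∏ j ∈ Finset.range m, t j
    | Int.negSucc m => (∏ j ∈ Finset.range (m + 1), t (-(j : ℤ) - 1))⁻¹
  refine ⟨v, ?_⟩
  rintro (m | (_ | m))
  · exact Finset.prod_range_succ _ _
  · change (∏ j ∈ Finset.range 0, t j) = (∏ j ∈ Finset.range (0 + 1), t (-(j : ℤ) - 1))⁻¹ * t (-1)
    simp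
  · change (∏ j ∈ Finset.range (m + 1), t (-(j : ℤ) - 1))⁻¹ =
      (∏ j ∈ Finset.range (m + 1 + 1), t (-(j : ℤ) - 1))⁻¹ * t (Int.negSucc (m + 1))
    rw [Finset.prod_range_succ _ (m + 1),
      show -((m + 1 : ℕ) : ℤ) - 1 = Int.negSucc (m + 1) by omega]
    simp

/-- Nonzero scalars on a diagram over the integers do not change the complex. -/
theorem nonempty_iso_of_scalar {D D' : Diagram k V ℤ} (hD : D.Valid R) (hD' : D'.Valid R)
    (hl : D'.letter = D.letter) (hlab : D'.label = D.label) (hdeg : D'.deg = D.deg)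
    (s s' : ℤ → kˣ) (hs : ∀ i, D.scalar i = s i) (hs' : ∀ i, D'.scalar i = s' i) :
    Nonempty (D.complex hD ≅ D'.complex hD') := by
  -- A direct letter maps `i` to `i + 1` and an inverse letter maps `i + 1` to `i`, so the required
  -- ratio is inverted for the latter.
  obtain ⟨v, hv⟩ := exists_units_ratio fun i : ℤ =>
    if (D.letter i).elim false Letter.direct then s' i / s i else s i / s' i
  have key : ∀ x, rescale v (D.differential R x) = D'.differential R (rescale v x) := by
    refine eq_of_single (L := rescale v ∘ₗ D.differential R)
      (L' := D'.differential R ∘ₗ rescale v) fun i => ?_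
    have h1 : ((v (i + 1) : k) * s i) • forward k R (D.letter i) =
        ((v i : k) * s' i) • forward k R (D.letter i) := by
      have := hv i
      rcases h : D.letter i with _ | ⟨_ | _, p⟩
      · simp [forward]
      · simp [forward]
      · rw [this, h]
        congr 1
        simp [mul_assoc]
    have h2 : ((v (i - 1) : k) * s (i - 1)) • backward k R (D.letter (i - 1)) =
        ((v i : k) * s' (i - 1)) • backward k R (D.letter (i - 1)) := by
      have := hv (i - 1)
      rw [sub_add_cancel] at this
      rcases h : D.letter (i - 1) with _ | ⟨_ | _, p⟩
      · simp [backward]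
      · rw [this, h]
        congr 1
        simp [mul_assoc]
      · simp [backward]
    simp only [LinearMap.comp_apply, differential_single, rescale_single]
    rw [← Finsupp.smul_single_one, smul_assoc, one_smul]
    rw [row, map_add, rescale_single, rescale_single, smul_smul, smul_smul, hs, hs, h1, h2]
    have : (v i : k) • Finsupp.single i (1 : BoundAlgebra k R) =
        Finsupp.single i ((v i : k) • (1 : BoundAlgebra k R)) := by simp
    rw [this, differential, Finsupp.linearCombination_single, row, hl, hs', hs']
    simp [smul_smul]
  let L := rescale (R := R) v
  let L' := rescale (R := R) fun i => (v i)⁻¹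
  have h1 : ∀ x, L' (L x) = x := rescale_rescale _ _ (by simp)
  have h2 : ∀ x, L (L' x) = x := rescale_rescale _ _ (by simp)
  refine ⟨(?_ : (graded hD).complex ≅ (graded hD').complex)⟩
  refine
    { hom := (graded hD).chainMap (graded hD') L (fun n x hx => rescale_mem v hlab hdeg hx) key
      inv := (graded hD').chainMap (graded hD) L'
        (fun n x hx => rescale_mem _ hlab.symm hdeg.symm hx) (fun x => ?_)
      hom_inv_id := ?_
      inv_hom_id := ?_ }
  · have := key (L' x)
    rw [show rescale v (L' x) = x from h2 x] at this
    change L' (D'.differential R x) = D.differential R (L' x)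
    rw [← this]
    exact h1 _
  · ext n x
    exact Subtype.ext (h1 x.1)
  · ext n x
    exact Subtype.ext (h2 x.1)

end Diagram
end DiagramMaps

/-! ### Comparison of vertices and degrees in σ, τ and c -/

section Labels

variable {V : Type u} [Quiver.{u} V] {R : Arrow V → Arrow V → Prop}

theorem Word.label_add_one (w : Word V) {i : ℤ} (hi : 0 ≤ i) :
    w.label (i + 1) = (w.letter i).bind Letter.rightEnd := by
  obtain ⟨m, rfl⟩ := Int.eq_ofNat_of_zero_le hi
  rfl

theorem Word.label_of_neg (w : Word V) {i : ℤ} (hi : i < 0) :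
    w.label i = (w.letter i).bind Letter.leftEnd := by
  obtain ⟨m, rfl⟩ : ∃ m : ℕ, i = Int.negSucc m := ⟨(-i - 1).toNat, by omega⟩
  rfl

theorem Word.diagram_letter (k : Type u) [Field k] (w : Word V) (d i : ℤ) :
    (w.diagram k d).letter i = w.letter i := rfl

namespace Overlap

variable {O : Overlap V} (k : Type u) [Field k] (μ : kˣ) (j : ZMod O.tau.length) (d : ℤ)

variable (O) in
/-- The degree of `σ` at its base vertex. -/
abbrev sigmaDeg (d : ℤ) : ℤ := d + signSum (O.δ ++ [O.τL])

theorem band_label_zero (hO : O.IsGraphOverlap) :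
    (bandDiagram k O.tau μ j d).label 0 = some O.y := by
  have := hO.base'
  rw [List.head?_eq_getElem?] at this
  simpa [bandDiagram] using this

theorem band_deg_zero : (bandDiagram k O.tau μ j d).deg 0 = d := by
  simp [bandDiagram, signSum]

variable (hO : O.IsGraphOverlap) (hσ : O.sigma.IsHomotopyString R) (hτ : IsHomotopyBand R O.tau)
  (hc : O.cone.IsHomotopyString R)

include hτ in
theorem band_step {z : ℤ} {l : Letter V} (hl : O.bandLetter z = some l) :
    (bandDiagram k O.tau μ j d).label (z : ZMod _) = l.leftEnd ∧
    (bandDiagram k O.tau μ j d).label ((z + 1 : ℤ) : ZMod _) = l.rightEnd ∧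
    (bandDiagram k O.tau μ j d).deg ((z + 1 : ℤ) : ZMod _) =
      (bandDiagram k O.tau μ j d).deg (z : ZMod _) + l.sign := by
  have hD := bandDiagram_valid k hτ μ j d
  have e : ((z + 1 : ℤ) : ZMod O.tau.length) = (z : ZMod O.tau.length) + 1 := by push_cast; rfl
  rw [e]
  exact ⟨hD.leftEnd _ l hl, hD.rightEnd _ l hl, hD.deg _ l hl⟩

include hO hσ hτ in
/-- The labels and degrees of `σ` and `τ` agree on the overlap. -/
theorem overlap_label_deg {i : ℕ} (hi : i ≤ O.ρ.length) :
    O.sigma.label i = (bandDiagram k O.tau μ j d).label ((O.δ.length + 1 + i : ℤ) : ZMod _) ∧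
    O.sigma.deg (O.sigmaDeg d) i =
      (bandDiagram k O.tau μ j d).deg ((O.δ.length + 1 + i : ℤ) : ZMod _) := by
  induction i with
  | zero =>
    obtain ⟨-, h2, -⟩ := band_step k μ j d hτ O.bandLetter_τL
    rw [Nat.cast_zero, add_zero, h2]
    refine ⟨hO.base.symm, ?_⟩
    have hv := O.val_natCast (m := O.δ.length + 1) (by rw [length_tau]; omega)
    push_cast at hv
    have : O.tau.take (O.δ.length + 1) = O.δ ++ [O.τL] := by
      simp [tau, List.take_append]
    simp [Word.deg, bandDiagram, hv, this]
  | succ i ih =>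
    obtain ⟨ih1, ih2⟩ := ih (by omega)
    have hl : O.sigma.letter i = some O.ρ[i] := by
      rw [sigma_letter_ρ O (by omega), List.getElem?_eq_getElem]
    have hl' : O.bandLetter (O.δ.length + 1 + i) = some O.ρ[i] := by
      rw [bandLetter_ρ O (by omega), List.getElem?_eq_getElem]
    obtain ⟨-, h2, h3⟩ := band_step k μ j d hτ hl'
    have hv := Word.diagram_valid k hσ (O.sigmaDeg d)
    have e : (O.δ.length + 1 + (i + 1 : ℕ) : ℤ) = O.δ.length + 1 + i + 1 := by push_cast; ring
    rw [e, h2, h3, ← ih2, Nat.cast_succ]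
    exact ⟨hv.rightEnd (i : ℤ) _ hl, hv.deg (i : ℤ) _ hl⟩

include hO hτ hc in
-- Induction away from the base vertex. Reading a letter backwards changes its sign and swaps its
-- ends, so the vertices of γ̄ keep their labels and degrees in the band complex.
theorem mid_label_deg_right {m : ℕ} (hm : m ≤ O.γ.length) :
    O.cone.label m = (bandDiagram k O.tau μ j d).label ((-m : ℤ) : ZMod _) ∧
    O.cone.deg d m = (bandDiagram k O.tau μ j d).deg ((-m : ℤ) : ZMod _) := by
  induction m with
  | zero =>
    rw [Nat.cast_zero, neg_zero, Int.cast_zero, band_label_zero k μ j d hO, band_deg_zero]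
    refine ⟨rfl, ?_⟩
    change d + 0 = d
    simp
  | succ m ih =>
    obtain ⟨-, ih2⟩ := ih (by omega)
    obtain ⟨l, hl⟩ := O.exists_bandLetter (-m - 1)
    have hl' : O.cone.letter m = some l.inv := by
      rw [cone_letter_mid O (by omega) (by omega), hl]; rfl
    obtain ⟨h1, h2, h3⟩ := band_step k μ j d hτ hl
    have hv := Word.diagram_valid k hc d
    have e : (-(m + 1 : ℕ) : ℤ) = -m - 1 := by push_cast; ring
    rw [sub_add_cancel, ← ih2] at h3
    have h4 := hv.rightEnd (m : ℤ) _ hl'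
    have h5 := hv.deg (m : ℤ) _ hl'
    rw [Letter.rightEnd_inv] at h4
    rw [Letter.sign_inv] at h5
    rw [e, h1]
    refine ⟨h4, ?_⟩
    change O.cone.deg d (m + 1) = O.cone.deg d m + -l.sign at h5
    push_cast
    push_cast at h3
    omega

include hO hτ hc in
theorem mid_label_deg_left {m : ℕ} (hm : m ≤ O.δ.length) :
    O.cone.label (-m) = (bandDiagram k O.tau μ j d).label ((m : ℤ) : ZMod _) ∧
    O.cone.deg d (-m) = (bandDiagram k O.tau μ j d).deg ((m : ℤ) : ZMod _) := by
  induction m with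
  | zero => simpa using mid_label_deg_right k μ j d hO hτ hc (m := 0) (by omega)
  | succ m ih =>
    obtain ⟨-, ih2⟩ := ih (by omega)
    obtain ⟨l, hl⟩ := O.exists_bandLetter m
    have hl' : O.cone.letter (-m - 1) = some l.inv := by
      rw [cone_letter_mid O (by omega) (by omega), show -(-(m : ℤ) - 1) - 1 = m by ring, hl]; rfl
    obtain ⟨h1, h2, h3⟩ := band_step k μ j d hτ hl
    have hv := Word.diagram_valid k hc d
    have e : (-(m + 1 : ℕ) : ℤ) = -m - 1 := by push_cast; ring
    have h4 := hv.leftEnd (-m - 1 : ℤ) _ hl'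
    have h5 := hv.deg (-m - 1 : ℤ) _ hl'
    rw [Letter.leftEnd_inv] at h4
    rw [Letter.sign_inv, sub_add_cancel] at h5
    rw [e, Nat.cast_succ, h2, h3, ← ih2]
    refine ⟨h4, ?_⟩
    change O.cone.deg d (-m) = O.cone.deg d (-m - 1) + -l.sign at h5
    omega

include hO hτ hc in
theorem mid_label_deg {i : ℤ} (h : -O.δ.length ≤ i) (h' : i ≤ O.γ.length) :
    O.cone.label i = (bandDiagram k O.tau μ j d).label ((-i : ℤ) : ZMod _) ∧
    O.cone.deg d i = (bandDiagram k O.tau μ j d).deg ((-i : ℤ) : ZMod _) := by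
  rcases le_or_gt 0 i with hi | hi
  · obtain ⟨m, rfl⟩ := Int.eq_ofNat_of_zero_le hi
    exact mid_label_deg_right k μ j d hO hτ hc (by omega)
  · obtain ⟨m, rfl⟩ : ∃ m : ℕ, i = -(m : ℤ) := ⟨(-i).toNat, by omega⟩
    rw [neg_neg]
    exact mid_label_deg_left k μ j d hO hτ hc (by omega)

include hO hσ hτ in
theorem right_label {i : ℤ} (h : O.γ.length + 1 ≤ i) :
    O.cone.label i = O.sigma.label (i - O.γ.length + O.ρ.length) := by
  obtain ⟨i, rfl⟩ : ∃ i', i = i' + 1 := ⟨i - 1, by ring⟩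
  rw [show i + 1 - O.γ.length + O.ρ.length = (i - O.γ.length + O.ρ.length) + 1 by ring,
    Word.label_add_one _ (by omega), Word.label_add_one _ (by omega)]
  rcases eq_or_ne i O.γ.length with rfl | hi
  · rw [sub_self, zero_add, cone_letter_cR, sigma_letter_σR]
    rcases hcR : O.cR with _ | c
    · rw [hO.cR_eq_none.mp hcR]
    · rcases hσR : O.σR with _ | s
      · rw [hO.cR_eq_none.mpr hσR] at hcR
        cases hcR
      · exact hO.right.rightEnd_eq (IsGraphOverlap.isPath_σR hσ) (IsGraphOverlap.isPath_τR hτ)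
          hσR hcR
  · rw [hO.cone_letter_right (by omega)]

include hO hσ hτ in
theorem left_label {i : ℤ} (h : i ≤ -O.δ.length - 1) :
    O.cone.label i = O.sigma.label (i + O.δ.length) := by
  rw [Word.label_of_neg _ (by omega), Word.label_of_neg _ (by omega)]
  rcases eq_or_ne i (-O.δ.length - 1) with rfl | hi
  · rw [show (-O.δ.length - 1 + O.δ.length : ℤ) = -1 by ring, cone_letter_cL, sigma_letter_σL]
    rcases hcL : O.cL with _ | c
    · rw [hO.cL_eq_none.mp hcL]
    · rcases hσL : O.σL with _ | s
      · rw [hO.cL_eq_none.mpr hσL] at hcL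
        cases hcL
      · have := hO.left.rightEnd_eq (l := s.inv) (m := c.inv) (IsGraphOverlap.isPath_σL hσ)
          (IsGraphOverlap.isPath_τL hτ) (by rw [hσL]; rfl) (by rw [hcL]; rfl)
        simpa using this
  · rw [hO.cone_letter_left (by omega)]

include k hO hσ hτ hc in
-- The +1 is the shift of σ in the mapping cone. It is established across c_R by
-- `EndCondition.sign_eq` and propagates along α, where c and σ have the same letters. Beyond the
-- end of c degrees carry no meaning, hence the condition on the label.
theorem right_deg {i : ℤ} (h : O.γ.length + 1 ≤ i) (hl : O.cone.label i ≠ none) :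
    O.sigma.deg (O.sigmaDeg d) (i - O.γ.length + O.ρ.length) = O.cone.deg d i + 1 := by
  have hv := Word.diagram_valid k hσ (O.sigmaDeg d)
  have hv' := Word.diagram_valid k hc d
  induction i, h using Int.leInduction with
  | base =>
    rw [Word.label_add_one _ (by omega), cone_letter_cR] at hl
    rcases hcR : O.cR with _ | c
    · simp [hcR] at hl
    rcases hσR : O.σR with _ | s
    · rw [hO.cR_eq_none.mpr hσR] at hcR
      cases hcR
    have h1 := hv.deg O.ρ.length s ((sigma_letter_σR O).trans hσR)
    have h2 := hv'.deg O.γ.length c ((cone_letter_cR O).trans hcR)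
    have h3 := (overlap_label_deg k 1 0 d hO hσ hτ le_rfl).2
    have h4 := (mid_label_deg k 1 0 d hO hτ hc (i := O.γ.length) (by omega) le_rfl).2
    have h5 := (band_step k 1 0 d hτ O.bandLetter_τR).2.2
    have h6 := hO.right.sign_eq hσR hcR
    -- After a full turn, position −|γ| is the far end of τ_R.
    rw [← intCast_add_length,
      show (-O.γ.length + O.tau.length : ℤ) = O.δ.length + 1 + O.ρ.length + 1 by
        rw [length_tau]; push_cast; ring] at h4
    change O.sigma.deg (O.sigmaDeg d) (O.ρ.length + 1) = O.sigma.deg (O.sigmaDeg d) O.ρ.length + _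
      at h1
    change O.cone.deg d (O.γ.length + 1) = O.cone.deg d O.γ.length + _ at h2
    rw [show (O.γ.length + 1 - O.γ.length + O.ρ.length : ℤ) = O.ρ.length + 1 by ring, h1, h2, h3,
      h4, h5, h6]
    ring
  | succ i hi ih =>
    rw [Word.label_add_one _ (by omega)] at hl
    rcases hl' : O.cone.letter i with _ | l
    · simp [hl'] at hl
    have h0 : O.cone.label i ≠ none := by
      have := hv'.leftEnd i l hl'
      change O.cone.label i = _ at this
      rw [this]
      exact Letter.leftEnd_ne_none (hc.isPath i l hl').1
    have h1 := hv'.deg i l hl'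
    rw [hO.cone_letter_right hi] at hl'
    have h2 := hv.deg (i - O.γ.length + O.ρ.length) l hl'
    have h3 := ih h0
    change O.cone.deg d (i + 1) = O.cone.deg d i + _ at h1
    change O.sigma.deg (O.sigmaDeg d) _ = O.sigma.deg (O.sigmaDeg d) _ + _ at h2
    rw [show i + 1 - O.γ.length + O.ρ.length = (i - O.γ.length + O.ρ.length) + 1 by ring, h2, h1,
      h3]
    ring

include k hO hσ hτ hc in
theorem left_deg {i : ℤ} (h : i ≤ -O.δ.length - 1) (hl : O.cone.label i ≠ none) :
    O.sigma.deg (O.sigmaDeg d) (i + O.δ.length) = O.cone.deg d i + 1 := by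
  have hv := Word.diagram_valid k hσ (O.sigmaDeg d)
  have hv' := Word.diagram_valid k hc d
  induction i, h using Int.leInductionDown with
  | base =>
    rw [Word.label_of_neg _ (by omega), cone_letter_cL] at hl
    rcases hcL : O.cL with _ | c
    · simp [hcL] at hl
    rcases hσL : O.σL with _ | s
    · rw [hO.cL_eq_none.mpr hσL] at hcL
      cases hcL
    have hs : O.sigma.letter (-1) = some s := (sigma_letter_σL O).trans hσL
    have h1 := hv.deg (-1 : ℤ) s ((Word.diagram_letter k _ _ _).trans hs)
    have h2 := hv'.deg (-O.δ.length - 1) c ((cone_letter_cL O).trans hcL)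
    have h3 := (overlap_label_deg k 1 0 d hO hσ hτ (i := 0) (by omega)).2
    have h4 := (mid_label_deg k 1 0 d hO hτ hc (i := -O.δ.length) le_rfl (by omega)).2
    have h5 := (band_step k 1 0 d hτ O.bandLetter_τL).2.2
    have h6 := hO.left.sign_eq (l := s.inv) (m := c.inv) (by rw [hσL]; rfl) (by rw [hcL]; rfl)
    rw [neg_neg] at h4
    rw [Nat.cast_zero, add_zero] at h3
    simp only [Letter.sign_inv] at h6
    change O.sigma.deg (O.sigmaDeg d) 0 = O.sigma.deg (O.sigmaDeg d) (-1) + _ at h1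
    rw [sub_add_cancel] at h2
    change O.cone.deg d (-O.δ.length) = O.cone.deg d (-O.δ.length - 1) + _ at h2
    rw [show (-O.δ.length - 1 + O.δ.length : ℤ) = -1 by ring]
    omega
  | pred i hi ih =>
    rw [Word.label_of_neg _ (by omega)] at hl
    rcases hl' : O.cone.letter (i - 1) with _ | l
    · simp [hl'] at hl
    have h0 : O.cone.label i ≠ none := by
      have := hv'.rightEnd (i - 1) l hl'
      rw [sub_add_cancel] at this
      change O.cone.label i = _ at this
      rw [this]
      exact Letter.rightEnd_ne_none (hc.isPath _ l hl').1
    have h1 := hv'.deg (i - 1) l hl'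
    rw [hO.cone_letter_left (by omega)] at hl'
    have h2 := hv.deg (i - 1 + O.δ.length) l hl'
    have h3 := ih h0
    rw [sub_add_cancel] at h1
    rw [show i - 1 + O.δ.length + 1 = i + O.δ.length by ring] at h2
    change O.cone.deg d i = O.cone.deg d (i - 1) + _ at h1
    change O.sigma.deg (O.sigmaDeg d) (i + O.δ.length) =
      O.sigma.deg (O.sigmaDeg d) (i - 1 + O.δ.length) + _ at h2
    omega

end Overlap
end Labels

/-! ### The maps used in the Gaussian elimination -/

section ConeMaps

variable (k : Type u) [Field k] {V : Type u} [Fintype V] [Quiver.{u} V]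
  (R : Arrow V → Arrow V → Prop)

namespace Overlap

variable (O : Overlap V)

/-- The free module on the positions of `σ` and `τ`. -/
abbrev Total : Type u := (ℤ →₀ BoundAlgebra k R) × (ZMod O.tau.length →₀ BoundAlgebra k R)

/-- The basis vector at the position `m` of `σ`. -/
noncomputable def stringBasis (m : ℤ) : O.Total k R := (Finsupp.single m 1, 0)

/-- The basis vector at the position `z` of `τ`. -/
noncomputable def bandBasis (z : ℤ) : O.Total k R :=
  (0, Finsupp.single (z : ZMod O.tau.length) 1)

/-- The coefficients of the graph map, with `1` in place of the idempotents. -/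
noncomputable def coefficient (i : ℤ) : BoundAlgebra k R :=
  if 0 ≤ i ∧ i ≤ O.ρ.length then 1
  else if i = O.ρ.length + 1 then O.fR.elim 0 (pathElt k R)
  else if i = -1 then O.fL.elim 0 (pathElt k R)
  else 0

/-- The graph map, with `1` in place of the idempotents. -/
noncomputable def graphMap (u : ℤ → kˣ) :
    (ℤ →₀ BoundAlgebra k R) →ₗ[BoundAlgebra k R] (ZMod O.tau.length →₀ BoundAlgebra k R) :=
  Finsupp.linearCombination _ fun i =>
    Finsupp.single ((O.δ.length + 1 + i : ℤ) : ZMod O.tau.length)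
      ((u i : k) • O.coefficient k R i)

/-- The inclusion of the positions of the cone into those of `σ` and `τ`. -/
noncomputable def coneIncl : (ℤ →₀ BoundAlgebra k R) →ₗ[BoundAlgebra k R] O.Total k R :=
  Finsupp.linearCombination _ fun i =>
    if i ≤ -O.δ.length - 1 then O.stringBasis k R (i + O.δ.length)
    else if i ≤ O.γ.length then O.bandBasis k R (-i)
    else O.stringBasis k R (i - O.γ.length + O.ρ.length)

/-- The projection onto the positions of the cone. -/
noncomputable def coneProj : O.Total k R →ₗ[BoundAlgebra k R] (ℤ →₀ BoundAlgebra k R) :=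
  (Finsupp.linearCombination _ fun m : ℤ =>
    if O.ρ.length < m then Finsupp.single (m - O.ρ.length + O.γ.length) 1
    else if m < 0 then Finsupp.single (m - O.δ.length) 1 else 0).coprod
  (Finsupp.linearCombination _ fun t : ZMod O.tau.length =>
    -- Position `i` of c is the residue `-i`. A representative up to |δ| gives `i = -t.val`; one
    -- beyond the overlap gives the length of τ minus `t.val`.
    if (t.val : ℤ) ≤ O.δ.length then Finsupp.single (-t.val : ℤ) 1
    else if (O.δ.length + 1 + O.ρ.length : ℤ) < t.val then
      Finsupp.single (O.tau.length - t.val : ℤ) 1 else 0)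

/-- The inverse of the graph map on the overlap. -/
noncomputable def coneHomotopy (u : ℤ → kˣ) : O.Total k R →ₗ[BoundAlgebra k R] O.Total k R :=
  LinearMap.inl _ _ _ ∘ₗ (Finsupp.linearCombination _ fun t : ZMod O.tau.length =>
    if (O.δ.length : ℤ) < t.val ∧ (t.val : ℤ) ≤ O.δ.length + 1 + O.ρ.length then
      Finsupp.single (t.val - O.δ.length - 1 : ℤ)
        ((((u (t.val - O.δ.length - 1 : ℤ))⁻¹ : kˣ) : k) • 1) else 0) ∘ₗ LinearMap.snd _ _ _

/-- The projection onto the overlap in `σ`. -/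
noncomputable def stringOverlapProj : O.Total k R →ₗ[BoundAlgebra k R] O.Total k R :=
  LinearMap.inl _ _ _ ∘ₗ (Finsupp.linearCombination _ fun m : ℤ =>
    if 0 ≤ m ∧ m ≤ O.ρ.length then Finsupp.single m 1 else 0) ∘ₗ LinearMap.fst _ _ _

/-- The projection onto the overlap in `τ`. -/
noncomputable def bandOverlapProj : O.Total k R →ₗ[BoundAlgebra k R] O.Total k R :=
  LinearMap.inr _ _ _ ∘ₗ (Finsupp.linearCombination _ fun t : ZMod O.tau.length =>
    if (O.δ.length : ℤ) < t.val ∧ (t.val : ℤ) ≤ O.δ.length + 1 + O.ρ.length then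
      Finsupp.single t 1 else 0) ∘ₗ LinearMap.snd _ _ _

variable {O}

omit [Fintype V] in
theorem val_outer {i : ℤ} (h : -O.δ.length ≤ i) (h' : i ≤ O.γ.length) :
    (((-i : ℤ) : ZMod O.tau.length).val : ℤ) = if i ≤ 0 then -i else O.tau.length - i := by
  have := O.length_tau
  split_ifs with hi
  · exact O.val_intCast (by omega) (by omega)
  · rw [← intCast_add_length, O.val_intCast (by omega) (by omega)]
    ring

omit [Fintype V] in
theorem val_overlap {i : ℤ} (h : 0 ≤ i) (h' : i ≤ O.ρ.length) :
    (((O.δ.length + 1 + i : ℤ) : ZMod O.tau.length).val : ℤ) = O.δ.length + 1 + i := by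
  have := O.length_tau
  exact O.val_intCast (by omega) (by omega)

omit [Fintype V] in
-- The cycle of positions of τ splits into the overlap, which is eliminated, and the arc that
-- survives in c.
theorem outer_or_overlap (t : ZMod O.tau.length) :
    (∃ i : ℤ, -O.δ.length ≤ i ∧ i ≤ O.γ.length ∧ t = ((-i : ℤ) : ZMod _)) ∨
    ∃ i : ℤ, 0 ≤ i ∧ i ≤ O.ρ.length ∧ t = ((O.δ.length + 1 + i : ℤ) : ZMod _) := by
  have hn := O.length_tau
  have ht := ZMod.val_lt t
  have e : t = ((t.val : ℤ) : ZMod _) := by simp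
  rcases le_or_gt (t.val : ℤ) O.δ.length with h | h
  · exact Or.inl ⟨-t.val, by omega, by omega, by rw [neg_neg]; exact e⟩
  rcases le_or_gt (t.val : ℤ) (O.δ.length + 1 + O.ρ.length) with h' | h'
  · exact Or.inr ⟨t.val - O.δ.length - 1, by omega, by omega, by
      rw [show (O.δ.length + 1 + (t.val - O.δ.length - 1) : ℤ) = t.val by ring]; exact e⟩
  · refine Or.inl ⟨O.tau.length - t.val, by omega, by omega, ?_⟩
    rw [← intCast_add_length, show (-(O.tau.length - t.val) + O.tau.length : ℤ) = t.val by ring]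
    exact e

omit [Fintype V] in
-- The vertex just after the overlap is the right end of the surviving arc, so the component f_R
-- ends where δ̄γ̄ ends.
theorem cast_succ_overlap :
    ((O.δ.length + 1 + (O.ρ.length + 1) : ℤ) : ZMod O.tau.length) =
      ((-O.γ.length : ℤ) : ZMod O.tau.length) := by
  rw [← intCast_add_length _ (-O.γ.length : ℤ), length_tau]
  congr 1
  push_cast
  ring

variable {k R}

/-- Every identity between maps on the cone is verified on three kinds of basis vectors: positions
of σ, the arc of τ, and the overlap in τ. -/
theorem total_ext {M : Type u} [AddCommGroup M] [Module (BoundAlgebra k R) M]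
    {L L' : O.Total k R →ₗ[BoundAlgebra k R] M}
    (hs : ∀ m, L (O.stringBasis k R m) = L' (O.stringBasis k R m))
    (ho : ∀ i : ℤ, -O.δ.length ≤ i → i ≤ O.γ.length →
      L (O.bandBasis k R (-i)) = L' (O.bandBasis k R (-i)))
    (hi : ∀ i : ℤ, 0 ≤ i → i ≤ O.ρ.length →
      L (O.bandBasis k R (O.δ.length + 1 + i)) = L' (O.bandBasis k R (O.δ.length + 1 + i)))
    (x : O.Total k R) : L x = L' x := by
  have h1 := eq_of_single (L := L ∘ₗ LinearMap.inl (BoundAlgebra k R) _ _)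
    (L' := L' ∘ₗ LinearMap.inl (BoundAlgebra k R) _ _) hs x.1
  have h2 := eq_of_single (L := L ∘ₗ LinearMap.inr (BoundAlgebra k R) _ _)
    (L' := L' ∘ₗ LinearMap.inr (BoundAlgebra k R) _ _)
    (fun t => by
      rcases O.outer_or_overlap t with ⟨i, h, h', rfl⟩ | ⟨i, h, h', rfl⟩
      · exact ho i h h'
      · exact hi i h h') x.2
  have e : x = LinearMap.inl (BoundAlgebra k R) _ _ x.1 + LinearMap.inr (BoundAlgebra k R) _ _ x.2 := by simp
  rw [e, map_add, map_add]
  exact congrArg₂ _ h1 h2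

variable (u : ℤ → kˣ)

theorem coneIncl_left {i : ℤ} (h : i ≤ -O.δ.length - 1) :
    O.coneIncl k R (Finsupp.single i 1) = O.stringBasis k R (i + O.δ.length) := by
  rw [coneIncl, Finsupp.linearCombination_single, if_pos h, one_smul]

theorem coneIncl_mid {i : ℤ} (h : -O.δ.length ≤ i) (h' : i ≤ O.γ.length) :
    O.coneIncl k R (Finsupp.single i 1) = O.bandBasis k R (-i) := by
  rw [coneIncl, Finsupp.linearCombination_single, if_neg (by omega), if_pos h', one_smul]

theorem coneIncl_right {i : ℤ} (h : O.γ.length + 1 ≤ i) :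
    O.coneIncl k R (Finsupp.single i 1) =
      O.stringBasis k R (i - O.γ.length + O.ρ.length) := by
  rw [coneIncl, Finsupp.linearCombination_single, if_neg (by omega), if_neg (by omega), one_smul]

theorem coneProj_stringBasis (m : ℤ) : O.coneProj k R (O.stringBasis k R m) =
    if O.ρ.length < m then Finsupp.single (m - O.ρ.length + O.γ.length) 1
    else if m < 0 then Finsupp.single (m - O.δ.length) 1 else 0 := by
  simp [coneProj, stringBasis]

theorem coneProj_outer {i : ℤ} (h : -O.δ.length ≤ i) (h' : i ≤ O.γ.length) :
    O.coneProj k R (O.bandBasis k R (-i)) = Finsupp.single i 1 := by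
  have hn := O.length_tau
  have hv := val_outer h h'
  rw [coneProj, bandBasis, LinearMap.coprod_apply, map_zero, zero_add,
    Finsupp.linearCombination_single, one_smul]
  split_ifs at hv with hi
  · rw [if_pos (by omega), hv, neg_neg]
  · rw [if_neg (by omega), if_pos (by omega), hv]
    congr 1
    ring

theorem coneProj_overlap {i : ℤ} (h : 0 ≤ i) (h' : i ≤ O.ρ.length) :
    O.coneProj k R (O.bandBasis k R (O.δ.length + 1 + i)) = 0 := by
  have hv := val_overlap h h'
  rw [coneProj, bandBasis, LinearMap.coprod_apply, map_zero, zero_add,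
    Finsupp.linearCombination_single, one_smul, if_neg (by omega), if_neg (by omega)]

theorem coneHomotopy_stringBasis (m : ℤ) :
    O.coneHomotopy k R u (O.stringBasis k R m) = 0 := by
  simp [coneHomotopy, stringBasis]

theorem coneHomotopy_outer {i : ℤ} (h : -O.δ.length ≤ i) (h' : i ≤ O.γ.length) :
    O.coneHomotopy k R u (O.bandBasis k R (-i)) = 0 := by
  have hn := O.length_tau
  have hv := val_outer h h'
  rw [coneHomotopy, bandBasis, LinearMap.comp_apply, LinearMap.comp_apply, LinearMap.snd_apply,
    Finsupp.linearCombination_single, if_neg (by split_ifs at hv <;> omega), smul_zero, map_zero]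

theorem coneHomotopy_overlap {i : ℤ} (h : 0 ≤ i) (h' : i ≤ O.ρ.length) :
    O.coneHomotopy k R u (O.bandBasis k R (O.δ.length + 1 + i)) =
      (((u i)⁻¹ : kˣ) : k) • O.stringBasis k R i := by
  have hv := val_overlap h h'
  rw [coneHomotopy, bandBasis, LinearMap.comp_apply, LinearMap.comp_apply, LinearMap.snd_apply,
    Finsupp.linearCombination_single, if_pos (by omega), one_smul, hv,
    show (O.δ.length + 1 + i - O.δ.length - 1 : ℤ) = i by ring]
  ext <;> simp [stringBasis]

theorem stringOverlapProj_stringBasis (m : ℤ) :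
    O.stringOverlapProj k R (O.stringBasis k R m) =
      if 0 ≤ m ∧ m ≤ O.ρ.length then O.stringBasis k R m else 0 := by
  rw [stringOverlapProj, stringBasis, LinearMap.comp_apply, LinearMap.comp_apply,
    LinearMap.fst_apply, Finsupp.linearCombination_single, one_smul]
  split_ifs <;> rfl

theorem stringOverlapProj_bandBasis (z : ℤ) :
    O.stringOverlapProj k R (O.bandBasis k R z) = 0 := by
  simp [stringOverlapProj, bandBasis]

theorem bandOverlapProj_stringBasis (m : ℤ) :
    O.bandOverlapProj k R (O.stringBasis k R m) = 0 := by
  simp [bandOverlapProj, stringBasis]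

theorem bandOverlapProj_outer {i : ℤ} (h : -O.δ.length ≤ i) (h' : i ≤ O.γ.length) :
    O.bandOverlapProj k R (O.bandBasis k R (-i)) = 0 := by
  have hn := O.length_tau
  have hv := val_outer h h'
  rw [bandOverlapProj, bandBasis, LinearMap.comp_apply, LinearMap.comp_apply, LinearMap.snd_apply,
    Finsupp.linearCombination_single, if_neg (by split_ifs at hv <;> omega), smul_zero, map_zero]

theorem bandOverlapProj_overlap {i : ℤ} (h : 0 ≤ i) (h' : i ≤ O.ρ.length) :
    O.bandOverlapProj k R (O.bandBasis k R (O.δ.length + 1 + i)) =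
      O.bandBasis k R (O.δ.length + 1 + i) := by
  have hv := val_overlap h h'
  rw [bandOverlapProj, bandBasis, LinearMap.comp_apply, LinearMap.comp_apply, LinearMap.snd_apply,
    Finsupp.linearCombination_single, if_pos (by omega), one_smul]
  rfl

theorem coneProj_coneIncl (x : ℤ →₀ BoundAlgebra k R) : O.coneProj k R (O.coneIncl k R x) = x := by
  refine eq_of_single (L := O.coneProj k R ∘ₗ O.coneIncl k R) (L' := LinearMap.id) (fun i => ?_) x
  rw [LinearMap.comp_apply, LinearMap.id_apply]
  rcases le_or_gt i (-O.δ.length - 1) with h | h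
  · rw [coneIncl_left h, coneProj_stringBasis, if_neg (by omega), if_pos (by omega),
      add_sub_cancel_right]
  rcases le_or_gt i O.γ.length with h' | h'
  · rw [coneIncl_mid (by omega) h', coneProj_outer (by omega) h']
  · rw [coneIncl_right (by omega), coneProj_stringBasis, if_pos (by omega)]
    congr 1
    ring

theorem coneHomotopy_coneIncl (x : ℤ →₀ BoundAlgebra k R) :
    O.coneHomotopy k R u (O.coneIncl k R x) = 0 := by
  refine eq_of_single (L := O.coneHomotopy k R u ∘ₗ O.coneIncl k R) (L' := 0) (fun i => ?_) x
  rw [LinearMap.comp_apply, LinearMap.zero_apply]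
  rcases le_or_gt i (-O.δ.length - 1) with h | h
  · rw [coneIncl_left h, coneHomotopy_stringBasis]
  rcases le_or_gt i O.γ.length with h' | h'
  · rw [coneIncl_mid (by omega) h', coneHomotopy_outer u (by omega) h']
  · rw [coneIncl_right (by omega), coneHomotopy_stringBasis]

theorem smul_map_basis {M N : Type u} [AddCommGroup M] [Module (BoundAlgebra k R) M]
    [AddCommGroup N] [Module (BoundAlgebra k R) N] [Module k M] [Module k N]
    [IsScalarTower k (BoundAlgebra k R) M] [IsScalarTower k (BoundAlgebra k R) N]
    (L : M →ₗ[BoundAlgebra k R] N) (c : k) (x : M) : L (c • x) = c • L x := by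
  rw [← algebraMap_smul (BoundAlgebra k R) c x, map_smul, algebraMap_smul]

theorem coneProj_coneHomotopy (x : O.Total k R) :
    O.coneProj k R (O.coneHomotopy k R u x) = 0 := by
  refine total_ext (L := O.coneProj k R ∘ₗ O.coneHomotopy k R u) (L' := 0) ?_ ?_ ?_ x <;> intro i <;>
    simp only [LinearMap.comp_apply, LinearMap.zero_apply]
  · rw [coneHomotopy_stringBasis, map_zero]
  · intro h h'
    rw [coneHomotopy_outer u h h', map_zero]
  · intro h h'
    rw [coneHomotopy_overlap u h h', smul_map_basis, coneProj_stringBasis, if_neg (by omega),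
      if_neg (by omega), smul_zero]

theorem coneHomotopy_coneHomotopy (x : O.Total k R) :
    O.coneHomotopy k R u (O.coneHomotopy k R u x) = 0 := by
  refine total_ext (L := O.coneHomotopy k R u ∘ₗ O.coneHomotopy k R u) (L' := 0) ?_ ?_ ?_ x <;>
    intro i <;> simp only [LinearMap.comp_apply, LinearMap.zero_apply]
  · rw [coneHomotopy_stringBasis, map_zero]
  · intro h h'
    rw [coneHomotopy_outer u h h', map_zero]
  · intro h h'
    rw [coneHomotopy_overlap u h h', smul_map_basis, coneHomotopy_stringBasis, smul_zero]

theorem bandOverlapProj_coneHomotopy (x : O.Total k R) :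
    O.bandOverlapProj k R (O.coneHomotopy k R u x) = 0 := by
  refine total_ext (L := O.bandOverlapProj k R ∘ₗ O.coneHomotopy k R u) (L' := 0) ?_ ?_ ?_ x <;>
    intro i <;> simp only [LinearMap.comp_apply, LinearMap.zero_apply]
  · rw [coneHomotopy_stringBasis, map_zero]
  · intro h h'
    rw [coneHomotopy_outer u h h', map_zero]
  · intro h h'
    rw [coneHomotopy_overlap u h h', smul_map_basis, bandOverlapProj_stringBasis, smul_zero]

theorem coneHomotopy_stringOverlapProj (x : O.Total k R) :
    O.coneHomotopy k R u (O.stringOverlapProj k R x) = 0 := by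
  refine total_ext (L := O.coneHomotopy k R u ∘ₗ O.stringOverlapProj k R) (L' := 0) ?_ ?_ ?_ x <;>
    intro i <;> simp only [LinearMap.comp_apply, LinearMap.zero_apply]
  · rw [stringOverlapProj_stringBasis]
    split_ifs
    · rw [coneHomotopy_stringBasis]
    · rw [map_zero]
  · intro h h'
    rw [stringOverlapProj_bandBasis, map_zero]
  · intro h h'
    rw [stringOverlapProj_bandBasis, map_zero]

/-- The positions of the mapping cone are those of c together with the two copies of the overlap
that cancel each other. -/
theorem decomp (x : O.Total k R) :
    O.coneIncl k R (O.coneProj k R x) + O.stringOverlapProj k R x + O.bandOverlapProj k R x = x := by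
  refine total_ext (L := O.coneIncl k R ∘ₗ O.coneProj k R + O.stringOverlapProj k R +
    O.bandOverlapProj k R) (L' := LinearMap.id) ?_ ?_ ?_ x <;>
    intro i <;> simp only [LinearMap.add_apply, LinearMap.comp_apply, LinearMap.id_apply]
  · rw [bandOverlapProj_stringBasis, stringOverlapProj_stringBasis, coneProj_stringBasis, add_zero]
    rcases lt_or_ge (O.ρ.length : ℤ) i with h | h
    · rw [if_pos h, if_neg (by omega), coneIncl_right (by omega), add_zero]
      congr 1
      ring
    rcases lt_or_ge i 0 with h' | h'
    · rw [if_neg (by omega), if_pos h', if_neg (by omega), coneIncl_left (by omega), add_zero,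
        sub_add_cancel]
    · rw [if_neg (by omega), if_neg (by omega), if_pos ⟨h', h⟩, map_zero, zero_add]
  · intro h h'
    rw [coneProj_outer h h', coneIncl_mid h h', stringOverlapProj_bandBasis,
      bandOverlapProj_outer h h', add_zero, add_zero]
  · intro h h'
    rw [coneProj_overlap h h', stringOverlapProj_bandBasis, bandOverlapProj_overlap h h', map_zero,
      add_zero, zero_add]

end Overlap
end ConeMaps

/-! ### The differential of the mapping cone and its zigzags through the overlap -/

section ConeDifferential

variable {k : Type u} [Field k] {V : Type u} [Fintype V] [Quiver.{u} V]
  {R : Arrow V → Arrow V → Prop}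

theorem Diagram.row_eq {ι : Type} [AddGroupWithOne ι] (D : Diagram k V ι) (i : ι) :
    D.row R i = D.scalar i • forward k R (D.letter i) • Finsupp.single (i + 1) 1 +
      D.scalar (i - 1) • backward k R (D.letter (i - 1)) • Finsupp.single (i - 1) 1 := by
  simp [Diagram.row]

namespace Overlap

variable {O : Overlap V}

/-- The scalar of the band complex on the letter with number `z`. -/
noncomputable def bandScalar (μ : kˣ) (j : ZMod O.tau.length) (z : ℤ) : kˣ :=
  open Classical in if (z : ZMod O.tau.length) = j then μ else 1

omit [Fintype V] in
theorem bandScalar_add_length (μ : kˣ) (j : ZMod O.tau.length) (z : ℤ) :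
    bandScalar μ j (z + O.tau.length) = bandScalar μ j z := by
  rw [bandScalar, intCast_add_length, bandScalar]

variable (u : ℤ → kˣ) (μ : kˣ) (j : ZMod O.tau.length) (d : ℤ)

variable (R) in
/-- The differential of the mapping cone. -/
noncomputable def coneD : O.Total k R →ₗ[BoundAlgebra k R] O.Total k R :=
  LinearMap.prod (-((O.sigma.diagram k (O.sigmaDeg d)).differential R ∘ₗ LinearMap.fst _ _ _))
    (O.graphMap k R u ∘ₗ LinearMap.fst _ _ _ +
      (bandDiagram k O.tau μ j d).differential R ∘ₗ LinearMap.snd _ _ _)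

theorem coneD_stringBasis (m : ℤ) : coneD R u μ j d (O.stringBasis k R m) =
    -(forward k R (O.sigma.letter m) • O.stringBasis k R (m + 1) +
      backward k R (O.sigma.letter (m - 1)) • O.stringBasis k R (m - 1)) +
    (u m : k) • O.coefficient k R m • O.bandBasis k R (O.δ.length + 1 + m) := by
  have h := Diagram.differential_single (R := R) (D := O.sigma.diagram k (O.sigmaDeg d)) m
  rw [Diagram.row_eq] at h
  change (_, _) = _
  simp only [LinearMap.neg_apply, LinearMap.comp_apply, LinearMap.add_apply, LinearMap.fst_apply,
    LinearMap.snd_apply, stringBasis, bandBasis, h, map_zero, add_zero]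
  ext1
  · simp [Word.diagram]
  · simp [graphMap]

theorem coneD_bandBasis (z : ℤ) : coneD R u μ j d (O.bandBasis k R z) =
    (bandScalar μ j z : k) • forward k R (O.bandLetter z) • O.bandBasis k R (z + 1) +
    (bandScalar μ j (z - 1) : k) • backward k R (O.bandLetter (z - 1)) •
      O.bandBasis k R (z - 1) := by
  have h := Diagram.differential_single (R := R) (D := bandDiagram k O.tau μ j d)
    (z : ZMod O.tau.length)
  rw [Diagram.row_eq] at h
  have hs : ∀ z : ℤ, (bandDiagram k O.tau μ j d).scalar (z : ZMod O.tau.length) =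
      (bandScalar μ j z : k) := by
    intro z
    simp only [bandDiagram, bandScalar]
    split_ifs <;> simp
  have e1 : ((z + 1 : ℤ) : ZMod O.tau.length) = (z : ZMod O.tau.length) + 1 := by push_cast; rfl
  have e2 : ((z - 1 : ℤ) : ZMod O.tau.length) = (z : ZMod O.tau.length) - 1 := by push_cast; rfl
  rw [← e1, ← e2, hs, hs] at h
  change (_, _) = _
  simp only [LinearMap.neg_apply, LinearMap.comp_apply, LinearMap.add_apply, LinearMap.fst_apply,
    LinearMap.snd_apply, bandBasis, h, map_zero, neg_zero, zero_add]
  ext1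
  · simp
  · rfl

theorem coefficient_overlap {i : ℤ} (h : 0 ≤ i) (h' : i ≤ O.ρ.length) :
    O.coefficient k R i = 1 := if_pos ⟨h, h'⟩

theorem coefficient_of_lt {i : ℤ} (h : i < -1) : O.coefficient k R i = 0 := by
  rw [coefficient, if_neg (by omega), if_neg (by omega), if_neg (by omega)]

theorem coefficient_of_gt {i : ℤ} (h : O.ρ.length + 1 < i) : O.coefficient k R i = 0 := by
  rw [coefficient, if_neg (by omega), if_neg (by omega), if_neg (by omega)]

theorem coefficient_right (hO : O.IsGraphOverlap) :
    O.coefficient k R (O.ρ.length + 1) = backward k R O.cR := by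
  rw [coefficient, if_neg (by omega), if_pos rfl, hO.right.backward_eq k]

theorem coefficient_left (hO : O.IsGraphOverlap) :
    O.coefficient k R (-1) = forward k R O.cL := by
  rw [coefficient, if_neg (by omega), if_neg (by omega), if_pos rfl, ← backward_inv,
    hO.left.backward_eq k]

/-- The homotopy kills all of σ, so of the differential only the unit component of the graph map is
seen, and the homotopy inverts it. This is the source of `h d h = h`. -/
theorem coneHomotopy_coneD_stringBasis {i : ℤ} (h : 0 ≤ i) (h' : i ≤ O.ρ.length) :
    O.coneHomotopy k R u (coneD R u μ j d (O.stringBasis k R i)) = O.stringBasis k R i := by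
  rw [coneD_stringBasis, coefficient_overlap h h', one_smul, map_add, map_neg, map_add, map_smul,
    map_smul, coneHomotopy_stringBasis, coneHomotopy_stringBasis, smul_map_basis,
    coneHomotopy_overlap u h h', smul_smul]
  simp

theorem bandOverlapProj_coneD_stringBasis {i : ℤ} (h : 0 ≤ i) (h' : i ≤ O.ρ.length) :
    O.bandOverlapProj k R (coneD R u μ j d (O.stringBasis k R i)) =
      (u i : k) • O.bandBasis k R (O.δ.length + 1 + i) := by
  rw [coneD_stringBasis, coefficient_overlap h h', one_smul, map_add, map_neg, map_add, map_smul,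
    map_smul, bandOverlapProj_stringBasis, bandOverlapProj_stringBasis, smul_map_basis,
    bandOverlapProj_overlap h h']
  simp

theorem coneHomotopy_coneD_coneHomotopy (x : O.Total k R) :
    O.coneHomotopy k R u (coneD R u μ j d (O.coneHomotopy k R u x)) = O.coneHomotopy k R u x := by
  refine total_ext (L := O.coneHomotopy k R u ∘ₗ coneD R u μ j d ∘ₗ O.coneHomotopy k R u)
    (L' := O.coneHomotopy k R u) ?_ ?_ ?_ x <;> intro i <;> simp only [LinearMap.comp_apply]
  · rw [coneHomotopy_stringBasis, map_zero, map_zero]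
  · intro h h'
    rw [coneHomotopy_outer u h h', map_zero, map_zero]
  · intro h h'
    rw [coneHomotopy_overlap u h h', smul_map_basis, smul_map_basis,
      coneHomotopy_coneD_stringBasis u μ j d h h']

theorem coneHomotopy_coneD_stringOverlapProj (x : O.Total k R) :
    O.coneHomotopy k R u (coneD R u μ j d (O.stringOverlapProj k R x)) =
      O.stringOverlapProj k R x := by
  refine total_ext (L := O.coneHomotopy k R u ∘ₗ coneD R u μ j d ∘ₗ O.stringOverlapProj k R)
    (L' := O.stringOverlapProj k R) ?_ ?_ ?_ x <;> intro i <;> simp only [LinearMap.comp_apply]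
  · rw [stringOverlapProj_stringBasis]
    split_ifs with h
    · exact coneHomotopy_coneD_stringBasis u μ j d h.1 h.2
    · rw [map_zero, map_zero]
  · intro h h'
    rw [stringOverlapProj_bandBasis, map_zero, map_zero]
  · intro h h'
    rw [stringOverlapProj_bandBasis, map_zero, map_zero]

theorem bandOverlapProj_coneD_coneHomotopy (x : O.Total k R) :
    O.bandOverlapProj k R (coneD R u μ j d (O.coneHomotopy k R u x)) =
      O.bandOverlapProj k R x := by
  refine total_ext (L := O.bandOverlapProj k R ∘ₗ coneD R u μ j d ∘ₗ O.coneHomotopy k R u)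
    (L' := O.bandOverlapProj k R) ?_ ?_ ?_ x <;> intro i <;> simp only [LinearMap.comp_apply]
  · rw [coneHomotopy_stringBasis, map_zero, map_zero, bandOverlapProj_stringBasis]
  · intro h h'
    rw [coneHomotopy_outer u h h', map_zero, map_zero, bandOverlapProj_outer h h']
  · intro h h'
    rw [coneHomotopy_overlap u h h', smul_map_basis, smul_map_basis,
      bandOverlapProj_coneD_stringBasis u μ j d h h', bandOverlapProj_overlap h h', smul_smul]
    simp

variable (R) in
/-- The projection onto the cone after elimination of the overlap. -/
noncomputable def reduction : O.Total k R →ₗ[BoundAlgebra k R] (ℤ →₀ BoundAlgebra k R) :=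
  O.coneProj k R - O.coneProj k R ∘ₗ coneD R u μ j d ∘ₗ O.coneHomotopy k R u

theorem reduction_stringBasis (m : ℤ) : reduction R u μ j d (O.stringBasis k R m) =
    if O.ρ.length < m then Finsupp.single (m - O.ρ.length + O.γ.length) 1
    else if m < 0 then Finsupp.single (m - O.δ.length) 1 else 0 := by
  rw [reduction, LinearMap.sub_apply, LinearMap.comp_apply, LinearMap.comp_apply,
    coneHomotopy_stringBasis, map_zero, map_zero, sub_zero, coneProj_stringBasis]

theorem reduction_outer {i : ℤ} (h : -O.δ.length ≤ i) (h' : i ≤ O.γ.length) :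
    reduction R u μ j d (O.bandBasis k R (-i)) = Finsupp.single i 1 := by
  rw [reduction, LinearMap.sub_apply, LinearMap.comp_apply, LinearMap.comp_apply,
    coneHomotopy_outer u h h', map_zero, map_zero, sub_zero, coneProj_outer h h']

/-- The sign of the zigzag cancels the sign of the shifted differential of σ. After projection only
steps that leave the overlap can survive. -/
theorem reduction_overlap {i : ℤ} (h : 0 ≤ i) (h' : i ≤ O.ρ.length) :
    reduction R u μ j d (O.bandBasis k R (O.δ.length + 1 + i)) =
    (((u i)⁻¹ : kˣ) : k) •
      (forward k R (O.sigma.letter i) • O.coneProj k R (O.stringBasis k R (i + 1)) +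
      backward k R (O.sigma.letter (i - 1)) • O.coneProj k R (O.stringBasis k R (i - 1))) := by
  rw [reduction, LinearMap.sub_apply, LinearMap.comp_apply, LinearMap.comp_apply,
    coneHomotopy_overlap u h h', smul_map_basis, smul_map_basis, coneD_stringBasis,
    coneProj_overlap h h', zero_sub, map_add, map_neg, map_add, map_smul, map_smul, smul_map_basis,
    map_smul, coneProj_overlap h h', smul_zero, smul_zero, add_zero, smul_neg, neg_neg]

section

variable (hO : O.IsGraphOverlap) (hR : IsGentle R) (hσ : O.sigma.IsHomotopyString R)
  (hτ : IsHomotopyBand R O.tau) (hor : O.CompatiblyOriented R)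
include hO hR hσ hτ hor

/-- For a trivial overlap a zigzag entering through τ_R could leave on the left through σ_L, giving
a component that c does not have. -/
theorem backward_τR_mul_backward_σL (hρ : O.ρ = []) :
    backward k R (some O.τR) * backward k R O.σL = 0 := by
  rw [← forward_inv k R O.σL]
  refine hO.right.backward_mul_forward k hR hO.left (IsGraphOverlap.isPath_σR hσ)
    (IsGraphOverlap.isPath_τR hτ) (IsGraphOverlap.isPath_σL hσ) (IsGraphOverlap.isPath_τL hτ)
    ?_ ?_ fun _ _ => hO.isPath_cL hR hσ hτ hor
  · simpa using IsGraphOverlap.adj_τL_τR hτ hρ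
  · intro l hl m hm
    obtain ⟨l', hl', rfl⟩ := Option.map_eq_some_iff.mp hl
    simpa using IsGraphOverlap.adj_σL_σR hσ hρ l' hl' m hm

theorem forward_τL_mul_forward_σR (hρ : O.ρ = []) :
    forward k R (some O.τL) * forward k R O.σR = 0 := by
  rw [← backward_inv]
  refine hO.left.backward_mul_forward k hR hO.right (IsGraphOverlap.isPath_σL hσ)
    (IsGraphOverlap.isPath_τL hτ) (IsGraphOverlap.isPath_σR hσ) (IsGraphOverlap.isPath_τR hτ)
    (IsGraphOverlap.adj_τL_τR hτ hρ).inv ?_ fun _ _ => hO.isPath_cR hR hσ hτ hor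
  intro m hm l hl
  obtain ⟨l', hl', rfl⟩ := Option.map_eq_some_iff.mp hl
  exact (IsGraphOverlap.adj_σL_σR hσ hρ l' hl' m hm).inv

/-- The zigzag through the right end of ρ. A step to the left in σ stays inside a nontrivial overlap
and is projected away; for a trivial overlap the preceding vanishing applies. The step along σ_R
yields c_R. -/
theorem backward_τR_smul_reduction :
    backward k R (some O.τR) •
      reduction R u μ j d (O.bandBasis k R (O.δ.length + 1 + O.ρ.length)) =
    (((u O.ρ.length)⁻¹ : kˣ) : k) • forward k R O.cR • Finsupp.single (O.γ.length + 1 : ℤ) 1 := by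
  have h2 : backward k R (some O.τR) • backward k R (O.sigma.letter (O.ρ.length - 1)) •
      O.coneProj k R (O.stringBasis k R (O.ρ.length - 1)) = 0 := by
    by_cases hρ : O.ρ = []
    · rw [smul_smul, hρ, show (([] : List (Letter V)).length : ℤ) - 1 = -1 by simp,
        sigma_letter_σL, backward_τR_mul_backward_σL hO hR hσ hτ hor hρ, zero_smul]
    · have := List.length_pos_iff.mpr hρ
      rw [coneProj_stringBasis, if_neg (by omega), if_neg (by omega), smul_zero, smul_zero]
  rw [reduction_overlap u μ j d (by omega) le_rfl, smul_comm, smul_add, h2, add_zero, smul_smul,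
    sigma_letter_σR, ← hO.right.forward_eq k, coneProj_stringBasis, if_pos (by omega),
    add_sub_cancel_left, add_comm (1 : ℤ)]

theorem forward_τL_smul_reduction :
    forward k R (some O.τL) • reduction R u μ j d (O.bandBasis k R (O.δ.length + 1)) =
    (((u 0)⁻¹ : kˣ) : k) • backward k R O.cL • Finsupp.single (-O.δ.length - 1 : ℤ) 1 := by
  have h1 : forward k R (some O.τL) • forward k R (O.sigma.letter 0) •
      O.coneProj k R (O.stringBasis k R (0 + 1)) = 0 := by
    by_cases hρ : O.ρ = []
    · have := O.sigma_letter_σR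
      rw [hρ, List.length_nil, Nat.cast_zero] at this
      rw [smul_smul, this, forward_τL_mul_forward_σR hO hR hσ hτ hor hρ, zero_smul]
    · have := List.length_pos_iff.mpr hρ
      rw [coneProj_stringBasis, if_neg (by omega), if_neg (by omega), smul_zero, smul_zero]
  have h2 : forward k R (some O.τL) * backward k R O.σL = backward k R O.cL := by
    rw [← forward_inv k R O.cL, hO.left.forward_eq k, forward_inv]
    congr 1
    exact (backward_inv k R (some O.τL)).symm
  have := reduction_overlap (O := O) (R := R) u μ j d (i := 0) le_rfl (by omega)
  rw [add_zero] at this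
  rw [this, smul_comm, smul_add, h1, zero_add, smul_smul, zero_sub,
    sigma_letter_σL, h2, coneProj_stringBasis, if_neg (by omega), if_pos (by omega),
    show -1 - (O.δ.length : ℤ) = -O.δ.length - 1 by ring]

end

/-- The scalars of the reduced mapping cone. -/
theorem exists_coneScalar (O : Overlap V) (R : Arrow V → Arrow V → Prop) (w v : ℤ → kˣ)
    (a b : kˣ) :
    ∃ s : ℤ → kˣ, (∀ i : ℤ, O.γ.length + 1 ≤ i → s i = -1) ∧
      (∀ i : ℤ, i ≤ -O.δ.length - 2 → s i = -1) ∧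
      (∀ i : ℤ, -O.δ.length ≤ i → i < O.γ.length → s i = w i) ∧
      (s O.γ.length : k) • forward k R O.cR = (a : k) • forward k R O.cR ∧
      (s O.γ.length : k) • backward k R O.cR = (v (O.ρ.length + 1) : k) • backward k R O.cR ∧
      (s (-O.δ.length - 1) : k) • backward k R O.cL = (b : k) • backward k R O.cL ∧
      (s (-O.δ.length - 1) : k) • forward k R O.cL = (v (-1) : k) • forward k R O.cL := by
  -- At c_R and c_L two scalars compete, one from a zigzag and one from a component of the graph
  -- map. The letter is direct or inverse but not both, so its orientation selects the relevant one.
  refine ⟨fun i => if O.γ.length + 1 ≤ i then -1 else if i ≤ -O.δ.length - 2 then -1 else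
    if i = O.γ.length then
      if O.cR.elim false Letter.direct then a else v (O.ρ.length + 1)
    else if i = -O.δ.length - 1 then
      if O.cL.elim false Letter.direct then v (-1) else b
    else w i, ?_, ?_, ?_, ?_, ?_, ?_, ?_⟩
  · intro i h
    simp only [if_pos h]
  · intro i h
    simp only [if_pos h, ite_self]
  · intro i h h'
    simp only
    rw [if_neg (by omega), if_neg (by omega), if_neg (by omega), if_neg (by omega)]
  · simp only
    rw [if_neg (by omega), if_neg (by omega), if_pos trivial]
    rcases O.cR with _ | ⟨_ | _, p⟩ <;> simp [forward]
  · simp only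
    rw [if_neg (by omega), if_neg (by omega), if_pos trivial]
    rcases O.cR with _ | ⟨_ | _, p⟩ <;> simp [backward]
  · simp only
    rw [if_neg (by omega), if_neg (by omega), if_neg (by omega), if_pos trivial]
    rcases O.cL with _ | ⟨_ | _, p⟩ <;> simp [backward]
  · simp only
    rw [if_neg (by omega), if_neg (by omega), if_neg (by omega), if_pos trivial]
    rcases O.cL with _ | ⟨_ | _, p⟩ <;> simp [forward]

end Overlap
end ConeDifferential

/-! ### The reduced mapping cone is the string complex of c -/

section ConeComplex

variable {k : Type u} [Field k] {V : Type u} [Fintype V] [Quiver.{u} V]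
  {R : Arrow V → Arrow V → Prop}

namespace Overlap

variable {O : Overlap V} (u : ℤ → kˣ) (μ : kˣ) (j : ZMod O.tau.length) (d : ℤ)

theorem bandBasis_congr {z w : ℤ} (h : (z : ZMod O.tau.length) = (w : ZMod O.tau.length)) :
    O.bandBasis k R z = O.bandBasis k R w := by
  rw [bandBasis, bandBasis, h]

/-- The core computation: position by position, what remains after elimination is the differential
of c with a unit on each letter. -/
theorem exists_row_eq_reduction (hO : O.IsGraphOverlap) (hR : IsGentle R)
    (hσ : O.sigma.IsHomotopyString R) (hτ : IsHomotopyBand R O.tau) (hor : O.CompatiblyOriented R) :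
    ∃ s : ℤ → kˣ, ∀ i : ℤ,
      (s i : k) • forward k R (O.cone.letter i) • Finsupp.single (i + 1) (1 : BoundAlgebra k R) +
        (s (i - 1) : k) • backward k R (O.cone.letter (i - 1)) • Finsupp.single (i - 1) 1 =
      reduction R u μ j d (coneD R u μ j d (O.coneIncl k R (Finsupp.single i 1))) := by
  -- Letters of σ carry −1 from the shift, and letters of the arc their band scalar. A zigzag
  -- carries the band scalar of τ_R or τ_L times the inverse unit of the graph map at the end of ρ
  -- it passes.
  obtain ⟨s, hs_right, hs_left, hs_mid, hsR, hsR', hsL, hsL'⟩ := exists_coneScalar (k := k) O R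
    (fun i => bandScalar μ j (-i - 1)) u
    (bandScalar μ j (O.δ.length + 1 + O.ρ.length) * (u O.ρ.length)⁻¹)
    (bandScalar μ j O.δ.length * (u 0)⁻¹)
  refine ⟨s, fun i => ?_⟩
  rcases le_or_gt (O.γ.length + 1 : ℤ) i with hi | hi
  · rw [coneIncl_right hi, coneD_stringBasis, map_add, map_neg, map_add, map_smul, map_smul,
      smul_map_basis, map_smul, reduction_stringBasis, if_pos (by omega), hO.cone_letter_right hi,
      hs_right i hi, show i - O.γ.length + O.ρ.length + 1 - O.ρ.length + O.γ.length = i + 1 by ring,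
      neg_add, Units.val_neg, Units.val_one, neg_smul, one_smul, add_assoc]
    congr 1
    -- At the far end of σ_R the step of σ back into the overlap is eliminated. Its place is taken
    -- by the component f_R, which is the inverse letter c_R.
    rcases eq_or_ne i (O.γ.length + 1) with rfl | h
    · have e : (O.γ.length + 1 - O.γ.length + O.ρ.length : ℤ) = O.ρ.length + 1 := by ring
      rw [e, add_sub_cancel_right, add_sub_cancel_right, reduction_stringBasis,
        if_neg (by omega), if_neg (by omega), smul_zero, neg_zero, zero_add, cone_letter_cR,
        coefficient_right hO, bandBasis_congr O.cast_succ_overlap,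
        reduction_outer u μ j d (by omega) le_rfl, ← smul_assoc, ← smul_assoc, hsR']
    · rw [reduction_stringBasis, if_pos (by omega), hO.cone_letter_right (by omega),
        coefficient_of_gt (by omega), hs_right _ (by omega), zero_smul, smul_zero, add_zero,
        Units.val_neg, Units.val_one, neg_smul, one_smul,
        show i - 1 - O.γ.length + O.ρ.length = i - O.γ.length + O.ρ.length - 1 by ring,
        show i - O.γ.length + O.ρ.length - 1 - O.ρ.length + O.γ.length = i - 1 by ring]
  rcases le_or_gt i (-O.δ.length - 1 : ℤ) with hi' | hi'
  · rw [coneIncl_left hi', coneD_stringBasis, map_add, map_neg, map_add, map_smul, map_smul,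
      smul_map_basis, map_smul, reduction_stringBasis _ _ _ _ (i + O.δ.length - 1),
      if_neg (by omega), if_pos (by omega), hO.cone_letter_left (i := i - 1) (by omega),
      hs_left (i - 1) (by omega), show i + O.δ.length - 1 - O.δ.length = i - 1 by ring,
      neg_add, Units.val_neg, Units.val_one, neg_smul, one_smul, add_comm (- _ : ℤ →₀ _) (- _),
      add_assoc, add_comm, show i - 1 + O.δ.length = i + O.δ.length - 1 by ring]
    congr 1
    rcases eq_or_ne i (-O.δ.length - 1) with rfl | h
    · have e : (-O.δ.length - 1 + O.δ.length : ℤ) = -1 := by ring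
      rw [e, neg_add_cancel, reduction_stringBasis, if_neg (by omega), if_neg (by omega), smul_zero,
        neg_zero, zero_add, cone_letter_cL, coefficient_left hO,
        show (O.δ.length + 1 + -1 : ℤ) = -(-O.δ.length : ℤ) by ring,
        reduction_outer u μ j d le_rfl (by omega), sub_add_cancel, ← smul_assoc, ← smul_assoc, hsL']
    · rw [reduction_stringBasis, if_neg (by omega), if_pos (by omega),
        hO.cone_letter_left (i := i) (by omega),
        coefficient_of_lt (by omega), hs_left _ (by omega), zero_smul, smul_zero, add_zero,
        Units.val_neg, Units.val_one, neg_smul, one_smul,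
        show i + O.δ.length + 1 - O.δ.length = i + 1 by ring]
  -- Since c runs through τ backwards, the two terms of the band differential change places.
  · rw [coneIncl_mid (by omega) (by omega), coneD_bandBasis, map_add, smul_map_basis,
      smul_map_basis, map_smul, map_smul, add_comm]
    congr 1
    -- At the left end of τ_L the direct step enters the overlap and becomes the zigzag giving c_L;
    -- elsewhere it stays on the arc.
    · rcases eq_or_ne i (-O.δ.length : ℤ) with rfl | h
      · rw [neg_neg, bandLetter_τL, forward_τL_smul_reduction u μ j d hO hR hσ hτ hor,
          cone_letter_cL, smul_smul, ← smul_assoc, hsL, smul_assoc, Units.val_mul]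
      · rw [show -i + 1 = -(i - 1) by ring, reduction_outer u μ j d (by omega) (by omega),
          hs_mid _ (by omega) (by omega), cone_letter_mid O (by omega) (by omega), backward_inv,
          show -(i - 1) - 1 = -i by ring]
    · rcases eq_or_ne i (O.γ.length : ℤ) with rfl | h
      · have e : (-O.γ.length - 1 + O.tau.length : ℤ) = O.δ.length + 1 + O.ρ.length := by
          rw [length_tau]; push_cast; ring
        have e' : ((-O.γ.length - 1 : ℤ) : ZMod O.tau.length) =
            ((O.δ.length + 1 + O.ρ.length : ℤ) : ZMod O.tau.length) := by
          rw [← intCast_add_length, e]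
        rw [← bandScalar_add_length, ← bandLetter_add_length, bandBasis_congr e', e, bandLetter_τR,
          backward_τR_smul_reduction u μ j d hO hR hσ hτ hor, cone_letter_cR, smul_smul,
          ← smul_assoc, hsR, smul_assoc, Units.val_mul]
      · rw [show -i - 1 = -(i + 1) by ring, reduction_outer u μ j d (by omega) (by omega),
          hs_mid _ (by omega) (by omega), cone_letter_mid O (by omega) (by omega), forward_inv,
          show -i - 1 = -(i + 1) by ring]

section Pieces

variable (hO : O.IsGraphOverlap) (hσ : O.sigma.IsHomotopyString R) (hτ : IsHomotopyBand R O.tau)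
  (hc : O.cone.IsHomotopyString R)

variable (R O) in
/-- The homogeneous pieces of the mapping cone. -/
noncomputable def conePiece (n : ℤ) : Submodule (BoundAlgebra k R) (O.Total k R) :=
  ((O.sigma.diagram k (O.sigmaDeg d)).piece R (n + 1)).prod
    ((bandDiagram k O.tau μ j d).piece R n)

theorem stringBasis_mem {n m : ℤ} {x : Option V} (c : k) (hx : O.sigma.label m = x)
    (hn : O.sigma.deg (O.sigmaDeg d) m = n + 1) :
    idemElt k R x • c • O.stringBasis k R m ∈ conePiece R O μ j d n := by
  refine ⟨?_, by simp [stringBasis]⟩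
  have := Diagram.idemElt_smul_single_mem (R := R) (D := O.sigma.diagram k (O.sigmaDeg d)) c hx hn
  simpa [stringBasis] using this

theorem bandBasis_mem {n z : ℤ} {x : Option V}
    (hx : (bandDiagram k O.tau μ j d).label (z : ZMod O.tau.length) = x)
    (hn : (bandDiagram k O.tau μ j d).deg (z : ZMod O.tau.length) = n) :
    idemElt k R x • O.bandBasis k R z ∈ conePiece R O μ j d n := by
  refine ⟨by simp [bandBasis], ?_⟩
  have := Diagram.idemElt_smul_single_mem (R := R) 1 hx hn
  simpa [bandBasis] using this

include hO hσ hτ hc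

theorem coneIncl_mem (n : ℤ) (x : ℤ →₀ BoundAlgebra k R) (hx : x ∈ (O.cone.diagram k d).piece R n) :
    O.coneIncl k R x ∈ conePiece R O μ j d n := by
  refine Diagram.map_mem_of_single hx _ _ fun i hl hn => ?_
  change idemElt k R (O.cone.label i) • _ ∈ _
  change O.cone.label i ≠ none at hl
  change O.cone.deg d i = n at hn
  rcases le_or_gt (O.γ.length + 1 : ℤ) i with hi | hi
  · rw [coneIncl_right hi, ← one_smul k (O.stringBasis k R _)]
    exact stringBasis_mem μ j d 1 (right_label hO hσ hτ hi).symm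
      (by rw [right_deg k d hO hσ hτ hc hi hl, hn])
  rcases le_or_gt i (-O.δ.length - 1 : ℤ) with hi' | hi'
  · rw [coneIncl_left hi', ← one_smul k (O.stringBasis k R _)]
    exact stringBasis_mem μ j d 1 (left_label hO hσ hτ hi').symm
      (by rw [left_deg k d hO hσ hτ hc hi' hl, hn])
  · obtain ⟨h1, h2⟩ := mid_label_deg k μ j d hO hτ hc (i := i) (by omega) (by omega)
    rw [coneIncl_mid (by omega) (by omega)]
    exact bandBasis_mem μ j d h1.symm (h2.symm.trans hn)

theorem coneProj_mem (n : ℤ) (x : O.Total k R) (hx : x ∈ conePiece R O μ j d n) :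
    O.coneProj k R x ∈ (O.cone.diagram k d).piece R n := by
  have key : ∀ {i : ℤ} {y : Option V}, O.cone.label i = y → O.cone.deg d i = n →
      idemElt k R y • Finsupp.single i (1 : BoundAlgebra k R) ∈
        (O.cone.diagram k d).piece R n := by
    intro i y h1 h2
    have := Diagram.idemElt_smul_single_mem (R := R) (D := O.cone.diagram k d) 1 h1 h2
    rwa [one_smul] at this
  have e : x = LinearMap.inl (BoundAlgebra k R) _ _ x.1 +
    LinearMap.inr (BoundAlgebra k R) _ _ x.2 := by simp
  rw [e, map_add]
  refine Submodule.add_mem _ ?_ ?_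
  · refine Diagram.map_mem_of_single hx.1 (O.coneProj k R ∘ₗ LinearMap.inl (BoundAlgebra k R) _ _) _
      fun m hl hn => ?_
    change idemElt k R (O.sigma.label m) • O.coneProj k R (O.stringBasis k R m) ∈ _
    change O.sigma.label m ≠ none at hl
    change O.sigma.deg (O.sigmaDeg d) m = n + 1 at hn
    rw [coneProj_stringBasis]
    split_ifs with h h'
    · have h1 := right_label hO hσ hτ (i := m - O.ρ.length + O.γ.length) (by omega)
      have h2 := right_deg k d hO hσ hτ hc (i := m - O.ρ.length + O.γ.length) (by omega)
      rw [show m - O.ρ.length + O.γ.length - O.γ.length + O.ρ.length = m by ring] at h1 h2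
      refine key h1 ?_
      have := h2 (by rwa [h1])
      omega
    · have h1 := left_label hO hσ hτ (i := m - O.δ.length) (by omega)
      have h2 := left_deg k d hO hσ hτ hc (i := m - O.δ.length) (by omega)
      rw [sub_add_cancel] at h1 h2
      refine key h1 ?_
      have := h2 (by rwa [h1])
      omega
    · rw [smul_zero]
      exact Submodule.zero_mem _
  · refine Diagram.map_mem_of_single hx.2 (O.coneProj k R ∘ₗ LinearMap.inr (BoundAlgebra k R) _ _) _
      fun t hl hn => ?_
    rcases O.outer_or_overlap t with ⟨i, h, h', rfl⟩ | ⟨i, h, h', rfl⟩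
    · obtain ⟨h1, h2⟩ := mid_label_deg k μ j d hO hτ hc h h'
      change _ • O.coneProj k R (O.bandBasis k R (-i)) ∈ _
      rw [coneProj_outer h h']
      exact key h1 (h2.trans hn)
    · change _ • O.coneProj k R (O.bandBasis k R (O.δ.length + 1 + i)) ∈ _
      rw [coneProj_overlap h h', smul_zero]
      exact Submodule.zero_mem _

omit hc in
theorem coneHomotopy_mem (n : ℤ) (x : O.Total k R) (hx : x ∈ conePiece R O μ j d (n + 1)) :
    O.coneHomotopy k R u x ∈ conePiece R O μ j d n := by
  have e : O.coneHomotopy k R u x =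
      (O.coneHomotopy k R u ∘ₗ LinearMap.inr (BoundAlgebra k R) _ _) x.2 := rfl
  rw [e]
  refine Diagram.map_mem_of_single hx.2 _ _ fun t hl hn => ?_
  rcases O.outer_or_overlap t with ⟨i, h, h', rfl⟩ | ⟨i, h, h', rfl⟩
  · change _ • O.coneHomotopy k R u (O.bandBasis k R (-i)) ∈ _
    rw [coneHomotopy_outer u h h', smul_zero]
    exact Submodule.zero_mem _
  · change _ • O.coneHomotopy k R u (O.bandBasis k R (O.δ.length + 1 + i)) ∈ _
    rw [coneHomotopy_overlap u h h']
    obtain ⟨m, rfl⟩ := Int.eq_ofNat_of_zero_le h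
    obtain ⟨h1, h2⟩ := overlap_label_deg k μ j d hO hσ hτ (i := m) (by omega)
    exact stringBasis_mem μ j d _ h1 (h2.trans hn)

end Pieces

section GraphMap

variable (hO : O.IsGraphOverlap) (hσ : O.sigma.IsHomotopyString R) (hτ : IsHomotopyBand R O.tau)

include hO hσ hτ

omit [Fintype V] in
theorem sigma_label_right {c : Letter V} (hcR : O.cR = some c) :
    O.sigma.label (O.ρ.length + 1) = c.rightEnd := by
  rcases hσR : O.σR with _ | s
  · rw [hO.cR_eq_none.mpr hσR] at hcR
    cases hcR
  · rw [Word.label_add_one _ (by omega), sigma_letter_σR, hσR]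
    exact (hO.right.rightEnd_eq (IsGraphOverlap.isPath_σR hσ) (IsGraphOverlap.isPath_τR hτ)
      hσR hcR).symm

omit [Fintype V] in
theorem sigma_label_left {c : Letter V} (hcL : O.cL = some c) :
    O.sigma.label (-1) = c.leftEnd := by
  rcases hσL : O.σL with _ | s
  · rw [hO.cL_eq_none.mpr hσL] at hcL
    cases hcL
  · rw [Word.label_of_neg _ (by omega), sigma_letter_σL, hσL]
    have := hO.left.rightEnd_eq (l := s.inv) (m := c.inv) (IsGraphOverlap.isPath_σL hσ)
      (IsGraphOverlap.isPath_τL hτ) (by rw [hσL]; rfl) (by rw [hcL]; rfl)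
    rw [Letter.rightEnd_inv, Letter.rightEnd_inv] at this
    exact this.symm

variable (hR : IsGentle R) (hor : O.CompatiblyOriented R)
include hR hor

/-- The paths f_L and f_R already absorb the idempotent on their left, so replacing idempotents by 1
changes the graph map on the overlap only. -/
theorem idemElt_mul_coefficient {i : ℤ} (h : ¬ (0 ≤ i ∧ i ≤ O.ρ.length)) :
    idemElt k R (O.sigma.label i) * O.coefficient k R i = O.coefficient k R i := by
  rcases eq_or_ne i (O.ρ.length + 1) with rfl | h1
  · rw [coefficient_right hO]
    rcases hcR : O.cR with _ | c
    · simp [backward]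
    · rw [sigma_label_right hO hσ hτ hcR,
        idemElt_mul_backward k (hO.isPath_cR hR hσ hτ hor c hcR).1]
  rcases eq_or_ne i (-1) with rfl | h2
  · rw [coefficient_left hO]
    rcases hcL : O.cL with _ | c
    · simp [forward]
    · rw [sigma_label_left hO hσ hτ hcL, idemElt_mul_forward k (l := c)
        (hO.isPath_cL hR hσ hτ hor c.inv (by rw [hcL]; rfl)).1]
  · rw [coefficient, if_neg h, if_neg h1, if_neg h2, mul_zero]

theorem component_eq (i : ℤ) :
    O.component k R i = idemElt k R (O.sigma.label i) * O.coefficient k R i := by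
  by_cases h : 0 ≤ i ∧ i ≤ O.ρ.length
  · rw [component, if_pos h, coefficient, if_pos h, mul_one]
  · rw [idemElt_mul_coefficient hO hσ hτ hR hor h, component, coefficient, if_neg h, if_neg h]

/-- On homogeneous elements, the idempotents in the components of the graph map can be replaced
by `1`. -/
theorem graphMap_apply {n : ℤ} {z : ℤ →₀ BoundAlgebra k R}
    (hz : z ∈ (O.sigma.diagram k (O.sigmaDeg d)).piece R n) :
    O.graphMap k R u z = Finsupp.linearCombination (BoundAlgebra k R)
        (fun i : ℤ => Finsupp.single ((O.δ.length + 1 + i : ℤ) : ZMod O.tau.length)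
          ((u i : k) • O.component k R i)) z := by
  rw [Finsupp.linearCombination_apply, Diagram.linearMap_apply_eq hz]
  refine Finsupp.sum_congr fun i _ => ?_
  change z i • idemElt k R (O.sigma.label i) • _ = _
  rw [component_eq hO hσ hτ hR hor]
  simp [graphMap]

/-- Used to extend the chain map identity from the pieces to the free modules: after applying the
differential, no trace is left of the idempotents replaced by 1. -/
theorem idemElt_smul_differential_graphMap (i : ℤ) :
    idemElt k R (O.sigma.label i) • (bandDiagram k O.tau μ j d).differential R
        (O.graphMap k R u (Finsupp.single i 1)) =
      (bandDiagram k O.tau μ j d).differential R (O.graphMap k R u (Finsupp.single i 1)) := by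
  have e : (bandDiagram k O.tau μ j d).differential R (O.graphMap k R u (Finsupp.single i 1)) =
      (u i : k) • O.coefficient k R i •
        (bandDiagram k O.tau μ j d).row R ((O.δ.length + 1 + i : ℤ) : ZMod O.tau.length) := by
    simp [graphMap, Diagram.differential]
  rw [e, smul_comm, smul_smul]
  by_cases h : 0 ≤ i ∧ i ≤ O.ρ.length
  · obtain ⟨m, rfl⟩ := Int.eq_ofNat_of_zero_le h.1
    have h1 := (overlap_label_deg k μ j d hO hσ hτ (i := m) (by omega)).1
    rw [coefficient_overlap h.1 h.2, mul_one, one_smul, h1,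
      (bandDiagram_valid k hτ μ j d).idemElt_smul_row]
  · rw [idemElt_mul_coefficient hO hσ hτ hR hor h]

end GraphMap

/-- The mapping cone of a graph map from a string complex to a band complex is homotopy equivalent to
the string complex of the cone. -/
theorem nonempty_homotopyEquiv (hR : IsGentle R)
    (hσ : O.sigma.IsHomotopyString R) (hτ : IsHomotopyBand R O.tau) (hO : O.IsGraphOverlap)
    (hor : O.CompatiblyOriented R) (hc : O.cone.IsHomotopyString R)
    (f : stringComplex k O.sigma hσ (d + signSum (O.δ ++ [O.τL])) ⟶ bandComplex k O.tau hτ μ j d)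
    (hf : O.IsGraphMap k f) :
    Nonempty (HomotopyEquiv (CochainComplex.mappingCone f) (stringComplex k O.cone hc d)) := by
  obtain ⟨u, hu⟩ := hf
  have hvσ := Word.diagram_valid k hσ (O.sigmaDeg d)
  have hvτ := bandDiagram_valid k hτ μ j d
  let S := Diagram.graded hvσ
  let B := Diagram.graded hvτ
  let φ : S.complex ⟶ B.complex := f
  have hφ : ∀ n (z : S.piece n), ((φ.f n).hom z : B.piece n).1 = O.graphMap k R u z.1 := by
    intro n z
    rw [graphMap_apply u d hO hσ hτ hR hor z.2]
    exact hu n z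
  have hF : ∀ n, ∀ x ∈ S.piece n, O.graphMap k R u x ∈ B.piece n := by
    intro n x hx
    rw [← hφ n ⟨x, hx⟩]
    exact ((φ.f n).hom ⟨x, hx⟩ : B.piece n).2
  -- The given `f` commutes with differentials on homogeneous elements only. The identity is
  -- evaluated at the idempotent of each position, and the idempotent is then absorbed on both
  -- sides.
  have hd : ∀ x, O.graphMap k R u (S.d x) = B.d (O.graphMap k R u x) := by
    refine eq_of_single (L := O.graphMap k R u ∘ₗ S.d) (L' := B.d ∘ₗ O.graphMap k R u) fun i => ?_
    simp only [LinearMap.comp_apply]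
    have hz : idemElt k R (O.sigma.label i) • Finsupp.single i (1 : BoundAlgebra k R) ∈
        S.piece (O.sigma.deg (O.sigmaDeg d) i) := by
      have := Diagram.idemElt_smul_single_mem (R := R) (D := O.sigma.diagram k (O.sigmaDeg d))
        (i := i) 1 rfl rfl
      rwa [one_smul] at this
    have h1 := congrArg (fun y : B.piece (O.sigma.deg (O.sigmaDeg d) i + 1) => y.1)
      (ConcreteCategory.congr_hom (φ.comm (O.sigma.deg (O.sigmaDeg d) i)
        (O.sigma.deg (O.sigmaDeg d) i + 1)) (⟨_, hz⟩ : S.piece _))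
    have h2 : B.d (O.graphMap k R u
        (idemElt k R (O.sigma.label i) • Finsupp.single i (1 : BoundAlgebra k R))) =
        O.graphMap k R u (S.d
          (idemElt k R (O.sigma.label i) • Finsupp.single i (1 : BoundAlgebra k R))) := by
      rw [S.complex_d, B.complex_d] at h1
      refine Eq.trans ?_ (h1.trans ?_)
      · exact congrArg B.d (hφ _ ⟨_, hz⟩).symm
      · exact hφ _ ⟨_, S.mem _ _ hz⟩
    have h3 : idemElt k R (O.sigma.label i) • S.d (Finsupp.single i 1) =
        S.d (Finsupp.single i 1) := by
      change _ • (O.sigma.diagram k (O.sigmaDeg d)).differential R _ =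
        (O.sigma.diagram k (O.sigmaDeg d)).differential R _
      rw [Diagram.differential_single]
      exact hvσ.idemElt_smul_row i
    rw [map_smul, map_smul, map_smul, h3] at h2
    rw [← h2]
    exact idemElt_smul_differential_graphMap u μ j d hO hσ hτ hR hor i
  have hφ' : ∀ n, φ.f n = S.map B (O.graphMap k R u) (hF n) := by
    intro n
    ext z
    exact Subtype.ext (hφ n z)
  let M := S.cone B (O.graphMap k R u) hF hd
  have iso : CochainComplex.mappingCone f ≅ M.complex :=
    S.mappingConeIso B (O.graphMap k R u) hF hd φ hφ'
  have hMd : ∀ x, M.d x = coneD R u μ j d x := fun x => rfl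
  obtain ⟨s, hs⟩ := exists_row_eq_reduction u μ j d hO hR hσ hτ hor
  have hvc := Word.diagram_valid k hc d
  -- The elimination produces c with the scalars `s`, and rescaling then turns them into 1.
  let D : Diagram k V ℤ := { O.cone.diagram k d with scalar := fun i => s i }
  have hD : D.Valid R := ⟨hvc.isPath, hvc.leftEnd, hvc.rightEnd, hvc.deg, hvc.adj⟩
  obtain ⟨iso'⟩ := Diagram.nonempty_iso_of_scalar hD hvc rfl rfl rfl s (fun _ => 1)
    (fun _ => rfl) (fun _ => by simp [Word.diagram])
  have e : HomotopyEquiv M.complex (Diagram.graded hD).complex :=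
    (Diagram.graded hD).homotopyEquiv M (O.coneHomotopy k R u) (O.coneIncl k R) (O.coneProj k R)
      (O.stringOverlapProj k R) (O.bandOverlapProj k R)
      (coneHomotopy_mem u μ j d hO hσ hτ)
      (coneIncl_mem μ j d hO hσ hτ hc)
      (coneProj_mem μ j d hO hσ hτ hc)
      (coneHomotopy_coneHomotopy u)
      (coneHomotopy_coneD_coneHomotopy u μ j d)
      (coneHomotopy_coneIncl u) (coneProj_coneHomotopy u) coneProj_coneIncl decomp
      (coneHomotopy_stringOverlapProj u) (coneHomotopy_coneD_stringOverlapProj u μ j d)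
      (bandOverlapProj_coneHomotopy u) (bandOverlapProj_coneD_coneHomotopy u μ j d)
      (eq_of_single (L := (Diagram.graded hD).d)
        (L' := reduction R u μ j d ∘ₗ coneD R u μ j d ∘ₗ O.coneIncl k R) fun i => by
          change D.differential R _ = _
          rw [Diagram.differential_single, Diagram.row_eq]
          exact hs i)
  exact ⟨(HomotopyEquiv.ofIso iso).trans (e.trans (HomotopyEquiv.ofIso iso'))⟩

end Overlap
end ConeComplex

end GentleCone

/-! ### Transport along the Morita equivalence -/

theorem mainTheorem9 {k : Type u} [Field k] [IsAlgClosed k]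
    {V : Type u} [Fintype V] [Quiver.{u} V]
    (R : GentleCone.Arrow V → GentleCone.Arrow V → Prop) (hR : GentleCone.IsGentle R)
    (Λ : Type u) [Ring Λ] [Algebra k Λ]
    (E : MoritaEquivalence k (GentleCone.BoundAlgebra k R) Λ)
    (O : GentleCone.Overlap V)
    (hσ : O.sigma.IsHomotopyString R) (hτ : GentleCone.IsHomotopyBand R O.tau)
    (hO : O.IsGraphOverlap) (hor : O.CompatiblyOriented R)
    (μ : kˣ) (j : ZMod O.tau.length) (d : ℤ)
    (f : GentleCone.stringComplex k O.sigma hσ (d + GentleCone.signSum (O.δ ++ [O.τL])) ⟶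
      GentleCone.bandComplex k O.tau hτ μ j d)
    (hf : O.IsGraphMap k f) :
    ∃ hc : O.cone.IsHomotopyString R,
      Nonempty
        ((HomotopyCategory.quotient (ModuleCat.{u} Λ) (ComplexShape.up ℤ)).obj
            (CochainComplex.mappingCone
              ((E.eqv.functor.mapHomologicalComplex (ComplexShape.up ℤ)).map f)) ≅
          (HomotopyCategory.quotient (ModuleCat.{u} Λ) (ComplexShape.up ℤ)).obj
            ((E.eqv.functor.mapHomologicalComplex (ComplexShape.up ℤ)).obj
              (GentleCone.stringComplex k O.cone hc d))) := by
  have hc := hO.isHomotopyString hR hσ hτ hor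
  obtain ⟨e⟩ := GentleCone.Overlap.nonempty_homotopyEquiv μ j d hR hσ hτ hO hor hc f hf
  refine ⟨hc, ⟨?_⟩⟩
  -- The equivalence, being additive, commutes with mapping cones and preserves homotopy
  -- equivalences, so the result for `BoundAlgebra k R` passes to `Λ`.
  exact (HomotopyCategory.quotient (ModuleCat.{u} Λ) (ComplexShape.up ℤ)).mapIso
      (CochainComplex.mappingCone.mapHomologicalComplexIso f E.eqv.functor).symm ≪≫
    HomotopyCategory.isoOfHomotopyEquiv (E.eqv.functor.mapHomotopyEquiv e)
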